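/- Conventions. Let $\Bbbk$ be a commutative ring, $G$ a group, and $\mathcal{C}$ a $G$-graded pivotal category over $\Bbbk$: a $\Bbbk$-additive monoidal category (with $\Bbbk$-bilinear $\otimes$) with chosen duals $X^*$ and morphisms $\mathrm{ev}_X\colon X^*\otimes X\to\mathbb 1$, $\mathrm{coev}_X\colon\mathbb 1\to X\otimes X^*$, $\widetilde{\mathrm{ev}}_X\colon X\otimes X^*\to\mathbb 1$, $\widetilde{\mathrm{coev}}_X\colon \mathbb 1\to X^*\otimes X$ whose left and right duality functors coincide as monoidal functors, together with full additive subcategories $\mathcal{C}_\alpha$ ($\alpha\in G$), closed under isomorphism, such that every object is a finite direct sum of objects of distinct $\mathcal{C}_\alpha$'s, $\mathrm{Hom}(X,Y)=0$ for $X\in\mathcal{C}_\alpha$, $Y\in\mathcal{C}_\beta$, $\alpha\ne\beta$, $\mathbb 1\in\mathcal{C}_1$ and $\mathcal{C}_\alpha\otimes\mathcal{C}_\beta\subset\mathcal{C}_{\alpha\beta}$. (Associativity, unit and duality constraints are suppressed in formulas.) Assume that $\mathcal{C}$ is non-singular: $r\otimes\mathrm{id}_X=\mathrm{id}_X\otimes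 r$ for all $r\in\mathrm{End}(\mathbb 1)$ and all $X$, all idempotents split, and every $\mathcal{C}_\alpha$ contains an object $V$ whose left dimension $d_V=\mathrm{ev}_V\widetilde{\mathrm{coev}}_V$ is invertible. Assume also that $\mathcal{C}$ is $G$-centralizable: the coends $Z_\alpha(X)=\int^{Y\in\mathcal{C}_\alpha}Y^*\otimes X\otimes Y$ exist for all $\alpha\in G$, $X\in\mathcal{C}$; let $\rho^\alpha_{X,Y}\colon Y^*\otimes X\otimes Y\to Z_\alpha(X)$ be their universal dinatural transformations and $\partial^\alpha_{X,Y}=(\mathrm{id}_Y\otimes\rho^\alpha_{X,Y})(\mathrm{coev}_Y\otimes\mathrm{id}_{X\otimes Y})\colon X\otimes Y\to Y\otimes Z_\alpha(X)$. The universal property makes $Z_\alpha$ a functor and defines natural morphisms $(Z_\alpha)_2(X_1,X_2)\colon Z_\alpha(X_1\otimes X_2)\to Z_\alpha(X_1)\otimes Z_\alpha(X_2)$, $Z_2(\alpha,\beta)_X\colon Z_\alpha Z_\beta(X)\to Z_{\beta\alpha}(X)$ and $s^l_X\colon Z_1(Z_1(X)^*)\to X^*$ by $$(\mathrm{id}_Y\otimes(Z_\alpha)_2(X_1,X_2))\,\partial^\alpha_{X_1\otimes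 X_2,Y}=(\partial^\alpha_{X_1,Y}\otimes\mathrm{id})(\mathrm{id}_{X_1}\otimes\partial^\alpha_{X_2,Y}),$$ $$(\mathrm{id}_{Y'\otimes Y}\otimes Z_2(\alpha,\beta)_X)(\mathrm{id}_{Y'}\otimes\partial^\alpha_{Z_\beta(X),Y})(\partial^\beta_{X,Y'}\otimes\mathrm{id}_Y)=\partial^{\beta\alpha}_{X,Y'\otimes Y},$$ $$(\mathrm{id}_Y\otimes s^l_X)\,\partial^1_{Z_1(X)^*,Y}=(\mathrm{ev}_{Z_1(X)}\otimes\mathrm{id})(\mathrm{id}\otimes\widetilde{\mathrm{ev}}_Y\otimes\mathrm{id})(\mathrm{id}\otimes\partial^1_{X,Y^*}\otimes\mathrm{id})(\mathrm{id}\otimes\widetilde{\mathrm{coev}}_Y\otimes\mathrm{id}_{X^*})(\mathrm{id}\otimes\mathrm{coev}_X),$$ where the morphisms in the last line run through $Z_1(X)^*\otimes Y\to Z_1(X)^*YXX^*\to Z_1(X)^*YXY^*YX^*\to Z_1(X)^*YY^*Z_1(X)YX^*\to Z_1(X)^*Z_1(X)YX^*\to Y\otimes X^*$. Let $\mathcal{Z}_G(\mathcal{C})$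 be the center of $\mathcal{C}$ relative to $\mathcal{C}_1$: its objects are pairs $(A,\sigma)$ with $\sigma=\{\sigma_X\colon A\otimes X\to X\otimes A\}_{X\in\mathcal{C}_1}$ a natural family of isomorphisms with $\sigma_{X\otimes Y}=(\mathrm{id}_X\otimes\sigma_Y)(\sigma_X\otimes\mathrm{id}_Y)$; it has the usual tensor products and duals, and $\mathcal{Z}_\alpha(\mathcal{C})$ is its full subcategory of pairs with $A\in\mathcal{C}_\alpha$. For $V\in\mathcal{C}_\alpha$ with $d_V$ invertible, let $\varphi_V(A,\sigma)$ be the image of the idempotent of $V^*\otimes A\otimes V$ given by $d_V^{-1}$ times the composite $V^*AV\to V^*A(VV^*)V\to V^*(VV^*)AV\to V^*AV$ of $\widetilde{\mathrm{coev}}_V$, $\sigma_{V\otimes V^*}$ and $\mathrm{ev}_V$, with the half braiding induced by the analogous morphisms with $\sigma_{V\otimes X\otimes V^*}$, $X\in\mathcal{C}_1$. The functors $\varphi_V$ are related by canonical isomorphisms $\varphi_V\to\varphi_U$, induced by $d_V^{-1}$ times the analogous morphisms with $\sigma_{V\otimes U^*}$; let $\varphi_\alpha\colon\mathcal{Z}_G(\mathcal{C})\to\mathcal{Z}_G(\mathcal{C})$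 be the projective limit of this system. **Theorem.** Let $\alpha,\beta\in G$. (1) Suppose that the coend $C_{\alpha,\beta}=\int^{Y\in\mathcal{C}_\beta}Z_\alpha(Y)^*\otimes Y$ exists in $\mathcal{C}$, with universal dinatural transformation $\varrho_Y\colon Z_\alpha(Y)^*\otimes Y\to C_{\alpha,\beta}$. Then there is a unique morphism $r\colon Z_1(C_{\alpha,\beta})\to C_{\alpha,\beta}$ such that for all $Y\in\mathcal{C}_\beta$ $$r\,Z_1(\varrho_Y)=\varrho_{Z_1(Y)}\bigl(Z_2(\alpha,1)_Y^*\;s^l_{Z_\alpha(Y)}\;Z_1(Z_2(1,\alpha)_Y^*)\otimes\mathrm{id}_{Z_1(Y)}\bigr)(Z_1)_2(Z_\alpha(Y)^*,Y);$$ the morphisms $\sigma^{\alpha,\beta}_X=(\mathrm{id}_X\otimes r)\,\partial^1_{C_{\alpha,\beta},X}$, $X\in\mathcal{C}_1$, form a half braiding of $C_{\alpha,\beta}$ relative to $\mathcal{C}_1$; the object $(C_{\alpha,\beta},\sigma^{\alpha,\beta})$ of $\mathcal{Z}_G(\mathcal{C})$ lies in $\mathcal{Z}_{\alpha^{-1}\beta^{-1}\alpha\beta}(\mathcal{C})$;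 and it is the coend in $\mathcal{Z}_G(\mathcal{C})$ $$(C_{\alpha,\beta},\sigma^{\alpha,\beta})=\int^{(A,\sigma)\in\mathcal{Z}_\beta(\mathcal{C})}\varphi_\alpha(A,\sigma)^*\otimes(A,\sigma).$$ (2) Call an object $i$ simple if $\mathrm{End}(i)$ is a free $\Bbbk$-module of rank $1$. Suppose moreover that $\mathcal{C}$ is $G$-fusion: $\mathbb 1$ is simple, every object is a finite direct sum of simple objects, there are no nonzero morphisms between non-isomorphic simple objects, and each $\mathcal{C}_\gamma$ contains a simple object and has finitely many isomorphism classes of simple objects. Let $I=\coprod_\gamma I_\gamma$, $I_\gamma\subset\mathcal{C}_\gamma$, be a set of simple objects containing exactly one object of each isomorphism class. Then the coend of (1) exists and is $$C_{\alpha,\beta}=\bigoplus_{i\in I_\alpha,\,j\in I_\beta}i^*\otimes j^*\otimes i\otimes j,$$ with universal dinatural transformation $$\varrho_Y=\sum_{i\in I_\alpha}\sum_b\bigl(\mathrm{id}_{i^*}\otimes q_b^*\otimes\phi_i^{-1}\otimes p_b\bigr)\bigl((\rho^\alpha_{Y,i})^*\otimes\mathrm{id}_Y\bigr),$$ followed by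 the inclusion of the summands $i^*\otimes j_b^*\otimes i\otimes j_b$. Here $(p_b\colon Y\to j_b,\ q_b\colon j_b\to Y)_b$ is any finite family with $j_b\in I_\beta$, $p_bq_c=\delta_{b,c}\,\mathrm{id}$ and $\sum_b q_bp_b=\mathrm{id}_Y$, the target $(i^*\otimes Y\otimes i)^*$ of $(\rho^\alpha_{Y,i})^*$ is identified with $i^*\otimes Y^*\otimes i^{**}$, and $\phi_i\colon i\to i^{**}$ is the pivotal structure. -/

import Mathlib

open CategoryTheory MonoidalCategory Limits Opposite

noncomputable section

namespace GrCen

universe v u w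

section Pivotal

/-- A pivotal category: every object `X` has a chosen object `dual X` which is at the same time
a left dual (through `ev`, `coev`) and a right dual (through `evt`, `coevt`) of `X`, and the two
resulting duality functors coincide as monoidal functors: on morphisms (`dual_hom`), on the
tensor constraints (`dual_tensor`) and on the unit constraints (`dual_unit`). -/
class PivotalCategory (C : Type u) [Category.{v} C] [MonoidalCategory C] where
  dual : C → C
  ev (X : C) : dual X ⊗ X ⟶ 𝟙_ C
  coev (X : C) : 𝟙_ C ⟶ X ⊗ dual X
  evt (X : C) : X ⊗ dual X ⟶ 𝟙_ C
  coevt (X : C) : 𝟙_ C ⟶ dual X ⊗ X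
  coev_ev (X : C) :
    dual X ◁ coev X ≫ (α_ _ _ _).inv ≫ ev X ▷ dual X = (ρ_ _).hom ≫ (λ_ _).inv
  ev_coev (X : C) :
    coev X ▷ X ≫ (α_ _ _ _).hom ≫ X ◁ ev X = (λ_ X).hom ≫ (ρ_ X).inv
  coevt_evt (X : C) :
    X ◁ coevt X ≫ (α_ _ _ _).inv ≫ evt X ▷ X = (ρ_ _).hom ≫ (λ_ _).inv
  evt_coevt (X : C) :
    coevt X ▷ dual X ≫ (α_ _ _ _).hom ≫ dual X ◁ evt X = (λ_ _).hom ≫ (ρ_ _).inv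
  dual_hom {X Y : C} (f : X ⟶ Y) :
    (ρ_ (dual Y)).inv ≫ dual Y ◁ coev X ≫ dual Y ◁ f ▷ dual X ≫ (α_ _ _ _).inv ≫
        ev Y ▷ dual X ≫ (λ_ _).hom =
      (λ_ (dual Y)).inv ≫ coevt X ▷ dual Y ≫ (dual X ◁ f) ▷ dual Y ≫ (α_ _ _ _).hom ≫
        dual X ◁ evt Y ≫ (ρ_ _).hom
  dual_tensor (X Y : C) :
    (𝟙 (dual X ⊗ dual Y) ⊗≫ (dual X ⊗ dual Y) ◁ coev (Y ⊗ X) ⊗≫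
        dual X ◁ ev Y ▷ (X ⊗ dual (Y ⊗ X)) ⊗≫ ev X ▷ dual (Y ⊗ X) ⊗≫
        𝟙 (dual (Y ⊗ X)) : dual X ⊗ dual Y ⟶ dual (Y ⊗ X)) =
      𝟙 (dual X ⊗ dual Y) ⊗≫ coevt (Y ⊗ X) ▷ (dual X ⊗ dual Y) ⊗≫
        (dual (Y ⊗ X) ⊗ Y) ◁ evt X ▷ dual Y ⊗≫ dual (Y ⊗ X) ◁ evt Y ⊗≫ 𝟙 (dual (Y ⊗ X))
  dual_unit : coev (𝟙_ C) ≫ (λ_ (dual (𝟙_ C))).hom = coevt (𝟙_ C) ≫ (ρ_ (dual (𝟙_ C))).hom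

variable {C : Type u} [Category.{v} C] [MonoidalCategory C] [PivotalCategory C]

open PivotalCategory

/-- `dual X` is a left dual of `X`. -/
abbrev leftPairing (X : C) : ExactPairing X (dual X) where
  coevaluation' := coev X
  evaluation' := ev X
  coevaluation_evaluation' := coev_ev X
  evaluation_coevaluation' := ev_coev X

/-- `dual X` is a right dual of `X`. -/
abbrev rightPairing (X : C) : ExactPairing (dual X) X where
  coevaluation' := coevt X
  evaluation' := evt X
  coevaluation_evaluation' := coevt_evt X
  evaluation_coevaluation' := evt_coevt X

/-- The dual `f* : Y* ⟶ X*` of a morphism `f : X ⟶ Y`. -/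
def dualMap {X Y : C} (f : X ⟶ Y) : dual Y ⟶ dual X :=
  (ρ_ (dual Y)).inv ≫ dual Y ◁ coev X ≫ dual Y ◁ f ▷ dual X ≫ (α_ _ _ _).inv ≫
    ev Y ▷ dual X ≫ (λ_ _).hom

lemma zig_left (X : C) : (dual X ◁ coev X ⊗≫ ev X ▷ dual X) = ⊗𝟙.hom :=
  @ExactPairing.coevaluation_evaluation'' _ _ _ X (dual X) (leftPairing X)

lemma zag_left (X : C) : (coev X ▷ X ⊗≫ X ◁ ev X) = ⊗𝟙.hom :=
  @ExactPairing.evaluation_coevaluation'' _ _ _ X (dual X) (leftPairing X)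

lemma zig_right (X : C) : (X ◁ coevt X ⊗≫ evt X ▷ X) = ⊗𝟙.hom :=
  @ExactPairing.coevaluation_evaluation'' _ _ _ (dual X) X (rightPairing X)

lemma zag_right (X : C) : (coevt X ▷ dual X ⊗≫ dual X ◁ evt X) = ⊗𝟙.hom :=
  @ExactPairing.evaluation_coevaluation'' _ _ _ (dual X) X (rightPairing X)

lemma dualMap_id (X : C) : dualMap (𝟙 X) = 𝟙 (dual X) := by
  simp [dualMap, reassoc_of% coev_ev X]

lemma dualMap_comp {X Y Z : C} (f : X ⟶ Y) (g : Y ⟶ Z) :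
    dualMap (f ≫ g) = dualMap g ≫ dualMap f :=
  @comp_rightAdjointMate _ _ _ X Y Z
    (@HasRightDual.mk _ _ _ X (dual X) (leftPairing X))
    (@HasRightDual.mk _ _ _ Y (dual Y) (leftPairing Y))
    (@HasRightDual.mk _ _ _ Z (dual Z) (leftPairing Z)) f g

lemma dualMap_ev {X Y : C} (f : X ⟶ Y) : dualMap f ▷ X ≫ ev X = dual Y ◁ f ≫ ev Y :=
  @rightAdjointMate_comp_evaluation _ _ _ X Y
    (@HasRightDual.mk _ _ _ X (dual X) (leftPairing X))
    (@HasRightDual.mk _ _ _ Y (dual Y) (leftPairing Y)) f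

lemma coev_dualMap {X Y : C} (f : X ⟶ Y) : coev Y ≫ Y ◁ dualMap f = coev X ≫ f ▷ dual X :=
  @coevaluation_comp_rightAdjointMate _ _ _ X Y
    (@HasRightDual.mk _ _ _ X (dual X) (leftPairing X))
    (@HasRightDual.mk _ _ _ Y (dual Y) (leftPairing Y)) f

lemma dualMap_evt {X Y : C} (f : X ⟶ Y) : X ◁ dualMap f ≫ evt X = f ▷ dual Y ≫ evt Y := by
  have := @leftAdjointMate_comp_evaluation _ _ _ X Y
    (@HasLeftDual.mk _ _ _ X (dual X) (rightPairing X))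
    (@HasLeftDual.mk _ _ _ Y (dual Y) (rightPairing Y)) f
  rw [dualMap, dual_hom]
  exact this

lemma coevt_dualMap {X Y : C} (f : X ⟶ Y) :
    coevt Y ≫ dualMap f ▷ Y = coevt X ≫ dual X ◁ f := by
  have := @coevaluation_comp_leftAdjointMate _ _ _ X Y
    (@HasLeftDual.mk _ _ _ X (dual X) (rightPairing X))
    (@HasLeftDual.mk _ _ _ Y (dual Y) (rightPairing Y)) f
  rw [dualMap, dual_hom]
  exact this

/-- The action of a scalar `r ∈ End(𝟙)` on an object `X`. -/
def scal (r : 𝟙_ C ⟶ 𝟙_ C) (X : C) : X ⟶ X := (λ_ X).inv ≫ r ▷ X ≫ (λ_ X).hom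

/-- The left dimension `dim_l(X) ∈ End(𝟙)`. -/
def dimL (X : C) : 𝟙_ C ⟶ 𝟙_ C := coevt X ≫ ev X

variable (C) in
/-- A monoidal category is pure if `r ⊗ id_X = id_X ⊗ r` for all `r ∈ End(𝟙)`. -/
class IsPure : Prop where
  pure (r : 𝟙_ C ⟶ 𝟙_ C) (X : C) :
    (λ_ X).inv ≫ r ▷ X ≫ (λ_ X).hom = (ρ_ X).inv ≫ X ◁ r ≫ (ρ_ X).hom

end Pivotal

section Scalars

open PivotalCategory

variable {C : Type u} [Category.{v} C] [MonoidalCategory C]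

lemma scal_nat (r : 𝟙_ C ⟶ 𝟙_ C) {X Y : C} (f : X ⟶ Y) : f ≫ scal r Y = scal r X ≫ f := by
  simp only [scal, Category.assoc, MonoidalCategory.leftUnitor_inv_naturality_assoc,
    MonoidalCategory.whisker_exchange_assoc, MonoidalCategory.leftUnitor_naturality]

lemma scal_nat_assoc (r : 𝟙_ C ⟶ 𝟙_ C) {X Y Z : C} (f : X ⟶ Y) (g : Y ⟶ Z) :
    f ≫ scal r Y ≫ g = scal r X ≫ f ≫ g := by
  rw [← Category.assoc, scal_nat, Category.assoc]

lemma scal_whiskerRight (r : 𝟙_ C ⟶ 𝟙_ C) (X Y : C) : scal r X ▷ Y = scal r (X ⊗ Y) := by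
  simp [scal]

lemma scal_whiskerLeft [IsPure C] (r : 𝟙_ C ⟶ 𝟙_ C) (X Y : C) :
    X ◁ scal r Y = scal r (X ⊗ Y) := by
  have h : ∀ Z : C, scal r Z = (ρ_ Z).inv ≫ Z ◁ r ≫ (ρ_ Z).hom := fun Z => IsPure.pure r Z
  have h2 : scal r X ▷ Y = X ◁ scal r Y := by
    rw [h X]; simp [scal]
  rw [← h2, scal_whiskerRight]

lemma scal_comp (r s : 𝟙_ C ⟶ 𝟙_ C) (X : C) : scal (r ≫ s) X = scal r X ≫ scal s X := by
  simp [scal]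

lemma scal_id (X : C) : scal (𝟙 (𝟙_ C)) X = 𝟙 X := by
  simp [scal]

end Scalars

section RelativeCenter

variable {C : Type u} [Category.{v} C] [MonoidalCategory C]

/-- A half braiding of `A` relative to the full subcategory of `C` on the objects satisfying `D`:
natural isomorphisms `A ⊗ X ≅ X ⊗ A` for `X` in `D`, compatible with tensor products. -/
structure RelHalfBraiding (D : ObjectProperty C) (A : C) where
  β (X : C) (hX : D X) : A ⊗ X ≅ X ⊗ A
  naturality {X Y : C} (hX : D X) (hY : D Y) (f : X ⟶ Y) :
    A ◁ f ≫ (β Y hY).hom = (β X hX).hom ≫ f ▷ A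
  monoidal {X Y : C} (hX : D X) (hY : D Y) (hXY : D (X ⊗ Y)) :
    (β (X ⊗ Y) hXY).hom =
      (α_ _ _ _).inv ≫ (β X hX).hom ▷ Y ≫ (α_ _ _ _).hom ≫ X ◁ (β Y hY).hom ≫ (α_ _ _ _).inv

/-- The center of `C` relative to the full subcategory on the objects satisfying `D`: objects of
`C` endowed with a half braiding relative to `D`. -/
structure RelCenter (D : ObjectProperty C) where
  obj : C
  hb : RelHalfBraiding D obj

namespace RelCenter

variable {D : ObjectProperty C}

/-- A morphism in the relative center: a morphism in `C` commuting with the half braidings. -/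
@[ext]
structure Hom (A B : RelCenter D) where
  f : A.obj ⟶ B.obj
  comm (X : C) (hX : D X) : f ▷ X ≫ (B.hb.β X hX).hom = (A.hb.β X hX).hom ≫ X ◁ f

instance : Category.{v} (RelCenter D) where
  Hom := Hom
  id A := ⟨𝟙 _, fun X hX => by simp⟩
  comp f g := ⟨f.f ≫ g.f, fun X hX => by
    simp [g.comm, reassoc_of% f.comm]⟩

@[ext]
lemma hom_ext {A B : RelCenter D} {f g : A ⟶ B} (h : f.f = g.f) : f = g := Hom.ext h

@[simp] lemma id_f (A : RelCenter D) : Hom.f (𝟙 A) = 𝟙 A.obj := rfl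
@[simp] lemma comp_f {A B E : RelCenter D} (f : A ⟶ B) (g : B ⟶ E) :
    (f ≫ g).f = f.f ≫ g.f := rfl

/-- The half braiding of a tensor product: `(σ ⊗ id) ∘ (id ⊗ ρ)`. -/
def tensorHB (A B : RelCenter D) : RelHalfBraiding D (A.obj ⊗ B.obj) where
  β X hX := α_ _ _ _ ≪≫ whiskerLeftIso A.obj (B.hb.β X hX) ≪≫ (α_ _ _ _).symm ≪≫
    whiskerRightIso (A.hb.β X hX) B.obj ≪≫ α_ _ _ _
  naturality {X Y} hX hY f := by
    simp only [Iso.trans_hom, MonoidalCategory.whiskerLeftIso_hom, Iso.symm_hom,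
      MonoidalCategory.whiskerRightIso_hom]
    calc
      _ = 𝟙 _ ⊗≫ (A.obj ◁ (B.obj ◁ f ≫ (B.hb.β Y hY).hom)) ⊗≫
            (A.hb.β Y hY).hom ▷ B.obj ⊗≫ 𝟙 _ := by monoidal
      _ = 𝟙 _ ⊗≫ A.obj ◁ (B.hb.β X hX).hom ⊗≫
            (A.obj ◁ f ≫ (A.hb.β Y hY).hom) ▷ B.obj ⊗≫ 𝟙 _ := by
          rw [B.hb.naturality hX hY]; monoidal
      _ = _ := by rw [A.hb.naturality hX hY]; monoidal
  monoidal {X Y} hX hY hXY := by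
    simp only [Iso.trans_hom, MonoidalCategory.whiskerLeftIso_hom, Iso.symm_hom,
      MonoidalCategory.whiskerRightIso_hom]
    rw [A.hb.monoidal hX hY hXY, B.hb.monoidal hX hY hXY]
    calc
      _ = 𝟙 _ ⊗≫ A.obj ◁ (B.hb.β X hX).hom ▷ Y ⊗≫
            (_ ◁ (B.hb.β Y hY).hom ≫ (A.hb.β X hX).hom ▷ _) ⊗≫
              X ◁ (A.hb.β Y hY).hom ▷ B.obj ⊗≫ 𝟙 _ := by monoidal
      _ = _ := by rw [whisker_exchange]; monoidal

/-- The tensor product of two objects of the relative center. -/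
def tensor (A B : RelCenter D) : RelCenter D := ⟨A.obj ⊗ B.obj, tensorHB A B⟩

lemma tensorHB_hom (A B : RelCenter D) (X : C) (hX : D X) :
    ((tensorHB A B).β X hX).hom = (α_ _ _ _).hom ≫ A.obj ◁ (B.hb.β X hX).hom ≫ (α_ _ _ _).inv ≫
      (A.hb.β X hX).hom ▷ B.obj ≫ (α_ _ _ _).hom := rfl

/-- The tensor product of morphisms of the relative center. -/
def tensorMap {A A' B B' : RelCenter D} (f : A ⟶ A') (g : B ⟶ B') :
    tensor A B ⟶ tensor A' B' where
  f := (f.f ▷ B.obj ≫ A'.obj ◁ g.f : A.obj ⊗ B.obj ⟶ A'.obj ⊗ B'.obj)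
  comm X hX := by
    dsimp only [tensor]
    rw [tensorHB_hom, tensorHB_hom]
    calc
      _ = 𝟙 _ ⊗≫ f.f ▷ (B.obj ⊗ X) ⊗≫ A'.obj ◁ (g.f ▷ X ≫ (B'.hb.β X hX).hom) ⊗≫
            (A'.hb.β X hX).hom ▷ B'.obj ⊗≫ 𝟙 _ := by
          monoidal
      _ = 𝟙 _ ⊗≫ (f.f ▷ (B.obj ⊗ X) ≫ A'.obj ◁ (B.hb.β X hX).hom) ⊗≫
            ((A'.obj ⊗ X) ◁ g.f ≫ (A'.hb.β X hX).hom ▷ B'.obj) ⊗≫ 𝟙 _ := by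
          rw [g.comm]; monoidal
      _ = 𝟙 _ ⊗≫ A.obj ◁ (B.hb.β X hX).hom ⊗≫ (f.f ▷ X ≫ (A'.hb.β X hX).hom) ▷ B.obj ⊗≫
            (X ⊗ A'.obj) ◁ g.f ⊗≫ 𝟙 _ := by
          rw [whisker_exchange, ← whisker_exchange]; monoidal
      _ = _ := by rw [f.comm]; monoidal

lemma tensorMap_f {A A' B B' : RelCenter D} (f : A ⟶ A') (g : B ⟶ B') :
    (tensorMap f g).f = (f.f ▷ B.obj ≫ A'.obj ◁ g.f : A.obj ⊗ B.obj ⟶ A'.obj ⊗ B'.obj) := rfl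

lemma tensorMap_id (A B : RelCenter D) : tensorMap (𝟙 A) (𝟙 B) = 𝟙 (tensor A B) :=
  hom_ext (by
    change 𝟙 A.obj ▷ B.obj ≫ A.obj ◁ 𝟙 B.obj = 𝟙 (A.obj ⊗ B.obj)
    simp)

lemma tensorMap_comp {A A' A'' B B' B'' : RelCenter D} (f : A ⟶ A') (f' : A' ⟶ A'')
    (g : B ⟶ B') (g' : B' ⟶ B'') :
    tensorMap (f ≫ f') (g ≫ g') = tensorMap f g ≫ tensorMap f' g' :=
  hom_ext (by
    change (f.f ≫ f'.f) ▷ B.obj ≫ A''.obj ◁ (g.f ≫ g'.f) =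
      (f.f ▷ B.obj ≫ A'.obj ◁ g.f) ≫ (f'.f ▷ B'.obj ≫ A''.obj ◁ g'.f)
    rw [Category.assoc, MonoidalCategory.whisker_exchange_assoc, comp_whiskerRight,
      MonoidalCategory.whiskerLeft_comp, Category.assoc])

end RelCenter

/-- A class of objects closed under tensor product, unit object and duality. -/
structure IsPivotalSub [PivotalCategory C] (D : ObjectProperty C) : Prop where
  unit : D (𝟙_ C)
  tensor {X Y : C} : D X → D Y → D (X ⊗ Y)
  dual {X : C} : D X → D (PivotalCategory.dual X)

lemma RelHalfBraiding.unit_eq {D : ObjectProperty C} {A : C} (σ : RelHalfBraiding D A)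
    (h : D (𝟙_ C)) (h2 : D (𝟙_ C ⊗ 𝟙_ C)) :
    (σ.β (𝟙_ C) h).hom = (ρ_ A).hom ≫ (λ_ A).inv := by
  have h3 := σ.monoidal h h h2
  have h4 := σ.naturality h2 h (λ_ (𝟙_ C)).hom
  rw [h3] at h4
  have h5 : A ◁ (λ_ (𝟙_ C)).hom ≫ (σ.β (𝟙_ C) h).hom =
      (α_ _ _ _).inv ≫ (ρ_ A).hom ▷ 𝟙_ C ≫ (σ.β (𝟙_ C) h).hom := by monoidal
  have h6 : ((α_ A (𝟙_ C) (𝟙_ C)).inv ≫ (σ.β (𝟙_ C) h).hom ▷ 𝟙_ C ≫ (α_ _ _ _).hom ≫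
      𝟙_ C ◁ (σ.β (𝟙_ C) h).hom ≫ (α_ _ _ _).inv) ≫ (λ_ (𝟙_ C)).hom ▷ A =
      (α_ _ _ _).inv ≫ (σ.β (𝟙_ C) h).hom ▷ 𝟙_ C ≫ (λ_ A).hom ▷ 𝟙_ C ≫ (σ.β (𝟙_ C) h).hom := by
    monoidal
  rw [h5, h6, cancel_epi, ← Category.assoc, cancel_mono, ← comp_whiskerRight] at h4
  have h7 : (ρ_ A).hom = (σ.β (𝟙_ C) h).hom ≫ (λ_ A).hom :=
    (whiskerRight_iff _ _).1 h4
  rw [h7]; simp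

variable [PivotalCategory C]
open PivotalCategory

lemma evt_coevt_slide {D : ObjectProperty C} {A : C} (hD : IsPivotalSub D)
    (σ : ∀ X, D X → (A ⊗ X ⟶ X ⊗ A))
    (nat : ∀ {X Y : C} (hX : D X) (hY : D Y) (f : X ⟶ Y), A ◁ f ≫ σ Y hY = σ X hX ≫ f ▷ A)
    (mul : ∀ {X Y : C} (hX : D X) (hY : D Y) (hXY : D (X ⊗ Y)), σ (X ⊗ Y) hXY =
      (α_ _ _ _).inv ≫ σ X hX ▷ Y ≫ (α_ _ _ _).hom ≫ X ◁ σ Y hY ≫ (α_ _ _ _).inv)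
    (one : ∀ h : D (𝟙_ C), σ (𝟙_ C) h = (ρ_ A).hom ≫ (λ_ A).inv) (X : C) (hX : D X) :
    σ X hX ≫ (𝟙 _ ⊗≫ (X ⊗ A) ◁ coevt X ⊗≫ X ◁ σ (dual X) (hD.dual hX) ▷ X ⊗≫
      evt X ▷ (A ⊗ X) ⊗≫ 𝟙 _) = 𝟙 (A ⊗ X) := by
  have h1 : A ◁ evt X ≫ σ (𝟙_ C) hD.unit =
    σ (X ⊗ dual X) (hD.tensor hX (hD.dual hX)) ≫ evt X ▷ A := nat _ _ _
  rw [one, mul hX (hD.dual hX)] at h1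
  calc
    _ = 𝟙 _ ⊗≫ (σ X hX ▷ 𝟙_ C ≫ (X ⊗ A) ◁ coevt X) ⊗≫
          X ◁ σ (dual X) (hD.dual hX) ▷ X ⊗≫ evt X ▷ (A ⊗ X) ⊗≫ 𝟙 _ := by monoidal
    _ = 𝟙 _ ⊗≫ (A ⊗ X) ◁ coevt X ⊗≫ (((α_ _ _ _).inv ≫ σ X hX ▷ dual X ≫ (α_ _ _ _).hom ≫
          X ◁ σ (dual X) (hD.dual hX) ≫ (α_ _ _ _).inv) ≫ evt X ▷ A) ▷ X ⊗≫ 𝟙 _ := by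
        rw [← whisker_exchange]; monoidal
    _ = 𝟙 _ ⊗≫ A ◁ (X ◁ coevt X ⊗≫ evt X ▷ X) ⊗≫ 𝟙 _ := by
        rw [← h1]; monoidal
    _ = _ := by rw [zig_right]; monoidal

lemma coevt_evt_slide {D : ObjectProperty C} {A : C} (hD : IsPivotalSub D)
    (σ : ∀ X, D X → (A ⊗ X ⟶ X ⊗ A))
    (nat : ∀ {X Y : C} (hX : D X) (hY : D Y) (f : X ⟶ Y), A ◁ f ≫ σ Y hY = σ X hX ≫ f ▷ A)
    (mul : ∀ {X Y : C} (hX : D X) (hY : D Y) (hXY : D (X ⊗ Y)), σ (X ⊗ Y) hXY =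
      (α_ _ _ _).inv ≫ σ X hX ▷ Y ≫ (α_ _ _ _).hom ≫ X ◁ σ Y hY ≫ (α_ _ _ _).inv)
    (one : ∀ h : D (𝟙_ C), σ (𝟙_ C) h = (ρ_ A).hom ≫ (λ_ A).inv) (X : C) (hX : D X) :
    (𝟙 _ ⊗≫ (X ⊗ A) ◁ coevt X ⊗≫ X ◁ σ (dual X) (hD.dual hX) ▷ X ⊗≫
      evt X ▷ (A ⊗ X) ⊗≫ 𝟙 _) ≫ σ X hX = 𝟙 (X ⊗ A) := by
  have h1 : A ◁ coevt X ≫ σ (dual X ⊗ X) (hD.tensor (hD.dual hX) hX) =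
    σ (𝟙_ C) hD.unit ≫ coevt X ▷ A := nat _ _ _
  rw [one, mul (hD.dual hX) hX] at h1
  calc
    _ = 𝟙 _ ⊗≫ (X ⊗ A) ◁ coevt X ⊗≫ X ◁ σ (dual X) (hD.dual hX) ▷ X ⊗≫
          (evt X ▷ (A ⊗ X) ≫ 𝟙_ C ◁ σ X hX) ⊗≫ 𝟙 _ := by monoidal
    _ = 𝟙 _ ⊗≫ X ◁ (A ◁ coevt X ≫ ((α_ _ _ _).inv ≫ σ (dual X) (hD.dual hX) ▷ X ≫ (α_ _ _ _).hom ≫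
          dual X ◁ σ X hX ≫ (α_ _ _ _).inv)) ⊗≫ evt X ▷ (X ⊗ A) ⊗≫ 𝟙 _ := by
        rw [← whisker_exchange]; monoidal
    _ = 𝟙 _ ⊗≫ (X ◁ coevt X ⊗≫ evt X ▷ X) ▷ A ⊗≫ 𝟙 _ := by
        rw [h1]; monoidal
    _ = _ := by rw [zig_right]; monoidal

/-- A natural, multiplicative and unital family of morphisms `A ⊗ X ⟶ X ⊗ A` is automatically
invertible, by duality. -/
def RelHalfBraiding.ofLax {D : ObjectProperty C} {A : C} (hD : IsPivotalSub D)
    (σ : ∀ X, D X → (A ⊗ X ⟶ X ⊗ A))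
    (nat : ∀ {X Y : C} (hX : D X) (hY : D Y) (f : X ⟶ Y), A ◁ f ≫ σ Y hY = σ X hX ≫ f ▷ A)
    (mul : ∀ {X Y : C} (hX : D X) (hY : D Y) (hXY : D (X ⊗ Y)), σ (X ⊗ Y) hXY =
      (α_ _ _ _).inv ≫ σ X hX ▷ Y ≫ (α_ _ _ _).hom ≫ X ◁ σ Y hY ≫ (α_ _ _ _).inv)
    (one : ∀ h : D (𝟙_ C), σ (𝟙_ C) h = (ρ_ A).hom ≫ (λ_ A).inv) : RelHalfBraiding D A where
  β X hX :=
    { hom := σ X hX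
      inv := 𝟙 _ ⊗≫ (X ⊗ A) ◁ coevt X ⊗≫ X ◁ σ (dual X) (hD.dual hX) ▷ X ⊗≫
        evt X ▷ (A ⊗ X) ⊗≫ 𝟙 _
      hom_inv_id := evt_coevt_slide hD σ nat mul one X hX
      inv_hom_id := coevt_evt_slide hD σ nat mul one X hX }
  naturality := nat
  monoidal := mul

lemma RelHalfBraiding.ofLax_hom {D : ObjectProperty C} {A : C} (hD : IsPivotalSub D)
    (σ : ∀ X, D X → (A ⊗ X ⟶ X ⊗ A)) (nat) (mul) (one) (X : C) (hX : D X) :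
    ((RelHalfBraiding.ofLax hD σ nat mul one).β X hX).hom = σ X hX := rfl

end RelativeCenter

section Slide

open PivotalCategory

variable {C : Type u} [Category.{v} C] [MonoidalCategory C] [PivotalCategory C]
  {D : ObjectProperty C}

/-- The canonical morphism `V* ⊗ A ⊗ V ⊗ X ⟶ X ⊗ U* ⊗ A ⊗ U`: create `U* ⊗ U`, apply the half
braiding of `A` with `V ⊗ X ⊗ U*`, and evaluate `V* ⊗ V`. -/
def slide (A : RelCenter D) (V U X : C) (h : D (V ⊗ (X ⊗ dual U))) :
    (dual V ⊗ (A.obj ⊗ V)) ⊗ X ⟶ X ⊗ (dual U ⊗ (A.obj ⊗ U)) :=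
  𝟙 _ ⊗≫ (dual V ⊗ A.obj ⊗ V ⊗ X) ◁ coevt U ⊗≫
    dual V ◁ (A.hb.β (V ⊗ (X ⊗ dual U)) h).hom ▷ U ⊗≫
      ev V ▷ (X ⊗ dual U ⊗ A.obj ⊗ U) ⊗≫ 𝟙 _

lemma slide_nat (A : RelCenter D) (V U : C) {X Y : C} (h : D (V ⊗ (X ⊗ dual U)))
    (h' : D (V ⊗ (Y ⊗ dual U))) (f : X ⟶ Y) :
    (dual V ⊗ (A.obj ⊗ V)) ◁ f ≫ slide A V U Y h' =
      slide A V U X h ≫ f ▷ (dual U ⊗ (A.obj ⊗ U)) := by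
  have h1 := A.hb.naturality h h' (V ◁ f ▷ dual U)
  dsimp only [slide]
  calc
    _ = 𝟙 _ ⊗≫ ((dual V ⊗ A.obj ⊗ V) ◁ f ▷ 𝟙_ C ≫ (dual V ⊗ A.obj ⊗ V) ◁ Y ◁ coevt U) ⊗≫
        dual V ◁ (A.hb.β (V ⊗ (Y ⊗ dual U)) h').hom ▷ U ⊗≫
          ev V ▷ (Y ⊗ dual U ⊗ A.obj ⊗ U) ⊗≫ 𝟙 _ := by monoidal
    _ = 𝟙 _ ⊗≫ (dual V ⊗ A.obj ⊗ V ⊗ X) ◁ coevt U ⊗≫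
        dual V ◁ (A.obj ◁ V ◁ f ▷ dual U ≫
          (A.hb.β (V ⊗ (Y ⊗ dual U)) h').hom) ▷ U ⊗≫
          ev V ▷ (Y ⊗ dual U ⊗ A.obj ⊗ U) ⊗≫ 𝟙 _ := by
        rw [← MonoidalCategory.whiskerLeft_comp, ← whisker_exchange]; monoidal
    _ = 𝟙 _ ⊗≫ (dual V ⊗ A.obj ⊗ V ⊗ X) ◁ coevt U ⊗≫
        dual V ◁ (A.hb.β (V ⊗ (X ⊗ dual U)) h).hom ▷ U ⊗≫
          ((dual V ⊗ V) ◁ f ▷ (dual U ⊗ A.obj ⊗ U) ≫ ev V ▷ (Y ⊗ dual U ⊗ A.obj ⊗ U)) ⊗≫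
            𝟙 _ := by
        rw [h1]; monoidal
    _ = _ := by rw [whisker_exchange]; monoidal

lemma slide_map {A B : RelCenter D} (g : A ⟶ B) (V U X : C) (h : D (V ⊗ (X ⊗ dual U))) :
    (dual V ◁ g.f ▷ V) ▷ X ≫ slide B V U X h = slide A V U X h ≫ X ◁ (dual U ◁ g.f ▷ U) := by
  have h1 := g.comm _ h
  dsimp only [slide]
  calc
    _ = 𝟙 _ ⊗≫ dual V ◁ (g.f ▷ (V ⊗ X ⊗ 𝟙_ C) ≫ B.obj ◁ V ◁ X ◁ coevt U) ⊗≫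
        dual V ◁ (B.hb.β (V ⊗ (X ⊗ dual U)) h).hom ▷ U ⊗≫
          ev V ▷ (X ⊗ dual U ⊗ B.obj ⊗ U) ⊗≫ 𝟙 _ := by monoidal
    _ = 𝟙 _ ⊗≫ (dual V ⊗ A.obj ⊗ V ⊗ X) ◁ coevt U ⊗≫
        dual V ◁ (g.f ▷ (V ⊗ X ⊗ dual U) ≫ (B.hb.β (V ⊗ (X ⊗ dual U)) h).hom) ▷ U ⊗≫
          ev V ▷ (X ⊗ dual U ⊗ B.obj ⊗ U) ⊗≫ 𝟙 _ := by
        rw [← whisker_exchange]; monoidal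
    _ = 𝟙 _ ⊗≫ (dual V ⊗ A.obj ⊗ V ⊗ X) ◁ coevt U ⊗≫
        dual V ◁ (A.hb.β (V ⊗ (X ⊗ dual U)) h).hom ▷ U ⊗≫
          ((dual V ⊗ V) ◁ (X ⊗ dual U) ◁ g.f ▷ U ≫ ev V ▷ ((X ⊗ dual U) ⊗ B.obj ⊗ U)) ⊗≫
            𝟙 _ := by
        rw [h1]; monoidal
    _ = _ := by rw [whisker_exchange]; monoidal

lemma slide_slide [IsPure C] (hT : ∀ {X Y : C}, D X → D Y → D (X ⊗ Y)) (A : RelCenter D)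
    (V U W X Y : C)
    (h1 : D (V ⊗ (X ⊗ dual U))) (h2 : D (U ⊗ (Y ⊗ dual W)))
    (h3 : D (V ⊗ ((X ⊗ Y) ⊗ dual W))) :
    slide A V U X h1 ▷ Y ≫ (α_ _ _ _).hom ≫ X ◁ slide A U W Y h2 =
      (α_ _ _ _).hom ≫ slide A V W (X ⊗ Y) h3 ≫ scal (dimL U) _ ≫ (α_ _ _ _).hom := by
  have m := A.hb.monoidal h1 h2 (hT h1 h2)
  have n1 := A.hb.naturality (hT h1 h2) h3
    (𝟙 _ ⊗≫ (V ⊗ X) ◁ ev U ▷ (Y ⊗ dual W) ⊗≫ 𝟙 (V ⊗ ((X ⊗ Y) ⊗ dual W)))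
  dsimp only [slide]
  calc
    _ = 𝟙 _ ⊗≫ (dual V ⊗ A.obj ⊗ V ⊗ X) ◁ coevt U ▷ Y ⊗≫
        dual V ◁ (A.hb.β (V ⊗ (X ⊗ dual U)) h1).hom ▷ (U ⊗ Y) ⊗≫
          (ev V ▷ (X ⊗ dual U ⊗ A.obj ⊗ U ⊗ Y) ≫ 𝟙_ C ◁ (𝟙 _ ⊗≫
            (X ⊗ dual U ⊗ A.obj ⊗ U ⊗ Y) ◁ coevt W ⊗≫
              (X ⊗ dual U) ◁ (A.hb.β (U ⊗ (Y ⊗ dual W)) h2).hom ▷ W ⊗≫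
                X ◁ ev U ▷ (Y ⊗ dual W ⊗ A.obj ⊗ W) ⊗≫
                  𝟙 (X ⊗ Y ⊗ dual W ⊗ A.obj ⊗ W))) ⊗≫ 𝟙 _ := by monoidal
    _ = 𝟙 _ ⊗≫ (dual V ⊗ A.obj ⊗ V ⊗ X) ◁ coevt U ▷ Y ⊗≫
        dual V ◁ ((A.hb.β (V ⊗ (X ⊗ dual U)) h1).hom ▷ (U ⊗ Y ⊗ 𝟙_ C) ≫
          ((V ⊗ X ⊗ dual U) ⊗ A.obj) ◁ U ◁ Y ◁ coevt W) ⊗≫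
          (dual V ⊗ (V ⊗ (X ⊗ dual U))) ◁ (A.hb.β (U ⊗ (Y ⊗ dual W)) h2).hom ▷ W ⊗≫
            (dual V ⊗ V ⊗ X) ◁ ev U ▷ (Y ⊗ dual W ⊗ A.obj ⊗ W) ⊗≫
              ev V ▷ (X ⊗ Y ⊗ dual W ⊗ A.obj ⊗ W) ⊗≫ 𝟙 _ := by
        rw [← whisker_exchange (ev V)]; monoidal
    _ = 𝟙 _ ⊗≫ (dual V ⊗ A.obj ⊗ V ⊗ X) ◁ coevt U ▷ Y ⊗≫
        (dual V ⊗ A.obj ⊗ (V ⊗ X ⊗ dual U) ⊗ U ⊗ Y) ◁ coevt W ⊗≫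
          dual V ◁ (((α_ _ _ _).inv ≫ (A.hb.β (V ⊗ (X ⊗ dual U)) h1).hom ▷ _ ≫ (α_ _ _ _).hom ≫
            (V ⊗ (X ⊗ dual U)) ◁ (A.hb.β (U ⊗ (Y ⊗ dual W)) h2).hom ≫ (α_ _ _ _).inv) ≫
              (𝟙 _ ⊗≫ (V ⊗ X) ◁ ev U ▷ (Y ⊗ dual W) ⊗≫
                𝟙 (V ⊗ ((X ⊗ Y) ⊗ dual W))) ▷ A.obj) ▷ W ⊗≫
              ev V ▷ (X ⊗ Y ⊗ dual W ⊗ A.obj ⊗ W) ⊗≫ 𝟙 _ := by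
        rw [← whisker_exchange]; monoidal
    _ = 𝟙 _ ⊗≫ (dual V ⊗ A.obj ⊗ V ⊗ X) ◁ (coevt U ▷ (Y ⊗ 𝟙_ C) ≫
          (dual U ⊗ U) ◁ (Y ◁ coevt W)) ⊗≫
        (dual V ⊗ A.obj ⊗ V ⊗ X) ◁ ev U ▷ (Y ⊗ dual W ⊗ W) ⊗≫
          dual V ◁ (A.hb.β (V ⊗ ((X ⊗ Y) ⊗ dual W)) h3).hom ▷ W ⊗≫
              ev V ▷ (X ⊗ Y ⊗ dual W ⊗ A.obj ⊗ W) ⊗≫ 𝟙 _ := by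
        rw [← m, ← n1]; monoidal
    _ = (𝟙 _ ⊗≫ (dual V ⊗ A.obj ⊗ V ⊗ X ⊗ Y) ◁ coevt W ⊗≫ 𝟙 _) ≫
        (dual V ⊗ A.obj ⊗ V ⊗ X) ◁ scal (dimL U) (Y ⊗ dual W ⊗ W) ≫
          (𝟙 _ ⊗≫ dual V ◁ (A.hb.β (V ⊗ ((X ⊗ Y) ⊗ dual W)) h3).hom ▷ W ⊗≫
              ev V ▷ (X ⊗ Y ⊗ dual W ⊗ A.obj ⊗ W) ⊗≫ 𝟙 _) := by
        rw [← whisker_exchange, scal, dimL]; monoidal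
    _ = _ := by
        rw [scal_whiskerLeft, ← scal_nat, ← Category.assoc]
        simp only [← scal_nat]
        simp only [← Category.assoc]
        congr 1
        monoidal

/-- The slide morphism divided by the left dimension of `V`. -/
def nslide (A : RelCenter D) (V U X : C) [IsIso (dimL V)] (h : D (V ⊗ (X ⊗ dual U))) :
    (dual V ⊗ (A.obj ⊗ V)) ⊗ X ⟶ X ⊗ (dual U ⊗ (A.obj ⊗ U)) :=
  slide A V U X h ≫ scal (inv (dimL V)) _

lemma nslide_nat (A : RelCenter D) (V U : C) [IsIso (dimL V)] {X Y : C}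
    (h : D (V ⊗ (X ⊗ dual U)))
    (h' : D (V ⊗ (Y ⊗ dual U))) (f : X ⟶ Y) :
    (dual V ⊗ (A.obj ⊗ V)) ◁ f ≫ nslide A V U Y h' =
      nslide A V U X h ≫ f ▷ (dual U ⊗ (A.obj ⊗ U)) := by
  simp only [nslide, reassoc_of% slide_nat A V U h h' f, Category.assoc]
  rw [scal_nat]

lemma nslide_map {A B : RelCenter D} (g : A ⟶ B) (V U X : C) [IsIso (dimL V)]
    (h : D (V ⊗ (X ⊗ dual U))) :
    (dual V ◁ g.f ▷ V) ▷ X ≫ nslide B V U X h =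
      nslide A V U X h ≫ X ◁ (dual U ◁ g.f ▷ U) := by
  simp only [nslide, reassoc_of% slide_map g V U X h, Category.assoc]
  rw [scal_nat]

lemma nslide_nslide [IsPure C] (hT : ∀ {X Y : C}, D X → D Y → D (X ⊗ Y)) (A : RelCenter D)
    (V U W X Y : C) [IsIso (dimL V)] [IsIso (dimL U)]
    (h1 : D (V ⊗ (X ⊗ dual U))) (h2 : D (U ⊗ (Y ⊗ dual W)))
    (h3 : D (V ⊗ ((X ⊗ Y) ⊗ dual W))) :
    nslide A V U X h1 ▷ Y ≫ (α_ _ _ _).hom ≫ X ◁ nslide A U W Y h2 =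
      (α_ _ _ _).hom ≫ nslide A V W (X ⊗ Y) h3 ≫ (α_ _ _ _).hom := by
  have e := slide_slide hT A V U W X Y h1 h2 h3
  simp only [nslide, comp_whiskerRight, MonoidalCategory.whiskerLeft_comp, scal_whiskerLeft,
    scal_whiskerRight, Category.assoc]
  calc
    _ = scal (inv (dimL V)) _ ≫ (slide A V U X h1 ▷ Y ≫ (α_ _ _ _).hom ≫ X ◁ slide A U W Y h2) ≫
          scal (inv (dimL U)) _ := by
        simp only [scal_nat_assoc, Category.assoc]
    _ = scal (inv (dimL V)) _ ≫ scal (inv (dimL U) ≫ dimL U) _ ≫ (α_ _ _ _).hom ≫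
          slide A V W (X ⊗ Y) h3 ≫ (α_ _ _ _).hom := by
        rw [e, scal_nat, scal_comp, Category.assoc,
          scal_nat_assoc (dimL U) (slide A V W (X ⊗ Y) h3), scal_nat_assoc (dimL U)]
    _ = _ := by
        rw [IsIso.inv_hom_id, scal_id, Category.id_comp,
          scal_nat_assoc (inv (dimL V)) (slide A V W (X ⊗ Y) h3), scal_nat_assoc (inv (dimL V))]

end Slide

section Dual

open PivotalCategory

variable {C : Type u} [Category.{v} C] [MonoidalCategory C] {D : ObjectProperty C}

lemma RelHalfBraiding.inv_nat {A : C} (σ : RelHalfBraiding D A) {X Y : C} (hX : D X) (hY : D Y)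
    (f : X ⟶ Y) : f ▷ A ≫ (σ.β Y hY).inv = (σ.β X hX).inv ≫ A ◁ f := by
  rw [Iso.comp_inv_eq, Category.assoc, σ.naturality hX hY, Iso.inv_hom_id_assoc]

lemma RelHalfBraiding.inv_monoidal {A : C} (σ : RelHalfBraiding D A) {X Y : C} (hX : D X)
    (hY : D Y) (hXY : D (X ⊗ Y)) : (σ.β (X ⊗ Y) hXY).inv =
      (α_ _ _ _).hom ≫ X ◁ (σ.β Y hY).inv ≫ (α_ _ _ _).inv ≫ (σ.β X hX).inv ▷ Y ≫
        (α_ _ _ _).hom := by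
  rw [← cancel_epi (σ.β (X ⊗ Y) hXY).hom, Iso.hom_inv_id, σ.monoidal hX hY hXY]
  simp

lemma RelCenter.Hom.inv_comm {A B : RelCenter D} (f : A ⟶ B) (X : C) (hX : D X) :
    X ◁ f.f ≫ (B.hb.β X hX).inv = (A.hb.β X hX).inv ≫ f.f ▷ X := by
  rw [Iso.comp_inv_eq, Category.assoc, f.comm, Iso.inv_hom_id_assoc]

variable [PivotalCategory C]

/-- The morphism `A* ⊗ X ⟶ X ⊗ A*` obtained from `(σ_X)⁻¹ : X ⊗ A ⟶ A ⊗ X` by duality. -/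
def dagger {A : C} (σ : RelHalfBraiding D A) (X : C) (hX : D X) : dual A ⊗ X ⟶ X ⊗ dual A :=
  𝟙 _ ⊗≫ (dual A ⊗ X) ◁ coev A ⊗≫ dual A ◁ (σ.β X hX).inv ▷ dual A ⊗≫
    ev A ▷ (X ⊗ dual A) ⊗≫ 𝟙 _

lemma dagger_nat {A : C} (σ : RelHalfBraiding D A) {X Y : C} (hX : D X) (hY : D Y) (f : X ⟶ Y) :
    dual A ◁ f ≫ dagger σ Y hY = dagger σ X hX ≫ f ▷ dual A := by
  dsimp only [dagger]
  calc
    _ = 𝟙 _ ⊗≫ ((dual A ◁ f) ▷ 𝟙_ C ≫ (dual A ⊗ Y) ◁ coev A) ⊗≫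
          dual A ◁ (σ.β Y hY).inv ▷ dual A ⊗≫ ev A ▷ (Y ⊗ dual A) ⊗≫ 𝟙 _ := by monoidal
    _ = 𝟙 _ ⊗≫ (dual A ⊗ X) ◁ coev A ⊗≫ dual A ◁ (f ▷ A ≫ (σ.β Y hY).inv) ▷ dual A ⊗≫
          ev A ▷ (Y ⊗ dual A) ⊗≫ 𝟙 _ := by rw [← whisker_exchange]; monoidal
    _ = 𝟙 _ ⊗≫ (dual A ⊗ X) ◁ coev A ⊗≫ dual A ◁ (σ.β X hX).inv ▷ dual A ⊗≫
          ((dual A ⊗ A) ◁ (f ▷ dual A) ≫ ev A ▷ (Y ⊗ dual A)) ⊗≫ 𝟙 _ := by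
        rw [σ.inv_nat hX hY]; monoidal
    _ = _ := by rw [whisker_exchange]; monoidal

lemma dagger_coev {A : C} (σ : RelHalfBraiding D A) (Y : C) (hY : D Y) :
    (coev A ▷ Y ⊗≫ A ◁ dagger σ Y hY) = 𝟙 _ ⊗≫ Y ◁ coev A ⊗≫ (σ.β Y hY).inv ▷ dual A ⊗≫ 𝟙 _ := by
  dsimp only [dagger]
  calc
    _ = 𝟙 _ ⊗≫ (coev A ▷ (Y ⊗ 𝟙_ C) ≫ (A ⊗ dual A) ◁ (Y ◁ coev A ⊗≫ (σ.β Y hY).inv ▷ dual A)) ⊗≫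
          A ◁ ev A ▷ (Y ⊗ dual A) ⊗≫ 𝟙 _ := by monoidal
    _ = 𝟙 _ ⊗≫ Y ◁ coev A ⊗≫ (σ.β Y hY).inv ▷ dual A ⊗≫
          (coev A ▷ A ⊗≫ A ◁ ev A) ▷ (Y ⊗ dual A) ⊗≫ 𝟙 _ := by
        rw [← whisker_exchange]; monoidal
    _ = _ := by rw [zag_left]; monoidal

lemma dagger_mul {A : C} (σ : RelHalfBraiding D A) {X Y : C} (hX : D X) (hY : D Y)
    (hXY : D (X ⊗ Y)) : dagger σ (X ⊗ Y) hXY =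
      (α_ _ _ _).inv ≫ dagger σ X hX ▷ Y ≫ (α_ _ _ _).hom ≫ X ◁ dagger σ Y hY ≫
        (α_ _ _ _).inv := by
  symm
  calc
    _ = 𝟙 _ ⊗≫ (dual A ⊗ X) ◁ coev A ▷ Y ⊗≫ dual A ◁ (σ.β X hX).inv ▷ (dual A ⊗ Y) ⊗≫
          (ev A ▷ (X ⊗ (dual A ⊗ Y)) ≫ 𝟙_ C ◁ X ◁ dagger σ Y hY) ⊗≫ 𝟙 _ := by
        rw [dagger]; monoidal
    _ = 𝟙 _ ⊗≫ (dual A ⊗ X) ◁ coev A ▷ Y ⊗≫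
          dual A ◁ ((σ.β X hX).inv ▷ (dual A ⊗ Y) ≫ (A ⊗ X) ◁ dagger σ Y hY) ⊗≫
          ev A ▷ (X ⊗ (Y ⊗ dual A)) ⊗≫ 𝟙 _ := by
        rw [← whisker_exchange (ev A)]; monoidal
    _ = 𝟙 _ ⊗≫ (dual A ⊗ X) ◁ (coev A ▷ Y ⊗≫ A ◁ dagger σ Y hY) ⊗≫
          dual A ◁ (σ.β X hX).inv ▷ (Y ⊗ dual A) ⊗≫ ev A ▷ (X ⊗ (Y ⊗ dual A)) ⊗≫ 𝟙 _ := by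
        rw [← whisker_exchange]; monoidal
    _ = _ := by
        rw [dagger_coev, dagger, σ.inv_monoidal hX hY hXY]; monoidal

lemma dagger_one {A : C} (σ : RelHalfBraiding D A) (h : D (𝟙_ C)) (h2 : D (𝟙_ C ⊗ 𝟙_ C)) :
    dagger σ (𝟙_ C) h = (ρ_ (dual A)).hom ≫ (λ_ (dual A)).inv := by
  have h1 : (σ.β (𝟙_ C) h).inv = (λ_ A).hom ≫ (ρ_ A).inv := by
    rw [← cancel_epi (σ.β (𝟙_ C) h).hom, Iso.hom_inv_id, σ.unit_eq h h2]; simp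
  rw [dagger, h1]
  calc
    _ = 𝟙 _ ⊗≫ (dual A ◁ coev A ⊗≫ ev A ▷ dual A) ⊗≫ 𝟙 _ := by monoidal
    _ = _ := by rw [zig_left]; monoidal

/-- The dual of an object of the relative center. -/
def RelCenter.dualObj (hD : IsPivotalSub D) (A : RelCenter D) : RelCenter D where
  obj := dual A.obj
  hb := RelHalfBraiding.ofLax hD (dagger A.hb) (dagger_nat A.hb) (dagger_mul A.hb)
    (fun h => dagger_one A.hb h (hD.tensor h h))

/-- The dual of a morphism of the relative center. -/
def RelCenter.dualHom (hD : IsPivotalSub D) {A B : RelCenter D} (f : A ⟶ B) :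
    RelCenter.dualObj hD B ⟶ RelCenter.dualObj hD A where
  f := (dualMap f.f : dual B.obj ⟶ dual A.obj)
  comm X hX := by
    change dualMap f.f ▷ X ≫ dagger A.hb X hX = dagger B.hb X hX ≫ X ◁ dualMap f.f
    dsimp only [dagger]
    calc
      _ = 𝟙 _ ⊗≫ (dualMap f.f ▷ (X ⊗ 𝟙_ C) ≫ dual A.obj ◁ (X ◁ coev A.obj ⊗≫
            (A.hb.β X hX).inv ▷ dual A.obj)) ⊗≫ ev A.obj ▷ (X ⊗ dual A.obj) ⊗≫ 𝟙 _ := by monoidal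
      _ = 𝟙 _ ⊗≫ (dual B.obj ⊗ X) ◁ coev A.obj ⊗≫ dual B.obj ◁ (A.hb.β X hX).inv ▷ dual A.obj ⊗≫
            (dualMap f.f ▷ A.obj ≫ ev A.obj) ▷ (X ⊗ dual A.obj) ⊗≫ 𝟙 _ := by
          rw [← whisker_exchange]; monoidal
      _ = 𝟙 _ ⊗≫ (dual B.obj ⊗ X) ◁ coev A.obj ⊗≫
            dual B.obj ◁ ((A.hb.β X hX).inv ≫ f.f ▷ X) ▷ dual A.obj ⊗≫
            ev B.obj ▷ (X ⊗ dual A.obj) ⊗≫ 𝟙 _ := by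
          rw [dualMap_ev]; monoidal
      _ = 𝟙 _ ⊗≫ (dual B.obj ⊗ X) ◁ (coev A.obj ≫ f.f ▷ dual A.obj) ⊗≫
            dual B.obj ◁ (B.hb.β X hX).inv ▷ dual A.obj ⊗≫
            ev B.obj ▷ (X ⊗ dual A.obj) ⊗≫ 𝟙 _ := by
          rw [← RelCenter.Hom.inv_comm f]; monoidal
      _ = 𝟙 _ ⊗≫ (dual B.obj ⊗ X) ◁ coev B.obj ⊗≫
            dual B.obj ◁ ((B.hb.β X hX).inv ▷ dual B.obj ≫ _ ◁ dualMap f.f) ⊗≫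
            ev B.obj ▷ (X ⊗ dual A.obj) ⊗≫ 𝟙 _ := by
          rw [← coev_dualMap, ← whisker_exchange]; monoidal
      _ = 𝟙 _ ⊗≫ (dual B.obj ⊗ X) ◁ coev B.obj ⊗≫
            dual B.obj ◁ (B.hb.β X hX).inv ▷ dual B.obj ⊗≫
            ((dual B.obj ⊗ B.obj) ◁ X ◁ dualMap f.f ≫ ev B.obj ▷ (X ⊗ dual A.obj)) ⊗≫ 𝟙 _ := by
          monoidal
      _ = _ := by rw [whisker_exchange]; monoidal

lemma RelCenter.dualHom_f (hD : IsPivotalSub D) {A B : RelCenter D} (f : A ⟶ B) :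
    (RelCenter.dualHom hD f).f = (dualMap f.f : dual B.obj ⟶ dual A.obj) := rfl

lemma RelCenter.dualHom_id (hD : IsPivotalSub D) (A : RelCenter D) :
    RelCenter.dualHom hD (𝟙 A) = 𝟙 _ :=
  RelCenter.hom_ext (dualMap_id A.obj)

lemma RelCenter.dualHom_comp (hD : IsPivotalSub D) {A B E : RelCenter D} (f : A ⟶ B)
    (g : B ⟶ E) :
    RelCenter.dualHom hD (f ≫ g) = RelCenter.dualHom hD g ≫ RelCenter.dualHom hD f :=
  RelCenter.hom_ext (dualMap_comp f.f g.f)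

end Dual

section Grading

open PivotalCategory

/-- A grading of the additive monoidal category `C` by a group `G`: full additive (and replete)
subcategories `comp α` such that every object is a finite direct sum of objects of the
subcategories, there are no nonzero morphisms between objects of different subcategories, the
unit object has degree `1`, and degrees multiply under the tensor product. -/
structure GGrading (G : Type w) [Group G] (C : Type u) [Category.{v} C] [Preadditive C]
    [HasFiniteBiproducts C] [MonoidalCategory C] where
  comp : G → ObjectProperty C
  of_iso {α : G} {X Y : C} : Nonempty (X ≅ Y) → comp α X → comp α Y
  of_isZero {α : G} {X : C} : IsZero X → comp α X
  biproduct {α : G} {n : ℕ} (Y : Fin n → C) : (∀ i, comp α (Y i)) → comp α (⨁ Y)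
  decomp (X : C) : ∃ (n : ℕ) (d : Fin n → G) (Y : Fin n → C), Function.Injective d ∧
    (∀ i, comp (d i) (Y i)) ∧ Nonempty (X ≅ ⨁ Y)
  hom_zero {α β : G} {X Y : C} : α ≠ β → comp α X → comp β Y → ∀ f : X ⟶ Y, f = 0
  unit : comp 1 (𝟙_ C)
  tensor {α β : G} {X Y : C} : comp α X → comp β Y → comp (α * β) (X ⊗ Y)

variable {G : Type w} [Group G] {C : Type u} [Category.{v} C] [Preadditive C]
    [HasFiniteBiproducts C] [MonoidalCategory C]

lemma GGrading.mem_of_test (P : GGrading G C) (γ : G) (X : C)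
    (h : ∀ (δ : G), δ ≠ γ → ∀ (Y : C), P.comp δ Y → ∀ f : X ⟶ Y, f = 0) : P.comp γ X := by
  classical
  obtain ⟨n, d, Y, hd, hY, ⟨e⟩⟩ := P.decomp X
  have key : ∀ a, d a ≠ γ → e.hom ≫ biproduct.π Y a = 0 := fun a ha => h _ ha _ (hY a) _
  have htot : 𝟙 X = ∑ a, e.hom ≫ biproduct.π Y a ≫ biproduct.ι Y a ≫ e.inv := by
    have h1 := biproduct.total (f := Y)
    calc
      𝟙 X = e.hom ≫ 𝟙 _ ≫ e.inv := by simp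
      _ = _ := by rw [← h1]; simp only [Preadditive.sum_comp, Preadditive.comp_sum, Category.assoc]
  by_cases hγ : ∃ a, d a = γ
  · obtain ⟨a, ha⟩ := hγ
    have hY' := hY a
    rw [ha] at hY'
    refine P.of_iso ⟨(?_ : Y a ≅ X)⟩ hY'
    exact
      { hom := biproduct.ι Y a ≫ e.inv
        inv := e.hom ≫ biproduct.π Y a
        hom_inv_id := by simp
        inv_hom_id := by
          rw [htot, Finset.sum_eq_single a]
          · simp
          · intro b _ hb
            rw [reassoc_of% key b (fun hh => hb (hd (hh.trans ha.symm)))]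
            simp
          · simp }
  · apply P.of_isZero
    rw [IsZero.iff_id_eq_zero, htot]
    apply Finset.sum_eq_zero
    intro a _
    rw [reassoc_of% key a (fun hh => hγ ⟨a, hh⟩)]
    simp

lemma GGrading.eq_comp (P : GGrading G C) {α β : G} {X : C} (h : P.comp α X) (e : α = β) :
    P.comp β X := e ▸ h

variable [PivotalCategory C] [MonoidalPreadditive C]

lemma GGrading.dual_mem (P : GGrading G C) {α : G} {V : C} (h : P.comp α V) :
    P.comp α⁻¹ (dual V) := by
  refine P.mem_of_test _ _ fun δ hδ Y hY f => ?_
  have h1 : coev V ≫ V ◁ f = 0 := by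
    refine P.hom_zero ?_ P.unit (P.tensor h hY) _
    intro e; exact hδ (eq_inv_of_mul_eq_one_right e.symm)
  calc
    f = 𝟙 _ ⊗≫ ((dual V) ◁ coev V ⊗≫ ev V ▷ dual V) ⊗≫ f := by rw [zig_left]; monoidal
    _ = 𝟙 _ ⊗≫ ((dual V) ◁ coev V ⊗≫ (ev V ▷ dual V ≫ 𝟙_ C ◁ f)) ⊗≫ 𝟙 _ := by monoidal
    _ = 𝟙 _ ⊗≫ (dual V) ◁ (coev V ≫ V ◁ f) ⊗≫ ev V ▷ Y ⊗≫ 𝟙 _ := by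
        rw [← whisker_exchange]; monoidal
    _ = 0 := by rw [h1]; simp [monoidalComp]

lemma GGrading.isPivotalSub (P : GGrading G C) : IsPivotalSub (P.comp 1) where
  unit := P.unit
  tensor hX hY := P.eq_comp (P.tensor hX hY) (one_mul 1)
  dual hX := P.eq_comp (P.dual_mem hX) inv_one

lemma GGrading.conj (P : GGrading G C) {α : G} {V U X : C} (hV : P.comp α V) (hU : P.comp α U)
    (hX : P.comp 1 X) : P.comp 1 (V ⊗ (X ⊗ dual U)) :=
  P.eq_comp (P.tensor hV (P.tensor hX (P.dual_mem hU))) (by rw [one_mul, mul_inv_cancel])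

end Grading

section Crossing

open PivotalCategory

variable {G : Type w} [Group G] {C : Type u} [Category.{v} C] [Preadditive C]
  [HasFiniteBiproducts C] [MonoidalCategory C] [MonoidalPreadditive C] [PivotalCategory C]
  [IsPure C]

/-- The graded center: the center of `C` relative to its component of degree `1`. -/
abbrev GradedCenter (P : GGrading G C) := RelCenter (P.comp 1)

/-- The objects of degree `α` whose left dimension is invertible. -/
abbrev InvDimObj (P : GGrading G C) (α : G) := {V : C // P.comp α V ∧ IsIso (dimL V)}

variable {P : GGrading G C} {α : G}

instance (V : InvDimObj P α) : IsIso (dimL V.1) := V.2.2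

/-- The normalized slide morphism between two objects of degree `α`. -/
def crossHom (A : GradedCenter P) (V U : InvDimObj P α) (X : C) (hX : P.comp 1 X) :
    (dual V.1 ⊗ (A.obj ⊗ V.1)) ⊗ X ⟶ X ⊗ (dual U.1 ⊗ (A.obj ⊗ U.1)) :=
  nslide A V.1 U.1 X (P.conj V.2.1 U.2.1 hX)

/-- The morphism `V* ⊗ A ⊗ V ⟶ U* ⊗ A ⊗ U` obtained from `crossHom` for `X = 𝟙`; for `U = V` it
is the idempotent `π`. -/
def crossProj (A : GradedCenter P) (V U : InvDimObj P α) :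
    dual V.1 ⊗ (A.obj ⊗ V.1) ⟶ dual U.1 ⊗ (A.obj ⊗ U.1) :=
  (ρ_ _).inv ≫ crossHom A V U (𝟙_ C) P.unit ≫ (λ_ _).hom

lemma crossHom_nat (A : GradedCenter P) (V U : InvDimObj P α) {X Y : C} (hX : P.comp 1 X)
    (hY : P.comp 1 Y) (f : X ⟶ Y) :
    (dual V.1 ⊗ (A.obj ⊗ V.1)) ◁ f ≫ crossHom A V U Y hY =
      crossHom A V U X hX ≫ f ▷ (dual U.1 ⊗ (A.obj ⊗ U.1)) :=
  nslide_nat A V.1 U.1 _ _ f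

lemma crossHom_crossHom (A : GradedCenter P) (V U W : InvDimObj P α) {X Y : C} (hX : P.comp 1 X)
    (hY : P.comp 1 Y) (hXY : P.comp 1 (X ⊗ Y)) :
    crossHom A V U X hX ▷ Y ≫ (α_ _ _ _).hom ≫ X ◁ crossHom A U W Y hY =
      (α_ _ _ _).hom ≫ crossHom A V W (X ⊗ Y) hXY ≫ (α_ _ _ _).hom :=
  nslide_nslide P.isPivotalSub.tensor A V.1 U.1 W.1 X Y _ _ _

lemma crossProj_crossHom (A : GradedCenter P) (V U W : InvDimObj P α) (X : C)
    (hX : P.comp 1 X) :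
    crossProj A V U ▷ X ≫ crossHom A U W X hX = crossHom A V W X hX := by
  have h1 : P.comp 1 (𝟙_ C ⊗ X) := P.isPivotalSub.tensor P.unit hX
  have h := crossHom_crossHom A V U W P.unit hX h1
  have n := crossHom_nat A V W h1 hX (λ_ X).hom
  calc
    _ = (ρ_ _).inv ▷ X ≫ (crossHom A V U (𝟙_ C) P.unit ▷ X ≫ (α_ _ _ _).hom ≫
          𝟙_ C ◁ crossHom A U W X hX) ≫ (λ_ _).hom := by
        rw [crossProj]; monoidal
    _ = (ρ_ _).inv ▷ X ≫ (α_ _ _ _).hom ≫ (crossHom A V W (𝟙_ C ⊗ X) h1 ≫ (λ_ X).hom ▷ _) := by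
        rw [h]; monoidal
    _ = _ := by rw [← n]; simp

lemma crossHom_crossProj (A : GradedCenter P) (V U W : InvDimObj P α) (X : C)
    (hX : P.comp 1 X) :
    crossHom A V U X hX ≫ X ◁ crossProj A U W = crossHom A V W X hX := by
  have h1 : P.comp 1 (X ⊗ 𝟙_ C) := P.isPivotalSub.tensor hX P.unit
  have h := crossHom_crossHom A V U W hX P.unit h1
  have n := crossHom_nat A V W h1 hX (ρ_ X).hom
  calc
    _ = (ρ_ _).inv ≫ (crossHom A V U X hX ▷ 𝟙_ C ≫ (α_ _ _ _).hom ≫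
          X ◁ crossHom A U W (𝟙_ C) P.unit) ≫ X ◁ (λ_ _).hom := by
        rw [crossProj]; monoidal
    _ = (ρ_ _).inv ≫ (α_ _ _ _).hom ≫ (crossHom A V W (X ⊗ 𝟙_ C) h1 ≫ (ρ_ X).hom ▷ _) := by
        rw [h]; monoidal
    _ = _ := by rw [← n]; simp

lemma crossProj_crossProj (A : GradedCenter P) (V U W : InvDimObj P α) :
    crossProj A V U ≫ crossProj A U W = crossProj A V W := by
  have h := crossProj_crossHom A V U W (𝟙_ C) P.unit
  calc
    _ = (ρ_ _).inv ≫ (crossProj A V U ▷ (𝟙_ C) ≫ crossHom A U W (𝟙_ C) P.unit) ≫ (λ_ _).hom := by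
        rw [crossProj.eq_1 A U W]; monoidal
    _ = _ := by rw [h, crossProj]

lemma crossHom_map {A B : GradedCenter P} (g : A ⟶ B) (V U : InvDimObj P α) (X : C)
    (hX : P.comp 1 X) :
    (dual V.1 ◁ g.f ▷ V.1) ▷ X ≫ crossHom B V U X hX =
      crossHom A V U X hX ≫ X ◁ (dual U.1 ◁ g.f ▷ U.1) :=
  nslide_map g V.1 U.1 X _

lemma crossProj_map {A B : GradedCenter P} (g : A ⟶ B) (V U : InvDimObj P α) :
    (dual V.1 ◁ g.f ▷ V.1) ≫ crossProj B V U = crossProj A V U ≫ (dual U.1 ◁ g.f ▷ U.1) := by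
  have h := crossHom_map g V U (𝟙_ C) P.unit
  calc
    _ = (ρ_ _).inv ≫ ((dual V.1 ◁ g.f ▷ V.1) ▷ (𝟙_ C) ≫ crossHom B V U (𝟙_ C) P.unit) ≫
          (λ_ _).hom := by rw [crossProj]; monoidal
    _ = _ := by rw [h, crossProj]; monoidal

variable [IsIdempotentComplete C]

/-- The image of the idempotent `π = crossProj A V V`. -/
def crossE (A : GradedCenter P) (V : InvDimObj P α) : C :=
  (IsIdempotentComplete.idempotents_split _ (crossProj A V V)
    (crossProj_crossProj A V V V)).choose

/-- The inclusion of the image of `π`. -/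
def crossI (A : GradedCenter P) (V : InvDimObj P α) : crossE A V ⟶ dual V.1 ⊗ (A.obj ⊗ V.1) :=
  (IsIdempotentComplete.idempotents_split _ (crossProj A V V)
    (crossProj_crossProj A V V V)).choose_spec.choose

/-- The projection on the image of `π`. -/
def crossP (A : GradedCenter P) (V : InvDimObj P α) : dual V.1 ⊗ (A.obj ⊗ V.1) ⟶ crossE A V :=
  (IsIdempotentComplete.idempotents_split _ (crossProj A V V)
    (crossProj_crossProj A V V V)).choose_spec.choose_spec.choose

lemma crossI_crossP (A : GradedCenter P) (V : InvDimObj P α) : crossI A V ≫ crossP A V = 𝟙 _ :=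
  (IsIdempotentComplete.idempotents_split _ (crossProj A V V)
    (crossProj_crossProj A V V V)).choose_spec.choose_spec.choose_spec.1

lemma crossP_crossI (A : GradedCenter P) (V : InvDimObj P α) :
    crossP A V ≫ crossI A V = crossProj A V V :=
  (IsIdempotentComplete.idempotents_split _ (crossProj A V V)
    (crossProj_crossProj A V V V)).choose_spec.choose_spec.choose_spec.2

/-- The half braiding `γ` of the image of `π`, before it is known to be invertible. -/
def crossGamma (A : GradedCenter P) (V : InvDimObj P α) (X : C) (hX : P.comp 1 X) :
    crossE A V ⊗ X ⟶ X ⊗ crossE A V :=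
  crossI A V ▷ X ≫ crossHom A V V X hX ≫ X ◁ crossP A V

lemma crossGamma_nat (A : GradedCenter P) (V : InvDimObj P α) {X Y : C} (hX : P.comp 1 X)
    (hY : P.comp 1 Y) (f : X ⟶ Y) :
    crossE A V ◁ f ≫ crossGamma A V Y hY = crossGamma A V X hX ≫ f ▷ crossE A V := by
  simp only [crossGamma, Category.assoc]
  rw [whisker_exchange_assoc, reassoc_of% crossHom_nat A V V hX hY f, whisker_exchange]

lemma crossGamma_mul (A : GradedCenter P) (V : InvDimObj P α) {X Y : C} (hX : P.comp 1 X)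
    (hY : P.comp 1 Y) (hXY : P.comp 1 (X ⊗ Y)) : crossGamma A V (X ⊗ Y) hXY =
      (α_ _ _ _).inv ≫ crossGamma A V X hX ▷ Y ≫ (α_ _ _ _).hom ≫ X ◁ crossGamma A V Y hY ≫
        (α_ _ _ _).inv := by
  symm
  calc
    _ = (α_ _ _ _).inv ≫ crossI A V ▷ X ▷ Y ≫ crossHom A V V X hX ▷ Y ≫ (α_ _ _ _).hom ≫
          X ◁ ((crossP A V ≫ crossI A V) ▷ Y ≫ crossHom A V V Y hY) ≫ X ◁ Y ◁ crossP A V ≫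
            (α_ _ _ _).inv := by
        rw [crossGamma, crossGamma]; monoidal
    _ = (α_ _ _ _).inv ≫ crossI A V ▷ X ▷ Y ≫ (crossHom A V V X hX ▷ Y ≫ (α_ _ _ _).hom ≫
          X ◁ (crossHom A V V Y hY)) ≫ X ◁ Y ◁ crossP A V ≫ (α_ _ _ _).inv := by
        rw [crossP_crossI, crossProj_crossHom]; monoidal
    _ = _ := by
        rw [crossHom_crossHom A V V V hX hY hXY, crossGamma]; monoidal

lemma crossGamma_one (A : GradedCenter P) (V : InvDimObj P α) (h : P.comp 1 (𝟙_ C)) :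
    crossGamma A V (𝟙_ C) h = (ρ_ _).hom ≫ (λ_ _).inv := by
  calc
    _ = (ρ_ _).hom ≫ crossI A V ≫ crossProj A V V ≫ crossP A V ≫ (λ_ _).inv := by
        rw [crossGamma, crossProj]; monoidal
    _ = _ := by
        rw [← crossP_crossI]; simp [reassoc_of% crossI_crossP A V]

/-- The object `φ_V(A)` of the graded center: the image of `π` with its half braiding `γ`. -/
def crossObj (V : InvDimObj P α) (A : GradedCenter P) : GradedCenter P where
  obj := crossE A V
  hb := RelHalfBraiding.ofLax P.isPivotalSub (crossGamma A V) (crossGamma_nat A V)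
    (crossGamma_mul A V) (crossGamma_one A V)

lemma crossHomAux {A B : GradedCenter P} (V U : InvDimObj P α) (X : C) (hX : P.comp 1 X)
    (g : A ⟶ B) :
    (crossI A V ≫ crossProj A V U ≫ dual U.1 ◁ g.f ▷ U.1 ≫ crossP B U) ▷ X ≫
      crossGamma B U X hX = crossGamma A V X hX ≫
        X ◁ (crossI A V ≫ crossProj A V U ≫ dual U.1 ◁ g.f ▷ U.1 ≫ crossP B U) := by
  calc
    _ = crossI A V ▷ X ≫ crossProj A V U ▷ X ≫ (dual U.1 ◁ g.f ▷ U.1) ▷ X ≫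
          ((crossP B U ≫ crossI B U) ▷ X ≫ crossHom B U U X hX) ≫ X ◁ crossP B U := by
        rw [crossGamma]; monoidal
    _ = crossI A V ▷ X ≫ (crossProj A V U ▷ X ≫ crossHom A U U X hX) ≫
          X ◁ (dual U.1 ◁ g.f ▷ U.1) ≫ X ◁ crossP B U := by
        rw [crossP_crossI, crossProj_crossHom, reassoc_of% crossHom_map g U U X hX,
          Category.assoc]
    _ = crossI A V ▷ X ≫ (crossHom A V V X hX ≫ X ◁ crossProj A V U) ≫
          X ◁ (dual U.1 ◁ g.f ▷ U.1) ≫ X ◁ crossP B U := by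
        rw [crossProj_crossHom, crossHom_crossProj]
    _ = crossI A V ▷ X ≫ crossHom A V V X hX ≫ X ◁ (crossProj A V V ≫ crossProj A V U) ≫
          X ◁ (dual U.1 ◁ g.f ▷ U.1) ≫ X ◁ crossP B U := by
        rw [crossProj_crossProj, Category.assoc]
    _ = _ := by
        rw [crossGamma, ← crossP_crossI]; monoidal

/-- The functor `φ_V` on morphisms. -/
def crossMap (V : InvDimObj P α) {A B : GradedCenter P} (g : A ⟶ B) :
    crossObj V A ⟶ crossObj V B where
  f := (crossI A V ≫ dual V.1 ◁ g.f ▷ V.1 ≫ crossP B V : crossE A V ⟶ crossE B V)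
  comm X hX := by
    have h := crossHomAux V V X hX g
    have e : crossI A V ≫ crossProj A V V ≫ dual V.1 ◁ g.f ▷ V.1 ≫ crossP B V =
        crossI A V ≫ dual V.1 ◁ g.f ▷ V.1 ≫ crossP B V := by
      rw [← crossP_crossI, Category.assoc, reassoc_of% crossI_crossP A V]
    rw [e] at h
    exact h

/-- The functor `φ_V` on the graded center. -/
def crossV (V : InvDimObj P α) : GradedCenter P ⥤ GradedCenter P where
  obj A := crossObj V A
  map g := crossMap V g
  map_id A := RelCenter.hom_ext (by
    change crossI A V ≫ dual V.1 ◁ (𝟙 A.obj) ▷ V.1 ≫ crossP A V = 𝟙 _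
    simp [crossI_crossP])
  map_comp {A B E} f g := RelCenter.hom_ext (by
    change crossI A V ≫ dual V.1 ◁ (f.f ≫ g.f) ▷ V.1 ≫ crossP E V =
      (crossI A V ≫ dual V.1 ◁ f.f ▷ V.1 ≫ crossP B V) ≫
        (crossI B V ≫ dual V.1 ◁ g.f ▷ V.1 ≫ crossP E V)
    have h : crossP B V ≫ crossI B V ≫ dual V.1 ◁ g.f ▷ V.1 ≫ crossP E V =
        dual V.1 ◁ g.f ▷ V.1 ≫ crossP E V := by
      rw [← Category.assoc, crossP_crossI, ← Category.assoc, ← crossProj_map, Category.assoc,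
        ← crossP_crossI, Category.assoc, crossI_crossP, Category.comp_id]
    simp [h])

/-- The morphism `δ : φ_V(A) ⟶ φ_U(A)`. -/
def crossDelta (V U : InvDimObj P α) (A : GradedCenter P) : crossObj V A ⟶ crossObj U A where
  f := (crossI A V ≫ crossProj A V U ≫ crossP A U : crossE A V ⟶ crossE A U)
  comm X hX := by
    have h := crossHomAux V U X hX (𝟙 A)
    simp only [RelCenter.id_f, id_whiskerRight, MonoidalCategory.whiskerLeft_id,
      Category.id_comp] at h
    exact h

/-- The functors `φ_V` and the morphisms `δ`, for `V` running over the objects of degree `α` with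
invertible left dimension, as a diagram of functors. -/
def crossDiagram (P : GGrading G C) (α : G) :
    Codiscrete (InvDimObj P α) ⥤ (GradedCenter P ⥤ GradedCenter P) where
  obj V := crossV V.as
  map {V U} _ :=
    { app := fun A => crossDelta V.as U.as A
      naturality := fun A B g => RelCenter.hom_ext (by
        change (crossI A V.as ≫ dual V.as.1 ◁ g.f ▷ V.as.1 ≫ crossP B V.as) ≫
            (crossI B V.as ≫ crossProj B V.as U.as ≫ crossP B U.as) =
          (crossI A V.as ≫ crossProj A V.as U.as ≫ crossP A U.as) ≫
            (crossI A U.as ≫ dual U.as.1 ◁ g.f ▷ U.as.1 ≫ crossP B U.as)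
        calc
          _ = crossI A V.as ≫ dual V.as.1 ◁ g.f ▷ V.as.1 ≫
                ((crossP B V.as ≫ crossI B V.as) ≫ crossProj B V.as U.as) ≫ crossP B U.as := by
              simp only [Category.assoc]
          _ = crossI A V.as ≫ (crossProj A V.as U.as ≫ dual U.as.1 ◁ g.f ▷ U.as.1) ≫
                crossP B U.as := by
              rw [crossP_crossI, crossProj_crossProj, ← crossProj_map, Category.assoc]
          _ = crossI A V.as ≫ ((crossProj A V.as U.as ≫ crossProj A U.as U.as) ≫
                dual U.as.1 ◁ g.f ▷ U.as.1) ≫ crossP B U.as := by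
              rw [crossProj_crossProj]
          _ = _ := by
              rw [← crossP_crossI]; simp only [Category.assoc]) }
  map_id V := by
    ext A
    change crossI A V.as ≫ crossProj A V.as V.as ≫ crossP A V.as = 𝟙 _
    rw [← crossP_crossI, Category.assoc, reassoc_of% crossI_crossP A V.as, crossI_crossP]
  map_comp {V U W} _ _ := by
    ext A
    change crossI A V.as ≫ crossProj A V.as W.as ≫ crossP A W.as =
      (crossI A V.as ≫ crossProj A V.as U.as ≫ crossP A U.as) ≫
        (crossI A U.as ≫ crossProj A U.as W.as ≫ crossP A W.as)
    calc
      _ = crossI A V.as ≫ (crossProj A V.as U.as ≫ crossProj A U.as U.as ≫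
            crossProj A U.as W.as) ≫ crossP A W.as := by
          rw [crossProj_crossProj, crossProj_crossProj]
      _ = _ := by
          rw [← crossP_crossI]; simp only [Category.assoc]

lemma crossDiagram_hasLimit (P : GGrading G C) (α : G) (h : Nonempty (InvDimObj P α)) :
    HasLimit (crossDiagram P α) := by
  obtain ⟨V⟩ := h
  have : HasInitial (Codiscrete (InvDimObj P α)) :=
    IsInitial.hasInitial (X := Codiscrete.mk V) (IsInitial.ofUnique _)
  infer_instance

/-- The crossing functor `φ_α`: the projective limit of the functors `φ_V` along the morphisms
`δ`. -/
def crossing (P : GGrading G C) (α : G) (h : Nonempty (InvDimObj P α)) :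
    GradedCenter P ⥤ GradedCenter P :=
  haveI := crossDiagram_hasLimit P α h
  limit (crossDiagram P α)

end Crossing

section Centralizer

open PivotalCategory

variable {G : Type w} [Group G] {C : Type u} [Category.{v} C] [Preadditive C]
  [HasFiniteBiproducts C] [MonoidalCategory C] [PivotalCategory C]

/-- The functor `(Y, Y') ↦ Y* ⊗ X ⊗ Y'` on the component of degree `α`. -/
def zIntegrand (P : GGrading G C) (α : G) (X : C) :
    (P.comp α).FullSubcategoryᵒᵖ ⥤ (P.comp α).FullSubcategory ⥤ C where
  obj Y :=
    { obj := fun Y' => dual Y.unop.obj ⊗ (X ⊗ Y'.obj)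
      map := fun g => dual Y.unop.obj ◁ X ◁ g.hom }
  map f :=
    { app := fun Y' => dualMap f.unop.hom ▷ (X ⊗ Y'.obj)
      naturality := fun _ _ g => whisker_exchange (dualMap f.unop.hom) (X ◁ g.hom) }
  map_id Y := by ext; simp [dualMap_id]
  map_comp f g := by ext; simp [dualMap_comp]

/-- A grading is centralizable if all the coends `∫^{Y ∈ C_α} Y* ⊗ X ⊗ Y` exist. -/
class GCentralizable (P : GGrading G C) : Prop where
  hasCoend (α : G) (X : C) : HasCoend (zIntegrand P α X)

variable (P : GGrading G C) [hP : GCentralizable P] (α : G)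

instance (X : C) : HasCoend (zIntegrand P α X) := hP.hasCoend α X

/-- The coend `Z_α(X) = ∫^{Y ∈ C_α} Y* ⊗ X ⊗ Y`. -/
def Zobj (X : C) : C := coend (zIntegrand P α X)

/-- The universal dinatural transformation of `Z_α(X)`. -/
def Zrho (X Y : C) (hY : P.comp α Y) : dual Y ⊗ (X ⊗ Y) ⟶ Zobj P α X :=
  coend.ι (zIntegrand P α X) ⟨Y, hY⟩

/-- The morphism `∂_{X,Y} : X ⊗ Y ⟶ Y ⊗ Z_α(X)` adjoint to the universal dinatural
transformation. -/
def Zd (X Y : C) (hY : P.comp α Y) : X ⊗ Y ⟶ Y ⊗ Zobj P α X :=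
  𝟙 _ ⊗≫ coev Y ▷ (X ⊗ Y) ⊗≫ Y ◁ Zrho P α X Y hY

lemma Zrho_dinat (X : C) {Y Y' : C} (hY : P.comp α Y) (hY' : P.comp α Y') (f : Y ⟶ Y') :
    dualMap f ▷ (X ⊗ Y) ≫ Zrho P α X Y hY = dual Y' ◁ X ◁ f ≫ Zrho P α X Y' hY' :=
  coend.condition (zIntegrand P α X)
    (ObjectProperty.homMk f : (⟨Y, hY⟩ : (P.comp α).FullSubcategory) ⟶ ⟨Y', hY'⟩)

lemma Zd_nat (X : C) {Y Y' : C} (hY : P.comp α Y) (hY' : P.comp α Y') (f : Y ⟶ Y') :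
    X ◁ f ≫ Zd P α X Y' hY' = Zd P α X Y hY ≫ f ▷ Zobj P α X := by
  dsimp only [Zd]
  calc
    _ = 𝟙 _ ⊗≫ (𝟙_ C ◁ X ◁ f ≫ coev Y' ▷ (X ⊗ Y')) ⊗≫ Y' ◁ Zrho P α X Y' hY' := by monoidal
    _ = 𝟙 _ ⊗≫ coev Y' ▷ (X ⊗ Y) ⊗≫ Y' ◁ (dual Y' ◁ X ◁ f ≫ Zrho P α X Y' hY') := by
        rw [whisker_exchange]; monoidal
    _ = 𝟙 _ ⊗≫ (coev Y' ≫ Y' ◁ dualMap f) ▷ (X ⊗ Y) ⊗≫ Y' ◁ Zrho P α X Y hY := by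
        rw [← Zrho_dinat P α X hY hY' f]; monoidal
    _ = 𝟙 _ ⊗≫ coev Y ▷ (X ⊗ Y) ⊗≫ (f ▷ (dual Y ⊗ (X ⊗ Y)) ≫ Y' ◁ Zrho P α X Y hY) := by
        rw [coev_dualMap]; monoidal
    _ = _ := by rw [← whisker_exchange]; monoidal

/-- The universal property of `Z_α(X)`, in terms of `∂`. -/
def Zdesc (X M : C) (t : ∀ Y : C, P.comp α Y → (X ⊗ Y ⟶ Y ⊗ M))
    (ht : ∀ (Y Y' : C) (hY : P.comp α Y) (hY' : P.comp α Y') (f : Y ⟶ Y'),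
      X ◁ f ≫ t Y' hY' = t Y hY ≫ f ▷ M) : Zobj P α X ⟶ M :=
  coend.desc (F := zIntegrand P α X)
    (fun Y => 𝟙 (dual Y.obj ⊗ (X ⊗ Y.obj)) ⊗≫ dual Y.obj ◁ t Y.obj Y.property ⊗≫
      ev Y.obj ▷ M ⊗≫ 𝟙 M)
    (by
      rintro ⟨Y, hY⟩ ⟨Y', hY'⟩ f
      change dualMap f.hom ▷ (X ⊗ Y) ≫ (𝟙 (dual Y ⊗ (X ⊗ Y)) ⊗≫ dual Y ◁ t Y hY ⊗≫
          ev Y ▷ M ⊗≫ 𝟙 M) = dual Y' ◁ X ◁ f.hom ≫ (𝟙 (dual Y' ⊗ (X ⊗ Y')) ⊗≫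
            dual Y' ◁ t Y' hY' ⊗≫ ev Y' ▷ M ⊗≫ 𝟙 M)
      have h : (dualMap f.hom ▷ Y ≫ ev Y) = dual Y' ◁ f.hom ≫ ev Y' := dualMap_ev f.hom
      calc
        _ = 𝟙 _ ⊗≫ (dualMap f.hom ▷ (X ⊗ Y) ≫ dual Y ◁ t Y hY) ⊗≫ ev Y ▷ M ⊗≫ 𝟙 M := by monoidal
        _ = 𝟙 _ ⊗≫ dual Y' ◁ t Y hY ⊗≫ (dualMap f.hom ▷ Y ≫ ev Y) ▷ M ⊗≫ 𝟙 M := by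
            rw [← whisker_exchange]; monoidal
        _ = 𝟙 _ ⊗≫ dual Y' ◁ (t Y hY ≫ f.hom ▷ M) ⊗≫ ev Y' ▷ M ⊗≫ 𝟙 M := by
            rw [h]; monoidal
        _ = _ := by rw [← ht Y Y' hY hY' f.hom]; monoidal)

lemma Zd_Zdesc (X M : C) (t : ∀ Y : C, P.comp α Y → (X ⊗ Y ⟶ Y ⊗ M))
    (ht : ∀ (Y Y' : C) (hY : P.comp α Y) (hY' : P.comp α Y') (f : Y ⟶ Y'),
      X ◁ f ≫ t Y' hY' = t Y hY ≫ f ▷ M) (Y : C) (hY : P.comp α Y) :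
    Zd P α X Y hY ≫ Y ◁ Zdesc P α X M t ht = t Y hY := by
  have h : Zrho P α X Y hY ≫ Zdesc P α X M t ht =
      𝟙 (dual Y ⊗ (X ⊗ Y)) ⊗≫ dual Y ◁ t Y hY ⊗≫ ev Y ▷ M ⊗≫ 𝟙 M :=
    coend.ι_desc (F := zIntegrand P α X) _ _ ⟨Y, hY⟩
  calc
    _ = 𝟙 _ ⊗≫ coev Y ▷ (X ⊗ Y) ⊗≫ Y ◁ (Zrho P α X Y hY ≫ Zdesc P α X M t ht) := by
        rw [Zd]; monoidal
    _ = 𝟙 _ ⊗≫ (coev Y ▷ (X ⊗ Y) ≫ (Y ⊗ dual Y) ◁ t Y hY) ⊗≫ Y ◁ ev Y ▷ M ⊗≫ 𝟙 _ := by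
        rw [h]; monoidal
    _ = 𝟙 _ ⊗≫ t Y hY ⊗≫ (coev Y ▷ Y ⊗≫ Y ◁ ev Y) ▷ M ⊗≫ 𝟙 _ := by
        rw [← whisker_exchange]; monoidal
    _ = _ := by rw [zag_left]; monoidal

lemma Zrho_eq (X Y : C) (hY : P.comp α Y) : Zrho P α X Y hY =
    𝟙 _ ⊗≫ dual Y ◁ Zd P α X Y hY ⊗≫ ev Y ▷ Zobj P α X ⊗≫ 𝟙 _ := by
  symm
  calc
    _ = 𝟙 _ ⊗≫ dual Y ◁ coev Y ▷ (X ⊗ Y) ⊗≫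
          ((dual Y ⊗ Y) ◁ Zrho P α X Y hY ≫ ev Y ▷ Zobj P α X) ⊗≫ 𝟙 _ := by
        rw [Zd]; monoidal
    _ = 𝟙 _ ⊗≫ (dual Y ◁ coev Y ⊗≫ ev Y ▷ dual Y) ▷ (X ⊗ Y) ⊗≫ Zrho P α X Y hY := by
        rw [whisker_exchange]; monoidal
    _ = _ := by rw [zig_left]; monoidal

lemma Zhom_ext {X M : C} {f g : Zobj P α X ⟶ M}
    (h : ∀ (Y : C) (hY : P.comp α Y), Zd P α X Y hY ≫ Y ◁ f = Zd P α X Y hY ≫ Y ◁ g) : f = g := by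
  refine coend.hom_ext (F := zIntegrand P α X) ?_
  rintro ⟨Y, hY⟩
  change Zrho P α X Y hY ≫ f = Zrho P α X Y hY ≫ g
  have key : ∀ k : Zobj P α X ⟶ M, Zrho P α X Y hY ≫ k =
      𝟙 _ ⊗≫ dual Y ◁ (Zd P α X Y hY ≫ Y ◁ k) ⊗≫ ev Y ▷ M ⊗≫ 𝟙 _ := by
    intro k
    rw [Zrho_eq]
    calc
      _ = 𝟙 _ ⊗≫ dual Y ◁ Zd P α X Y hY ⊗≫ (ev Y ▷ Zobj P α X ≫ 𝟙_ C ◁ k) ⊗≫ 𝟙 _ := by monoidal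
      _ = _ := by rw [← whisker_exchange]; monoidal
  rw [key, key, h]

/-- The functor `Z_α` on morphisms. -/
def Zmap {X X' : C} (f : X ⟶ X') : Zobj P α X ⟶ Zobj P α X' :=
  Zdesc P α X _ (fun Y hY => f ▷ Y ≫ Zd P α X' Y hY) (fun _ _ hY hY' g => by
    rw [whisker_exchange_assoc, Zd_nat P α X' hY hY', Category.assoc])

lemma Zd_Zmap {X X' : C} (f : X ⟶ X') (Y : C) (hY : P.comp α Y) :
    Zd P α X Y hY ≫ Y ◁ Zmap P α f = f ▷ Y ≫ Zd P α X' Y hY := by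
  rw [Zmap, Zd_Zdesc]

lemma Zmap_id (X : C) : Zmap P α (𝟙 X) = 𝟙 _ := by
  apply Zhom_ext; intro Y hY; rw [Zd_Zmap]; simp

lemma Zmap_comp {X X' X'' : C} (f : X ⟶ X') (g : X' ⟶ X'') :
    Zmap P α (f ≫ g) = Zmap P α f ≫ Zmap P α g := by
  apply Zhom_ext; intro Y hY
  rw [Zd_Zmap, MonoidalCategory.whiskerLeft_comp, reassoc_of% Zd_Zmap P α f Y hY, Zd_Zmap]
  simp

/-- The comonoidal constraint `Z_α(X₁ ⊗ X₂) ⟶ Z_α(X₁) ⊗ Z_α(X₂)`. -/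
def Zcomul (X₁ X₂ : C) : Zobj P α (X₁ ⊗ X₂) ⟶ Zobj P α X₁ ⊗ Zobj P α X₂ :=
  Zdesc P α (X₁ ⊗ X₂) _
    (fun Y hY => (α_ _ _ _).hom ≫ X₁ ◁ Zd P α X₂ Y hY ≫ (α_ _ _ _).inv ≫
      Zd P α X₁ Y hY ▷ Zobj P α X₂ ≫ (α_ _ _ _).hom)
    (fun Y Y' hY hY' f => by
      calc
        _ = (α_ _ _ _).hom ≫ X₁ ◁ (X₂ ◁ f ≫ Zd P α X₂ Y' hY') ≫ (α_ _ _ _).inv ≫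
              Zd P α X₁ Y' hY' ▷ Zobj P α X₂ ≫ (α_ _ _ _).hom := by monoidal
        _ = (α_ _ _ _).hom ≫ X₁ ◁ Zd P α X₂ Y hY ≫ (α_ _ _ _).inv ≫
              (X₁ ◁ f ≫ Zd P α X₁ Y' hY') ▷ Zobj P α X₂ ≫ (α_ _ _ _).hom := by
            rw [Zd_nat P α X₂ hY hY']; monoidal
        _ = _ := by rw [Zd_nat P α X₁ hY hY']; monoidal)

lemma Zd_Zcomul (X₁ X₂ Y : C) (hY : P.comp α Y) :
    Zd P α (X₁ ⊗ X₂) Y hY ≫ Y ◁ Zcomul P α X₁ X₂ =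
      (α_ _ _ _).hom ≫ X₁ ◁ Zd P α X₂ Y hY ≫ (α_ _ _ _).inv ≫
        Zd P α X₁ Y hY ▷ Zobj P α X₂ ≫ (α_ _ _ _).hom := by
  rw [Zcomul, Zd_Zdesc]

/-- For `Y` of degree `α`, the morphism `Z_β(X) ⊗ Y ⟶ Y ⊗ Z_{βα}(X)` characterized by
`Zd_ZmulAux`. -/
def ZmulAux {α β γ : G} (h : β * α = γ) (X Y : C) (hY : P.comp α Y) :
    Zobj P β X ⊗ Y ⟶ Y ⊗ Zobj P γ X :=
  Zdesc P β X ((Y ⊗ Zobj P γ X) ⊗ dual Y)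
      (fun Y' hY' => 𝟙 _ ⊗≫ (X ⊗ Y') ◁ coev Y ⊗≫
        Zd P γ X (Y' ⊗ Y) (P.eq_comp (P.tensor hY' hY) h) ▷ dual Y ⊗≫ 𝟙 _)
      (fun Y₁ Y₂ h₁ h₂ f => by
        calc
          _ = 𝟙 _ ⊗≫ ((X ◁ f) ▷ 𝟙_ C ≫ (X ⊗ Y₂) ◁ coev Y) ⊗≫
                Zd P γ X (Y₂ ⊗ Y) (P.eq_comp (P.tensor h₂ hY) h) ▷ dual Y ⊗≫ 𝟙 _ := by monoidal
          _ = 𝟙 _ ⊗≫ (X ⊗ Y₁) ◁ coev Y ⊗≫ (X ◁ f ▷ Y ≫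
                Zd P γ X (Y₂ ⊗ Y) (P.eq_comp (P.tensor h₂ hY) h)) ▷ dual Y ⊗≫ 𝟙 _ := by
              rw [← whisker_exchange]; monoidal
          _ = _ := by
              rw [Zd_nat P γ X (P.eq_comp (P.tensor h₁ hY) h)]; monoidal) ▷ Y ⊗≫
    (Y ⊗ Zobj P γ X) ◁ ev Y ⊗≫ 𝟙 _

lemma Zd_ZmulAux {α β γ : G} (h : β * α = γ) (X Y Y' : C) (hY : P.comp α Y) (hY' : P.comp β Y') :
    Zd P β X Y' hY' ▷ Y ≫ (α_ _ _ _).hom ≫ Y' ◁ ZmulAux P h X Y hY =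
      (α_ _ _ _).hom ≫ Zd P γ X (Y' ⊗ Y) (P.eq_comp (P.tensor hY' hY) h) ≫ (α_ _ _ _).hom := by
  rw [ZmulAux]
  set q := Zdesc P β X ((Y ⊗ Zobj P γ X) ⊗ dual Y) _ _ with hq
  have e : Zd P β X Y' hY' ≫ Y' ◁ q = 𝟙 _ ⊗≫ (X ⊗ Y') ◁ coev Y ⊗≫
        Zd P γ X (Y' ⊗ Y) (P.eq_comp (P.tensor hY' hY) h) ▷ dual Y ⊗≫ 𝟙 _ :=
    by rw [hq, Zd_Zdesc]
  clear_value q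
  calc
    _ = 𝟙 _ ⊗≫ (Zd P β X Y' hY' ≫ Y' ◁ q) ▷ Y ⊗≫ (Y' ⊗ Y ⊗ Zobj P γ X) ◁ ev Y ⊗≫ 𝟙 _ := by monoidal
    _ = 𝟙 _ ⊗≫ (X ⊗ Y') ◁ coev Y ▷ Y ⊗≫
          (Zd P γ X (Y' ⊗ Y) (P.eq_comp (P.tensor hY' hY) h) ▷ (dual Y ⊗ Y) ≫
            ((Y' ⊗ Y) ⊗ Zobj P γ X) ◁ ev Y) ⊗≫ 𝟙 _ := by
        rw [e]; monoidal
    _ = 𝟙 _ ⊗≫ (X ⊗ Y') ◁ (coev Y ▷ Y ⊗≫ Y ◁ ev Y) ⊗≫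
          Zd P γ X (Y' ⊗ Y) (P.eq_comp (P.tensor hY' hY) h) ⊗≫ 𝟙 _ := by
        rw [← whisker_exchange]; monoidal
    _ = _ := by rw [zag_left]; monoidal

lemma ZmulAux_ext {β : G} {X Y M : C} {f g : Zobj P β X ⊗ Y ⟶ M}
    (h : ∀ (Y' : C) (hY' : P.comp β Y'), Zd P β X Y' hY' ▷ Y ≫ (α_ _ _ _).hom ≫ Y' ◁ f =
      Zd P β X Y' hY' ▷ Y ≫ (α_ _ _ _).hom ≫ Y' ◁ g) : f = g := by
  have key : ∀ k : Zobj P β X ⊗ Y ⟶ M, k =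
      (𝟙 _ ⊗≫ Zobj P β X ◁ coev Y ⊗≫ k ▷ dual Y) ▷ Y ⊗≫ M ◁ ev Y ⊗≫ 𝟙 _ := by
    intro k
    symm
    calc
      _ = 𝟙 _ ⊗≫ Zobj P β X ◁ coev Y ▷ Y ⊗≫ (k ▷ (dual Y ⊗ Y) ≫ M ◁ ev Y) ⊗≫ 𝟙 _ := by monoidal
      _ = 𝟙 _ ⊗≫ Zobj P β X ◁ (coev Y ▷ Y ⊗≫ Y ◁ ev Y) ⊗≫ k := by
          rw [← whisker_exchange]; monoidal
      _ = _ := by rw [zag_left]; monoidal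
  have : (𝟙 _ ⊗≫ Zobj P β X ◁ coev Y ⊗≫ f ▷ dual Y : Zobj P β X ⟶ M ⊗ dual Y) =
      𝟙 _ ⊗≫ Zobj P β X ◁ coev Y ⊗≫ g ▷ dual Y := by
    apply Zhom_ext
    intro Y' hY'
    have key2 : ∀ k : Zobj P β X ⊗ Y ⟶ M, Zd P β X Y' hY' ≫
        Y' ◁ (𝟙 _ ⊗≫ Zobj P β X ◁ coev Y ⊗≫ k ▷ dual Y) = 𝟙 _ ⊗≫ (X ⊗ Y') ◁ coev Y ⊗≫
          (Zd P β X Y' hY' ▷ Y ≫ (α_ _ _ _).hom ≫ Y' ◁ k) ▷ dual Y ⊗≫ 𝟙 _ := by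
      intro k
      calc
        _ = 𝟙 _ ⊗≫ (Zd P β X Y' hY' ▷ 𝟙_ C ≫ (Y' ⊗ Zobj P β X) ◁ coev Y) ⊗≫
              Y' ◁ k ▷ dual Y ⊗≫ 𝟙 _ := by monoidal
        _ = _ := by rw [← whisker_exchange]; monoidal
    rw [key2, key2, h]
  rw [key f, key g, this]

/-- The multiplication `Z_α Z_β ⟶ Z_{βα}`. -/
def Zmul {α β γ : G} (h : β * α = γ) (X : C) : Zobj P α (Zobj P β X) ⟶ Zobj P γ X :=
  Zdesc P α _ _ (fun Y hY => ZmulAux P h X Y hY) (fun Y₁ Y₂ h₁ h₂ f => by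
    apply ZmulAux_ext
    intro Y' hY'
    have e1 := Zd_ZmulAux P h X Y₁ Y' h₁ hY'
    have e2 := Zd_ZmulAux P h X Y₂ Y' h₂ hY'
    have n := Zd_nat P γ X (P.eq_comp (P.tensor hY' h₁) h) (P.eq_comp (P.tensor hY' h₂) h) (Y' ◁ f)
    calc
      _ = (X ⊗ Y') ◁ f ≫ (Zd P β X Y' hY' ▷ Y₂ ≫ (α_ _ _ _).hom ≫
            Y' ◁ ZmulAux P h X Y₂ h₂) := by
          rw [MonoidalCategory.whisker_exchange_assoc]; monoidal
      _ = (α_ _ _ _).hom ≫ (X ◁ Y' ◁ f ≫ Zd P γ X (Y' ⊗ Y₂) (P.eq_comp (P.tensor hY' h₂) h)) ≫ (α_ _ _ _).hom := by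
          rw [e2]; monoidal
      _ = ((α_ _ _ _).hom ≫ Zd P γ X (Y' ⊗ Y₁) (P.eq_comp (P.tensor hY' h₁) h) ≫
            (α_ _ _ _).hom) ≫ Y' ◁ f ▷ Zobj P γ X := by
          rw [n]; monoidal
      _ = _ := by rw [← e1]; monoidal)

lemma Zd_Zmul {α β γ : G} (h : β * α = γ) (X Y Y' : C) (hY : P.comp α Y) (hY' : P.comp β Y') :
    Zd P β X Y' hY' ▷ Y ≫ (α_ _ _ _).hom ≫ Y' ◁ Zd P α (Zobj P β X) Y hY ≫
        Y' ◁ Y ◁ Zmul P h X =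
      (α_ _ _ _).hom ≫ Zd P γ X (Y' ⊗ Y) (P.eq_comp (P.tensor hY' hY) h) ≫ (α_ _ _ _).hom := by
  rw [← Zd_ZmulAux P h X Y Y' hY hY', ← MonoidalCategory.whiskerLeft_comp,
    Zmul, Zd_Zdesc]

lemma Zobj_mem {α β γ : G} (h : α⁻¹ * β * α = γ) {X : C} (hX : P.comp β X) :
    P.comp γ (Zobj P α X) := by
  refine P.mem_of_test _ _ fun δ hδ M hM f => ?_
  apply Zhom_ext
  intro Y hY
  have z : ∀ g : Zobj P α X ⟶ M, Zd P α X Y hY ≫ Y ◁ g = 0 := fun g => by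
    refine P.hom_zero ?_ (P.tensor hX hY) (P.tensor hY hM) _
    intro e
    apply hδ
    rw [← h, mul_assoc, e]; group
  rw [z, z]

variable [MonoidalPreadditive C]

/-- The left antipode `Z₁(Z₁(X)*) ⟶ X*` of the Hopf monad `Z₁`. -/
def Zantipode (X : C) : Zobj P 1 (dual (Zobj P 1 X)) ⟶ dual X :=
  Zdesc P 1 _ _
    (fun Y hY => 𝟙 _ ⊗≫ (dual (Zobj P 1 X) ⊗ Y) ◁ coev X ⊗≫
      (dual (Zobj P 1 X) ⊗ Y ⊗ X) ◁ coevt Y ▷ dual X ⊗≫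
        (dual (Zobj P 1 X) ⊗ Y) ◁ Zd P 1 X (dual Y) (P.isPivotalSub.dual hY) ▷ (Y ⊗ dual X) ⊗≫
          dual (Zobj P 1 X) ◁ evt Y ▷ (Zobj P 1 X ⊗ Y ⊗ dual X) ⊗≫
            ev (Zobj P 1 X) ▷ (Y ⊗ dual X) ⊗≫ 𝟙 _)
    (fun Y₁ Y₂ h₁ h₂ f => by
      have n := Zd_nat P 1 X (P.isPivotalSub.dual h₂) (P.isPivotalSub.dual h₁) (dualMap f)
      have e1 := dualMap_evt f
      have e2 := coevt_dualMap f
      set Z := Zobj P 1 X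
      calc
        _ = 𝟙 _ ⊗≫ dual Z ◁ (f ▷ 𝟙_ C ≫ Y₂ ◁ (coev X ⊗≫ X ◁ coevt Y₂ ▷ dual X ⊗≫
              Zd P 1 X (dual Y₂) (P.isPivotalSub.dual h₂) ▷ (Y₂ ⊗ dual X))) ⊗≫
                dual Z ◁ evt Y₂ ▷ (Z ⊗ Y₂ ⊗ dual X) ⊗≫
                  ev Z ▷ (Y₂ ⊗ dual X) ⊗≫ 𝟙 _ := by monoidal
        _ = 𝟙 _ ⊗≫ dual Z ◁ (Y₁ ◁ (coev X ⊗≫ X ◁ coevt Y₂ ▷ dual X ⊗≫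
              Zd P 1 X (dual Y₂) (P.isPivotalSub.dual h₂) ▷ (Y₂ ⊗ dual X))) ⊗≫
                dual Z ◁ (f ▷ dual Y₂ ≫ evt Y₂) ▷ (Z ⊗ Y₂ ⊗ dual X) ⊗≫
                  ev Z ▷ (Y₂ ⊗ dual X) ⊗≫ 𝟙 _ := by
            rw [← whisker_exchange]; monoidal
        _ = 𝟙 _ ⊗≫ dual Z ◁ (Y₁ ◁ (coev X ⊗≫ X ◁ coevt Y₂ ▷ dual X ⊗≫
              (Zd P 1 X (dual Y₂) (P.isPivotalSub.dual h₂) ≫ dualMap f ▷ Z) ▷ (Y₂ ⊗ dual X))) ⊗≫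
                dual Z ◁ evt Y₁ ▷ (Z ⊗ Y₂ ⊗ dual X) ⊗≫
                  ev Z ▷ (Y₂ ⊗ dual X) ⊗≫ 𝟙 _ := by
            rw [← e1]; monoidal
        _ = 𝟙 _ ⊗≫ dual Z ◁ (Y₁ ◁ (coev X ⊗≫ X ◁ (coevt Y₂ ≫ dualMap f ▷ Y₂) ▷ dual X ⊗≫
              Zd P 1 X (dual Y₁) (P.isPivotalSub.dual h₁) ▷ (Y₂ ⊗ dual X))) ⊗≫
                dual Z ◁ evt Y₁ ▷ (Z ⊗ Y₂ ⊗ dual X) ⊗≫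
                  ev Z ▷ (Y₂ ⊗ dual X) ⊗≫ 𝟙 _ := by
            rw [← n]; monoidal
        _ = 𝟙 _ ⊗≫ dual Z ◁ (Y₁ ◁ (coev X ⊗≫ X ◁ coevt Y₁ ▷ dual X ⊗≫
              ((X ⊗ dual Y₁) ◁ (f ▷ dual X) ≫
                Zd P 1 X (dual Y₁) (P.isPivotalSub.dual h₁) ▷ (Y₂ ⊗ dual X)))) ⊗≫
                dual Z ◁ evt Y₁ ▷ (Z ⊗ Y₂ ⊗ dual X) ⊗≫
                  ev Z ▷ (Y₂ ⊗ dual X) ⊗≫ 𝟙 _ := by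
            rw [e2]; monoidal
        _ = 𝟙 _ ⊗≫ dual Z ◁ (Y₁ ◁ (coev X ⊗≫ X ◁ coevt Y₁ ▷ dual X ⊗≫
              Zd P 1 X (dual Y₁) (P.isPivotalSub.dual h₁) ▷ (Y₁ ⊗ dual X))) ⊗≫
                dual Z ◁ ((Y₁ ⊗ dual Y₁) ◁ (Z ◁ f ▷ dual X) ≫ evt Y₁ ▷ (Z ⊗ Y₂ ⊗ dual X)) ⊗≫
                  ev Z ▷ (Y₂ ⊗ dual X) ⊗≫ 𝟙 _ := by
            rw [whisker_exchange]; monoidal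
        _ = 𝟙 _ ⊗≫ dual Z ◁ (Y₁ ◁ (coev X ⊗≫ X ◁ coevt Y₁ ▷ dual X ⊗≫
              Zd P 1 X (dual Y₁) (P.isPivotalSub.dual h₁) ▷ (Y₁ ⊗ dual X))) ⊗≫
                dual Z ◁ evt Y₁ ▷ (Z ⊗ Y₁ ⊗ dual X) ⊗≫
                  ((dual Z ⊗ Z) ◁ (f ▷ dual X) ≫ ev Z ▷ (Y₂ ⊗ dual X)) ⊗≫ 𝟙 _ := by
            rw [whisker_exchange]; monoidal
        _ = _ := by rw [whisker_exchange]; monoidal)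

end Centralizer

section Coends

open PivotalCategory

variable {G : Type w} [Group G] {C : Type u} [Category.{v} C] [Preadditive C]
  [HasFiniteBiproducts C] [MonoidalCategory C] [PivotalCategory C]

/-- `X` is a coend of `F`: it is the target of a universal dinatural transformation. -/
def IsCoendOf {J : Type*} [Category* J] {E : Type*} [Category* E] (F : Jᵒᵖ ⥤ J ⥤ E) (X : E) :
    Prop :=
  ∃ (ρ : ∀ j : J, (F.obj (op j)).obj j ⟶ X)
    (hρ : ∀ ⦃i j : J⦄ (f : i ⟶ j), (F.map f.op).app i ≫ ρ i = (F.obj (op j)).map f ≫ ρ j),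
    Nonempty (IsColimit (Cowedge.mk X ρ hρ))

/-- The functor `(Y, Y') ↦ Z_α(Y)* ⊗ Y'` on the component of degree `β`. -/
def cIntegrand (P : GGrading G C) [GCentralizable P] (α β : G) :
    (P.comp β).FullSubcategoryᵒᵖ ⥤ (P.comp β).FullSubcategory ⥤ C where
  obj Y :=
    { obj := fun Y' => dual (Zobj P α Y.unop.obj) ⊗ Y'.obj
      map := fun g => dual (Zobj P α Y.unop.obj) ◁ g.hom }
  map f :=
    { app := fun Y' => dualMap (Zmap P α f.unop.hom) ▷ Y'.obj
      naturality := fun _ _ g => whisker_exchange (dualMap (Zmap P α f.unop.hom)) g.hom }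
  map_id Y := by ext; simp [dualMap_id, Zmap_id]
  map_comp f g := by ext; simp [dualMap_comp, Zmap_comp]

variable [MonoidalPreadditive C]

/-- The value at `Y` of the right-hand side of the equation characterizing the action of `Z₁` on
the coend `W` of `cIntegrand`:
`ϱ_{Z₁(Y)} ∘ ((Z₂(α,1)_Y* ∘ s^l ∘ Z₁(Z₂(1,α)_Y*)) ⊗ id) ∘ (Z₁)₂(Z_α(Y)*, Y)`. -/
def cAction (P : GGrading G C) [GCentralizable P] (α β : G) (W : Cowedge (cIntegrand P α β))
    (Y : (P.comp β).FullSubcategory) : Zobj P 1 (dual (Zobj P α Y.obj) ⊗ Y.obj) ⟶ W.pt :=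
  Zcomul P 1 (dual (Zobj P α Y.obj)) Y.obj ≫
    (Zmap P 1 (dualMap (Zmul P (mul_one α) Y.obj)) ≫ Zantipode P (Zobj P α Y.obj) ≫
      dualMap (Zmul P (one_mul α) Y.obj)) ▷ Zobj P 1 Y.obj ≫
        W.π ⟨Zobj P 1 Y.obj, Zobj_mem P (by group : (1 : G)⁻¹ * β * 1 = β) Y.property⟩

variable [IsPure C] [IsIdempotentComplete C]

/-- The objects of the graded center of degree `β`. -/
abbrev centerComp (P : GGrading G C) (β : G) : ObjectProperty (GradedCenter P) :=
  fun A => P.comp β A.obj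

/-- The functor `(A, B) ↦ φ_α(A)* ⊗ B` on the component of degree `β` of the graded center. -/
def centerIntegrand (P : GGrading G C) (α β : G) (h : Nonempty (InvDimObj P α)) :
    (centerComp P β).FullSubcategoryᵒᵖ ⥤ (centerComp P β).FullSubcategory ⥤ GradedCenter P where
  obj A :=
    { obj := fun B => RelCenter.tensor
        (RelCenter.dualObj P.isPivotalSub ((crossing P α h).obj A.unop.obj)) B.obj
      map := fun g => RelCenter.tensorMap (𝟙 _) g.hom
      map_id := fun B => RelCenter.tensorMap_id _ _
      map_comp := fun f g => by
        rw [← RelCenter.tensorMap_comp, Category.comp_id]; rfl }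
  map f :=
    { app := fun B => RelCenter.tensorMap
        (RelCenter.dualHom P.isPivotalSub ((crossing P α h).map f.unop.hom)) (𝟙 _)
      naturality := fun B B' g => by
        change RelCenter.tensorMap _ _ ≫ RelCenter.tensorMap _ _ =
          RelCenter.tensorMap _ _ ≫ RelCenter.tensorMap _ _
        rw [← RelCenter.tensorMap_comp, ← RelCenter.tensorMap_comp]
        simp only [Category.comp_id, Category.id_comp] }
  map_id A := by
    ext B : 2
    change RelCenter.tensorMap (RelCenter.dualHom _ ((crossing P α h).map (𝟙 A.unop.obj))) _ = 𝟙 _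
    rw [CategoryTheory.Functor.map_id, RelCenter.dualHom_id, RelCenter.tensorMap_id]
  map_comp f g := by
    ext B : 2
    change RelCenter.tensorMap (RelCenter.dualHom _
      ((crossing P α h).map (g.unop.hom ≫ f.unop.hom))) _ =
        RelCenter.tensorMap _ _ ≫ RelCenter.tensorMap _ _
    rw [CategoryTheory.Functor.map_comp, RelCenter.dualHom_comp, ← RelCenter.tensorMap_comp, Category.comp_id]

end Coends

section Fusion

open PivotalCategory

variable {G : Type w} [Group G] {C : Type u} [Category.{v} C] [Preadditive C]
  [HasFiniteBiproducts C] [MonoidalCategory C] [PivotalCategory C]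

/-- An object is simple (over `k`) if its endomorphisms form a free `k`-module of rank one. -/
def IsSplitSimple (k : Type*) [CommRing k] [Linear k C] (X : C) : Prop :=
  Nonempty (k ≃ₗ[k] (X ⟶ X))

/-- A `G`-graded category is `G`-fusion if its unit object is simple, it is split semisimple, and
every component contains a simple object and has finitely many isomorphism classes of them. -/
structure IsGFusion (k : Type*) [CommRing k] [Linear k C] (P : GGrading G C) : Prop where
  unit_simple : IsSplitSimple k (𝟙_ C)
  semisimple (X : C) : ∃ (n : ℕ) (S : Fin n → C), (∀ a, IsSplitSimple k (S a)) ∧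
    Nonempty (X ≅ ⨁ S)
  hom_zero {X Y : C} : IsSplitSimple k X → IsSplitSimple k Y → IsEmpty (X ≅ Y) →
    ∀ f : X ⟶ Y, f = 0
  exists_simple (γ : G) : ∃ X : C, P.comp γ X ∧ IsSplitSimple k X
  finite (γ : G) : ∃ (n : ℕ) (S : Fin n → C), ∀ X : C, P.comp γ X → IsSplitSimple k X →
    ∃ a, Nonempty (X ≅ S a)

/-- A `G`-representative family of simple objects: `S γ` enumerates simple objects of degree `γ`,
and every simple object is isomorphic to exactly one member of the family. -/
structure IsGRepresentative (k : Type*) [CommRing k] [Linear k C] (P : GGrading G C) (n : G → ℕ)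
    (S : ∀ γ : G, Fin (n γ) → C) : Prop where
  mem (γ : G) (i : Fin (n γ)) : P.comp γ (S γ i)
  simple (γ : G) (i : Fin (n γ)) : IsSplitSimple k (S γ i)
  unique (X : C) : IsSplitSimple k X → ∃! s : (γ : G) × Fin (n γ), Nonempty (X ≅ S s.1 s.2)

/-- The canonical isomorphism `(X ⊗ Y)* ⟶ Y* ⊗ X*`. -/
def dualTensorInv (X Y : C) : dual (X ⊗ Y) ⟶ dual Y ⊗ dual X :=
  𝟙 _ ⊗≫ dual (X ⊗ Y) ◁ coev X ⊗≫ (dual (X ⊗ Y) ⊗ X) ◁ coev Y ▷ dual X ⊗≫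
    ev (X ⊗ Y) ▷ (dual Y ⊗ dual X) ⊗≫ 𝟙 _

/-- The inverse `X** ⟶ X` of the pivotal structure. -/
def pivInv (X : C) : dual (dual X) ⟶ X :=
  𝟙 _ ⊗≫ dual (dual X) ◁ coevt X ⊗≫ ev (dual X) ▷ X ⊗≫ 𝟙 _

/-- A decomposition of `Y` as a finite direct sum of members of the family `S`. -/
structure SimplePartition {m : ℕ} (S : Fin m → C) (Y : C) where
  card : ℕ
  idx : Fin card → Fin m
  p (b : Fin card) : Y ⟶ S (idx b)
  q (b : Fin card) : S (idx b) ⟶ Y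
  q_p_self (b : Fin card) : q b ≫ p b = 𝟙 _
  q_p_ne (b c : Fin card) : b ≠ c → q b ≫ p c = 0
  total : ∑ b, p b ≫ q b = 𝟙 Y

/-- For `i` of degree `α`, `p : Y ⟶ j` and `q : j ⟶ Y`: the morphism
`Z_α(Y)* ⊗ Y ⟶ i* ⊗ j* ⊗ i ⊗ j` which projects `Z_α(Y)*` on `(i* ⊗ Y ⊗ i)* = i* ⊗ Y* ⊗ i**` and
then applies `id ⊗ q* ⊗ (i** ⟶ i) ⊗ p`. -/
def fusionRho (P : GGrading G C) [GCentralizable P] (α : G) {i j Y : C} (hi : P.comp α i)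
    (p : Y ⟶ j) (q : j ⟶ Y) :
    dual (Zobj P α Y) ⊗ Y ⟶ dual i ⊗ (dual j ⊗ (i ⊗ j)) :=
  (dualMap (Zrho P α Y i hi) ≫ dualTensorInv (dual i) (Y ⊗ i) ≫
    dualTensorInv Y i ▷ dual (dual i)) ▷ Y ⊗≫
      dual i ◁ (dualMap q ▷ (dual (dual i) ⊗ Y) ≫ dual j ◁ (pivInv i ▷ Y ≫ i ◁ p))

/-- The object `⊕ i* ⊗ j* ⊗ i ⊗ j`, where `i` and `j` run over the simple objects of degree `α`
and `β` in the given family. -/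
def fusionC (n : G → ℕ) (S : ∀ γ : G, Fin (n γ) → C) (α β : G) : C :=
  ⨁ fun s : Fin (n α) × Fin (n β) =>
    dual (S α s.1) ⊗ (dual (S β s.2) ⊗ (S α s.1 ⊗ S β s.2))

/-- The inclusion of a summand in `fusionC`. -/
def fusionIncl (n : G → ℕ) (S : ∀ γ : G, Fin (n γ) → C) (α β : G) (i : Fin (n α))
    (j : Fin (n β)) :
    dual (S α i) ⊗ (dual (S β j) ⊗ (S α i ⊗ S β j)) ⟶ fusionC n S α β :=
  biproduct.ι (fun s : Fin (n α) × Fin (n β) =>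
    dual (S α s.1) ⊗ (dual (S β s.2) ⊗ (S α s.1 ⊗ S β s.2))) (i, j)

end Fusion

end GrCen

end

open GrCen PivotalCategory

noncomputable section

namespace GrCen

universe v u w

/-! ### The functors `Z_α` over the graded center: half braidings on `Z_α(X)`, and free objects -/

section Free

open PivotalCategory

variable {G : Type w} [Group G] {C : Type u} [Category.{v} C] [Preadditive C]
  [HasFiniteBiproducts C] [MonoidalCategory C] [PivotalCategory C]
  (P : GGrading G C) [GCentralizable P]

/-! Bending the multiplication of the Z's gives morphisms Z_β(X) ⊗ Y → Y ⊗ Z_{βα}(X) for Y of degree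
α (`ZmulAux`). When Y has degree 1 they form a half braiding of Z_β(X). With it Z_1(X) plays the
role of the free object of the graded center on X: `Zunit` is the unit, and the counit `freeCounit`
at (A, σ) is σ read as an action Z_1(A) → A.

The crossing functor enters the argument only through its relation to Z_α, recorded in
`CrossingData`. There are morphisms h_A : Z_α(A) → φ_α(A) that identify the two maps from
Z_α(Z_1(A)), and morphisms j_X : φ_α(Z_1(X)) → Z_α(X) such that j followed by h is φ_α of the
counit, while h followed by j is the multiplication. For φ_V, h comes from creating V* ⊗ V and half
braiding A past Q ⊗ V*, divided by d_V. Composing such morphisms closes a loop in V, whose value d_V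
cancels one of the factors (`swap_slide`, `swap_ZmulAux`). The limit defining φ_α is isomorphic to
each φ_V, so the data pass to it.

Let W be the coend in C. Its leg on the center at A is h_A* ⊗ id followed by the leg of W at A
(`centerLeg`). Conversely, the leg of W at Y is the center leg at Z_1(Y) pulled back along j* ⊗ unit
(`toPair_centerLeg`). Hence the center legs are jointly epimorphic, also after tensoring with an
object on the right, and every dinatural family on the center factors through W
(`exists_centerDesc`): W already has the universal property required in the center, up to half
braidings.

For the half braiding, ∂_{Y,X} and the half braiding dual to that of Z_α(Y) give a morphism from
Z_α(Y)* ⊗ Y ⊗ X to X ⊗ W (`cTwist`). It is dinatural in Y and natural in X, so it descends to r :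
Z_1(W) → W; `dagger_freeObj` rewrites the dual half braiding through the antipode, which turns the
equation for r into the stated one. The decisive point is `centerLeg_comm`: the center legs
intertwine the half braiding of φ_α(A)* ⊗ A with (id ⊗ r)∂. The axioms for the latter are thus
inherited from the former, without any Hopf monad identity, and invertibility is automatic by
duality. The same intertwining shows that the factorizations through W are morphisms of the center.

The fusion case rests on one general fact (`exists_coend_biproduct`): if all objects are sums of
finitely many objects S_a with no morphisms between different ones, and endomorphisms of S_a act
equally on both variables of a biadditive F, then the coend of F is the sum of the F(S_a, S_a). Used
in degree β it gives ⊕_j Z_α(j)* ⊗ j, and used in degree α it gives Z_α(j) = ⊕_i i* ⊗ j ⊗ i.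
Dualizing, and identifying i** with i, yields the formula. -/

lemma ZmulAux_nat {α β γ : G} (h : β * α = γ) (X : C) {Y₁ Y₂ : C} (h₁ : P.comp α Y₁)
    (h₂ : P.comp α Y₂) (f : Y₁ ⟶ Y₂) :
    Zobj P β X ◁ f ≫ ZmulAux P h X Y₂ h₂ = ZmulAux P h X Y₁ h₁ ≫ f ▷ Zobj P γ X := by
  apply ZmulAux_ext
  intro Y' hY'
  have e1 := Zd_ZmulAux P h X Y₁ Y' h₁ hY'
  have e2 := Zd_ZmulAux P h X Y₂ Y' h₂ hY'
  have n := Zd_nat P γ X (P.eq_comp (P.tensor hY' h₁) h) (P.eq_comp (P.tensor hY' h₂) h) (Y' ◁ f)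
  calc
    _ = (X ⊗ Y') ◁ f ≫ (Zd P β X Y' hY' ▷ Y₂ ≫ (α_ _ _ _).hom ≫
          Y' ◁ ZmulAux P h X Y₂ h₂) := by
        rw [MonoidalCategory.whisker_exchange_assoc]; monoidal
    _ = (α_ _ _ _).hom ≫ (X ◁ Y' ◁ f ≫
          Zd P γ X (Y' ⊗ Y₂) (P.eq_comp (P.tensor hY' h₂) h)) ≫ (α_ _ _ _).hom := by
        rw [e2]; monoidal
    _ = ((α_ _ _ _).hom ≫ Zd P γ X (Y' ⊗ Y₁) (P.eq_comp (P.tensor hY' h₁) h) ≫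
          (α_ _ _ _).hom) ≫ Y' ◁ f ▷ Zobj P γ X := by
        rw [n]; monoidal
    _ = _ := by rw [← e1]; monoidal

lemma Zd_Zmul_aux {α β γ : G} (h : β * α = γ) (X Y : C) (hY : P.comp α Y) :
    Zd P α (Zobj P β X) Y hY ≫ Y ◁ Zmul P h X = ZmulAux P h X Y hY := by
  rw [Zmul, Zd_Zdesc]

lemma Zmap_ZmulAux {α β γ : G} (h : β * α = γ) {X X' : C} (f : X ⟶ X') (Y : C)
    (hY : P.comp α Y) :
    Zmap P β f ▷ Y ≫ ZmulAux P h X' Y hY = ZmulAux P h X Y hY ≫ Y ◁ Zmap P γ f := by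
  apply ZmulAux_ext
  intro Y' hY'
  have e1 := Zd_ZmulAux P h X Y Y' hY hY'
  have e2 := Zd_ZmulAux P h X' Y Y' hY hY'
  have n := Zd_Zmap P β f Y' hY'
  have n' := Zd_Zmap P γ f (Y' ⊗ Y) (P.eq_comp (P.tensor hY' hY) h)
  calc
    _ = (Zd P β X Y' hY' ≫ Y' ◁ Zmap P β f) ▷ Y ≫ (α_ _ _ _).hom ≫
          Y' ◁ ZmulAux P h X' Y hY := by monoidal
    _ = f ▷ Y' ▷ Y ≫ (Zd P β X' Y' hY' ▷ Y ≫ (α_ _ _ _).hom ≫ Y' ◁ ZmulAux P h X' Y hY) := by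
        rw [n]; monoidal
    _ = (α_ _ _ _).hom ≫ (f ▷ (Y' ⊗ Y) ≫
          Zd P γ X' (Y' ⊗ Y) (P.eq_comp (P.tensor hY' hY) h)) ≫ (α_ _ _ _).hom := by
        rw [e2]; monoidal
    _ = ((α_ _ _ _).hom ≫ Zd P γ X (Y' ⊗ Y) (P.eq_comp (P.tensor hY' hY) h) ≫
          (α_ _ _ _).hom) ≫ Y' ◁ Y ◁ Zmap P γ f := by
        rw [← n']; monoidal
    _ = _ := by rw [← e1]; monoidal

/-- Tested on ∂_{X,Y'}, the two sides become ∂ at Y' ⊗ (Y₁ ⊗ Y₂) and at (Y' ⊗ Y₁) ⊗ Y₂, which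
naturality along the associator identifies. With Y₁ and Y₂ of degree 1 this is the multiplicativity
of the half braiding of Z_β(X); the mixed case, with Y₁ of degree 1 and Y₂ of degree α, is needed in
`swap_ZmulAux`. -/
lemma ZmulAux_tensor {α₁ α₂ β γ δ ε : G} (h₁ : β * α₁ = γ) (h₂ : γ * α₂ = δ)
    (h₄ : β * ε = δ) (X : C) {Y₁ Y₂ : C} (hY₁ : P.comp α₁ Y₁) (hY₂ : P.comp α₂ Y₂)
    (hY : P.comp ε (Y₁ ⊗ Y₂)) :
    ZmulAux P h₄ X (Y₁ ⊗ Y₂) hY = (α_ _ _ _).inv ≫ ZmulAux P h₁ X Y₁ hY₁ ▷ Y₂ ≫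
      (α_ _ _ _).hom ≫ Y₁ ◁ ZmulAux P h₂ X Y₂ hY₂ ≫ (α_ _ _ _).inv := by
  apply ZmulAux_ext
  intro Y' hY'
  have e1 := Zd_ZmulAux P h₁ X Y₁ Y' hY₁ hY'
  have e2 := Zd_ZmulAux P h₂ X Y₂ (Y' ⊗ Y₁) hY₂ (P.eq_comp (P.tensor hY' hY₁) h₁)
  have e4 := Zd_ZmulAux P h₄ X (Y₁ ⊗ Y₂) Y' hY hY'
  have n := Zd_nat P δ X (P.eq_comp (P.tensor (P.eq_comp (P.tensor hY' hY₁) h₁) hY₂) h₂)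
    (P.eq_comp (P.tensor hY' hY) h₄) (α_ Y' Y₁ Y₂).hom
  calc
    _ = (α_ _ _ _).hom ≫ (X ◁ (α_ Y' Y₁ Y₂).inv ≫ X ◁ (α_ Y' Y₁ Y₂).hom ≫
          Zd P δ X (Y' ⊗ Y₁ ⊗ Y₂) (P.eq_comp (P.tensor hY' hY) h₄)) ≫ (α_ _ _ _).hom := by
        rw [e4]; simp
    _ = (α_ _ _ _).inv ≫ (α_ _ _ _).hom ▷ _ ≫ ((α_ _ _ _).hom ≫
          Zd P δ X ((Y' ⊗ Y₁) ⊗ Y₂)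
            (P.eq_comp (P.tensor (P.eq_comp (P.tensor hY' hY₁) h₁) hY₂) h₂) ≫
              (α_ _ _ _).hom) ≫ (α_ _ _ _).hom ≫ Y' ◁ (α_ _ _ _).inv := by
        rw [n]; monoidal
    _ = (α_ _ _ _).inv ≫ ((α_ _ _ _).hom ≫
          Zd P γ X (Y' ⊗ Y₁) (P.eq_comp (P.tensor hY' hY₁) h₁) ≫ (α_ _ _ _).hom) ▷ Y₂ ≫
            (α_ _ _ _).hom ≫ Y' ◁ ((α_ _ _ _).hom ≫
              Y₁ ◁ ZmulAux P h₂ X Y₂ hY₂ ≫ (α_ _ _ _).inv) := by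
        rw [← e2]; monoidal
    _ = _ := by rw [← e1]; monoidal

lemma ZmulAux_unit {β : G} (h : β * 1 = β) (X : C) (h1 : P.comp 1 (𝟙_ C)) :
    ZmulAux P h X (𝟙_ C) h1 = (ρ_ _).hom ≫ (λ_ _).inv := by
  apply ZmulAux_ext
  intro Y' hY'
  have e := Zd_ZmulAux P h X (𝟙_ C) Y' h1 hY'
  have n := Zd_nat P β X (P.eq_comp (P.tensor hY' h1) h) hY' (ρ_ Y').hom
  rw [e]
  calc
    _ = (α_ _ _ _).hom ≫ (Zd P β X (Y' ⊗ 𝟙_ C) (P.eq_comp (P.tensor hY' h1) h) ≫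
          (ρ_ Y').hom ▷ _) ≫ Y' ◁ (λ_ _).inv := by monoidal
    _ = _ := by rw [← n]; monoidal

/-- The unit `X ⟶ Z₁(X)` of the monad `Z₁`. -/
def Zunit (X : C) : X ⟶ Zobj P 1 X :=
  (ρ_ X).inv ≫ Zd P 1 X (𝟙_ C) P.unit ≫ (λ_ _).hom

/-- The unit is ∂ at the unit object, so the defining equation of `ZmulAux` at Y' = 𝟙 produces ∂ at
𝟙 ⊗ Y. -/
lemma Zunit_ZmulAux {α : G} (h : 1 * α = α) (X Y : C) (hY : P.comp α Y) :
    Zunit P X ▷ Y ≫ ZmulAux P h X Y hY = Zd P α X Y hY := by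
  have e := Zd_ZmulAux P h X Y (𝟙_ C) hY P.unit
  have n := Zd_nat P α X (P.eq_comp (P.tensor P.unit hY) h) hY (λ_ Y).hom
  calc
    _ = (ρ_ X).inv ▷ Y ≫ (Zd P 1 X (𝟙_ C) P.unit ▷ Y ≫ (α_ _ _ _).hom ≫
          𝟙_ C ◁ ZmulAux P h X Y hY) ≫ (λ_ _).hom := by rw [Zunit]; monoidal
    _ = X ◁ (λ_ Y).inv ≫ (Zd P α X (𝟙_ C ⊗ Y) (P.eq_comp (P.tensor P.unit hY) h) ≫
          (λ_ Y).hom ▷ _) := by rw [e]; monoidal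
    _ = _ := by rw [← n]; monoidal

lemma Zunit_nat {X X' : C} (f : X ⟶ X') : f ≫ Zunit P X' = Zunit P X ≫ Zmap P 1 f := by
  have e := Zd_Zmap P 1 f (𝟙_ C) P.unit
  calc
    _ = (ρ_ X).inv ≫ (f ▷ 𝟙_ C ≫ Zd P 1 X' (𝟙_ C) P.unit) ≫ (λ_ _).hom := by
        rw [Zunit]; monoidal
    _ = _ := by rw [← e, Zunit]; monoidal

/-- A unit law of the monad when α = 1. In general it splits the multiplication Z_α(Z_1(X)) →
Z_α(X), which is how legs at Y are recovered from legs at Z_1(Y). -/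
lemma Zmap_Zunit_Zmul {α : G} (h : 1 * α = α) (X : C) :
    Zmap P α (Zunit P X) ≫ Zmul P h X = 𝟙 _ := by
  apply Zhom_ext
  intro Y hY
  rw [MonoidalCategory.whiskerLeft_comp, reassoc_of% Zd_Zmap P α (Zunit P X) Y hY,
    Zd_Zmul_aux, Zunit_ZmulAux]
  simp

lemma Zmap_Zmul {α β γ : G} (h : β * α = γ) {X X' : C} (f : X ⟶ X') :
    Zmap P α (Zmap P β f) ≫ Zmul P h X' = Zmul P h X ≫ Zmap P γ f := by
  apply Zhom_ext
  intro Y hY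
  rw [MonoidalCategory.whiskerLeft_comp, reassoc_of% Zd_Zmap P α (Zmap P β f) Y hY,
    Zd_Zmul_aux, MonoidalCategory.whiskerLeft_comp, reassoc_of% Zd_Zmul_aux P h X Y hY,
    Zmap_ZmulAux]

variable [MonoidalPreadditive C]

/-- The object `Z_α(X)` with its canonical half braiding; for `α = 1` it is the free object of
the graded center on `X`. -/
abbrev freeObj (α : G) (X : C) : GradedCenter P where
  obj := Zobj P α X
  hb := RelHalfBraiding.ofLax P.isPivotalSub (ZmulAux P (mul_one α) X)
    (fun h₁ h₂ f => ZmulAux_nat P (mul_one α) X h₁ h₂ f)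
    (fun h₁ h₂ h₁₂ => ZmulAux_tensor P (mul_one α) (mul_one α) (mul_one α) X h₁ h₂ h₁₂)
    (fun h => ZmulAux_unit P (mul_one α) X h)

/-- The functoriality of `freeObj`. -/
abbrev freeMap (α : G) {X X' : C} (f : X ⟶ X') : freeObj P α X ⟶ freeObj P α X' where
  f := (Zmap P α f : Zobj P α X ⟶ Zobj P α X')
  comm Y hY := Zmap_ZmulAux P (mul_one α) f Y hY

/-- The action `Z₁(A) ⟶ A` of `Z₁` on an object of the graded center. -/
def Zact (A : GradedCenter P) : Zobj P 1 A.obj ⟶ A.obj :=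
  Zdesc P 1 _ _ (fun Y hY => (A.hb.β Y hY).hom) (fun _ _ hY hY' f => A.hb.naturality hY hY' f)

lemma Zd_Zact (A : GradedCenter P) (Y : C) (hY : P.comp 1 Y) :
    Zd P 1 A.obj Y hY ≫ Y ◁ Zact P A = (A.hb.β Y hY).hom := by
  rw [Zact, Zd_Zdesc]

/-- Multiplicativity and invertibility force a half braiding to be trivial at the unit object. -/
lemma Zunit_Zact (A : GradedCenter P) : Zunit P A.obj ≫ Zact P A = 𝟙 _ := by
  have e := Zd_Zact P A (𝟙_ C) P.unit
  rw [A.hb.unit_eq P.unit (P.isPivotalSub.tensor P.unit P.unit)] at e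
  calc
    _ = (ρ_ _).inv ≫ (Zd P 1 A.obj (𝟙_ C) P.unit ≫ 𝟙_ C ◁ Zact P A) ≫ (λ_ _).hom := by
        rw [Zunit]; monoidal
    _ = _ := by rw [e]; simp

/-- The counit `(Z₁(A), free half braiding) ⟶ A`. -/
abbrev freeCounit (A : GradedCenter P) : freeObj P 1 A.obj ⟶ A where
  f := (Zact P A : Zobj P 1 A.obj ⟶ A.obj)
  comm X hX := by
    change Zact P A ▷ X ≫ (A.hb.β X hX).hom = ZmulAux P (mul_one 1) A.obj X hX ≫ X ◁ Zact P A
    -- After testing on ∂_{A,Y}, the claim is the multiplicativity of the half braiding of A at Y ⊗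
    -- X.
    apply ZmulAux_ext
    intro Y hY
    have e := Zd_ZmulAux P (mul_one 1) A.obj X Y hX hY
    have e1 := Zd_Zact P A Y hY
    have e2 := Zd_Zact P A (Y ⊗ X) (P.isPivotalSub.tensor hY hX)
    have m := A.hb.monoidal hY hX (P.isPivotalSub.tensor hY hX)
    calc
      _ = (Zd P 1 A.obj Y hY ≫ Y ◁ Zact P A) ▷ X ≫ (α_ _ _ _).hom ≫ Y ◁ (A.hb.β X hX).hom := by
          monoidal
      _ = (α_ _ _ _).hom ≫ (Zd P 1 A.obj (Y ⊗ X) (P.isPivotalSub.tensor hY hX) ≫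
            (Y ⊗ X) ◁ Zact P A) ≫ (α_ _ _ _).hom := by
          rw [e1, e2, m]; simp
      _ = ((α_ _ _ _).hom ≫ Zd P 1 A.obj (Y ⊗ X) (P.isPivotalSub.tensor hY hX) ≫
            (α_ _ _ _).hom) ≫ Y ◁ X ◁ Zact P A := by
          monoidal
      _ = _ := by rw [← e]; monoidal

end Free

/-! ### The universal dinatural transformation ρ expressed through its adjoint ∂ -/

section Centralizer

open PivotalCategory

variable {G : Type w} [Group G] {C : Type u} [Category.{v} C] [Preadditive C]
  [HasFiniteBiproducts C] [MonoidalCategory C] [PivotalCategory C] {P : GGrading G C}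
  [GCentralizable P] {α : G}

lemma Zrho_comp {X M : C} (f : Zobj P α X ⟶ M) (Y : C) (hY : P.comp α Y) :
    Zrho P α X Y hY ≫ f =
      𝟙 _ ⊗≫ dual Y ◁ (Zd P α X Y hY ≫ Y ◁ f) ⊗≫ ev Y ▷ M ⊗≫ 𝟙 _ := by
  rw [Zrho_eq]
  calc
    _ = 𝟙 _ ⊗≫ dual Y ◁ Zd P α X Y hY ⊗≫ (ev Y ▷ Zobj P α X ≫ 𝟙_ C ◁ f) ⊗≫ 𝟙 _ := by monoidal
    _ = _ := by rw [← whisker_exchange]; monoidal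

lemma Zrho_Zmap {X X' : C} (f : X ⟶ X') (Y : C) (hY : P.comp α Y) :
    Zrho P α X Y hY ≫ Zmap P α f = dual Y ◁ f ▷ Y ≫ Zrho P α X' Y hY := by
  rw [Zrho_comp, Zd_Zmap, Zrho_eq]
  monoidal

end Centralizer

/-! ### Half braiding an object of the center past Q while conjugating it by V -/

section Swap

open PivotalCategory

variable {C : Type u} [Category.{v} C] [MonoidalCategory C] [PivotalCategory C]
  {D : ObjectProperty C}

/-- The canonical morphism `A ⊗ Q ⟶ Q ⊗ V* ⊗ A ⊗ V`: create `V* ⊗ V` and apply the half braiding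
of `A` with `Q ⊗ V*`. -/
def swap (A : RelCenter D) (V Q : C) (h : D (Q ⊗ dual V)) :
    A.obj ⊗ Q ⟶ Q ⊗ (dual V ⊗ (A.obj ⊗ V)) :=
  𝟙 _ ⊗≫ (A.obj ⊗ Q) ◁ coevt V ⊗≫ (A.hb.β (Q ⊗ dual V) h).hom ▷ V ⊗≫ 𝟙 _

lemma swap_nat (A : RelCenter D) (V : C) {Q Q' : C} (h : D (Q ⊗ dual V)) (h' : D (Q' ⊗ dual V))
    (f : Q ⟶ Q') :
    A.obj ◁ f ≫ swap A V Q' h' = swap A V Q h ≫ f ▷ (dual V ⊗ (A.obj ⊗ V)) := by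
  have h1 := A.hb.naturality h h' (f ▷ dual V)
  dsimp only [swap]
  calc
    _ = 𝟙 _ ⊗≫ ((A.obj ◁ f) ▷ 𝟙_ C ≫ (A.obj ⊗ Q') ◁ coevt V) ⊗≫
          (A.hb.β (Q' ⊗ dual V) h').hom ▷ V ⊗≫ 𝟙 _ := by monoidal
    _ = 𝟙 _ ⊗≫ (A.obj ⊗ Q) ◁ coevt V ⊗≫
          (A.obj ◁ (f ▷ dual V) ≫ (A.hb.β (Q' ⊗ dual V) h').hom) ▷ V ⊗≫ 𝟙 _ := by
        rw [← whisker_exchange]; monoidal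
    _ = _ := by rw [h1]; monoidal

lemma swap_map {A B : RelCenter D} (g : A ⟶ B) (V Q : C) (h : D (Q ⊗ dual V)) :
    g.f ▷ Q ≫ swap B V Q h = swap A V Q h ≫ Q ◁ (dual V ◁ g.f ▷ V) := by
  have h1 := g.comm _ h
  dsimp only [swap]
  calc
    _ = 𝟙 _ ⊗≫ (g.f ▷ (Q ⊗ 𝟙_ C) ≫ B.obj ◁ Q ◁ coevt V) ⊗≫
          (B.hb.β (Q ⊗ dual V) h).hom ▷ V ⊗≫ 𝟙 _ := by monoidal
    _ = 𝟙 _ ⊗≫ (A.obj ⊗ Q) ◁ coevt V ⊗≫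
          (g.f ▷ (Q ⊗ dual V) ≫ (B.hb.β (Q ⊗ dual V) h).hom) ▷ V ⊗≫ 𝟙 _ := by
        rw [← whisker_exchange]; monoidal
    _ = _ := by rw [h1]; monoidal

/-- Multiplicativity of the half braiding at X ⊗ (Q ⊗ V*). It is the source of the coequalizing
property `Zmul_toCrossE`. -/
lemma swap_tensor (A : RelCenter D) (V X Q : C) (hX : D X) (h : D (Q ⊗ dual V))
    (h' : D ((X ⊗ Q) ⊗ dual V)) (h'' : D (X ⊗ (Q ⊗ dual V))) :
    swap A V (X ⊗ Q) h' = (α_ _ _ _).inv ≫ (A.hb.β X hX).hom ▷ Q ≫ (α_ _ _ _).hom ≫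
      X ◁ swap A V Q h ≫ (α_ _ _ _).inv := by
  have n := A.hb.naturality h' h'' (α_ X Q (dual V)).hom
  have m := A.hb.monoidal hX h h''
  rw [m] at n
  dsimp only [swap]
  calc
    _ = 𝟙 _ ⊗≫ (A.obj ⊗ X ⊗ Q) ◁ coevt V ⊗≫
          ((A.hb.β ((X ⊗ Q) ⊗ dual V) h').hom ≫ (α_ X Q (dual V)).hom ▷ A.obj) ▷ V ⊗≫ 𝟙 _ := by
        monoidal
    _ = 𝟙 _ ⊗≫ (((A.obj ⊗ X) ⊗ Q) ◁ coevt V ≫ ((A.hb.β X hX).hom ▷ Q) ▷ (dual V ⊗ V)) ⊗≫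
          X ◁ (A.hb.β (Q ⊗ dual V) h).hom ▷ V ⊗≫ 𝟙 _ := by
        rw [← n]; monoidal
    _ = _ := by rw [whisker_exchange]; monoidal

/-- The half braidings at Q ⊗ V* and V ⊗ X ⊗ U* multiply to one at their tensor product, and
naturality along ev_V contracts V* ⊗ V there. What remains of V is its creation followed by its
evaluation, a closed loop of value d_V. -/
lemma swap_slide [IsPure C] (hT : ∀ {X Y : C}, D X → D Y → D (X ⊗ Y)) (A : RelCenter D)
    (V U Q X : C) (h1 : D (Q ⊗ dual V)) (h2 : D (V ⊗ (X ⊗ dual U)))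
    (h3 : D ((Q ⊗ X) ⊗ dual U)) :
    swap A V Q h1 ▷ X ≫ (α_ _ _ _).hom ≫ Q ◁ slide A V U X h2 =
      (α_ _ _ _).hom ≫ swap A U (Q ⊗ X) h3 ≫ scal (dimL V) _ ≫ (α_ _ _ _).hom := by
  have m := A.hb.monoidal h1 h2 (hT h1 h2)
  have n := A.hb.naturality (hT h1 h2) h3
    (𝟙 _ ⊗≫ Q ◁ ev V ▷ (X ⊗ dual U) ⊗≫ 𝟙 ((Q ⊗ X) ⊗ dual U))
  dsimp only [swap, slide]
  calc
    _ = 𝟙 _ ⊗≫ (A.obj ⊗ Q) ◁ coevt V ▷ X ⊗≫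
          ((A.hb.β (Q ⊗ dual V) h1).hom ▷ (V ⊗ X ⊗ 𝟙_ C) ≫
            ((Q ⊗ dual V) ⊗ A.obj) ◁ (V ◁ X ◁ coevt U)) ⊗≫
          (Q ⊗ dual V) ◁ (A.hb.β (V ⊗ (X ⊗ dual U)) h2).hom ▷ U ⊗≫
            Q ◁ ev V ▷ (X ⊗ dual U ⊗ A.obj ⊗ U) ⊗≫ 𝟙 _ := by monoidal
    _ = 𝟙 _ ⊗≫ (A.obj ⊗ Q) ◁ coevt V ▷ X ⊗≫ (A.obj ⊗ (Q ⊗ dual V) ⊗ V ⊗ X) ◁ coevt U ⊗≫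
          (((α_ _ _ _).inv ≫ (A.hb.β (Q ⊗ dual V) h1).hom ▷ _ ≫ (α_ _ _ _).hom ≫
            (Q ⊗ dual V) ◁ (A.hb.β (V ⊗ (X ⊗ dual U)) h2).hom ≫ (α_ _ _ _).inv) ≫
              (𝟙 _ ⊗≫ Q ◁ ev V ▷ (X ⊗ dual U) ⊗≫ 𝟙 ((Q ⊗ X) ⊗ dual U)) ▷ A.obj) ▷ U ⊗≫ 𝟙 _ := by
        rw [← whisker_exchange]; monoidal
    _ = 𝟙 _ ⊗≫ (A.obj ⊗ Q) ◁ (coevt V ▷ (X ⊗ 𝟙_ C) ≫ (dual V ⊗ V) ◁ (X ◁ coevt U)) ⊗≫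
          (A.obj ⊗ Q) ◁ ev V ▷ (X ⊗ dual U ⊗ U) ⊗≫
            (A.hb.β ((Q ⊗ X) ⊗ dual U) h3).hom ▷ U ⊗≫ 𝟙 _ := by
        rw [← m, ← n]; monoidal
    _ = (𝟙 _ ⊗≫ (A.obj ⊗ Q ⊗ X) ◁ coevt U ⊗≫ 𝟙 _) ≫
        (A.obj ⊗ Q) ◁ scal (dimL V) (X ⊗ dual U ⊗ U) ≫
          (𝟙 _ ⊗≫ (A.hb.β ((Q ⊗ X) ⊗ dual U) h3).hom ▷ U ⊗≫ 𝟙 _) := by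
        rw [← whisker_exchange, scal, dimL]; monoidal
    _ = _ := by
        -- Purity is what allows the loop to be pulled out to the left of A ⊗ Q.
        rw [scal_whiskerLeft, ← scal_nat, ← Category.assoc]
        simp only [← scal_nat]
        simp only [← Category.assoc]
        congr 1
        monoidal

lemma slide_unit (A : RelCenter D) (V U : C) (h : D (V ⊗ (𝟙_ C ⊗ dual U)))
    (h' : D (V ⊗ dual U)) :
    (ρ_ _).inv ≫ slide A V U (𝟙_ C) h ≫ (λ_ _).hom =
      𝟙 _ ⊗≫ dual V ◁ swap A U V h' ⊗≫ ev V ▷ (dual U ⊗ (A.obj ⊗ U)) ⊗≫ 𝟙 _ := by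
  have n := A.hb.naturality h h' (V ◁ (λ_ (dual U)).hom)
  dsimp only [swap, slide]
  calc
    _ = 𝟙 _ ⊗≫ (dual V ⊗ A.obj ⊗ V) ◁ coevt U ⊗≫
          dual V ◁ ((A.hb.β (V ⊗ (𝟙_ C ⊗ dual U)) h).hom ≫ (V ◁ (λ_ (dual U)).hom) ▷ A.obj) ▷ U ⊗≫
            ev V ▷ (dual U ⊗ A.obj ⊗ U) ⊗≫ 𝟙 _ := by monoidal
    _ = _ := by rw [← n]; monoidal

end Swap

/-! ### Comparison of Z_α with the functors φ_V -/

section CrossingAction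

open PivotalCategory

variable {G : Type w} [Group G] {C : Type u} [Category.{v} C] [Preadditive C]
  [HasFiniteBiproducts C] [MonoidalCategory C] [PivotalCategory C] [MonoidalPreadditive C]
  [IsPure C] {P : GGrading G C} {α : G}

lemma GGrading.conj_unit (P : GGrading G C) {α : G} {V Q : C} (hQ : P.comp α Q)
    (hV : P.comp α V) : P.comp 1 (Q ⊗ dual V) :=
  P.eq_comp (P.tensor hQ (P.dual_mem hV)) (mul_inv_cancel α)

/-- `swap` divided by the left dimension of `V`. -/
def crossSwap (A : GradedCenter P) (V : InvDimObj P α) (Q : C) (hQ : P.comp α Q) :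
    A.obj ⊗ Q ⟶ Q ⊗ (dual V.1 ⊗ (A.obj ⊗ V.1)) :=
  swap A V.1 Q (P.conj_unit hQ V.2.1) ≫ scal (inv (dimL V.1)) _

lemma crossSwap_nat (A : GradedCenter P) (V : InvDimObj P α) {Q Q' : C} (hQ : P.comp α Q)
    (hQ' : P.comp α Q') (f : Q ⟶ Q') : A.obj ◁ f ≫ crossSwap A V Q' hQ' =
      crossSwap A V Q hQ ≫ f ▷ (dual V.1 ⊗ (A.obj ⊗ V.1)) := by
  simp only [crossSwap, reassoc_of% swap_nat A V.1 (P.conj_unit hQ V.2.1)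
    (P.conj_unit hQ' V.2.1) f, Category.assoc]
  rw [scal_nat]

lemma crossSwap_map {A B : GradedCenter P} (g : A ⟶ B) (V : InvDimObj P α) (Q : C)
    (hQ : P.comp α Q) : g.f ▷ Q ≫ crossSwap B V Q hQ =
      crossSwap A V Q hQ ≫ Q ◁ (dual V.1 ◁ g.f ▷ V.1) := by
  simp only [crossSwap, reassoc_of% swap_map g V.1 Q (P.conj_unit hQ V.2.1), Category.assoc]
  rw [scal_nat]

lemma crossSwap_tensor (A : GradedCenter P) (V : InvDimObj P α) {X Q : C} (hX : P.comp 1 X)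
    (hQ : P.comp α Q) (hXQ : P.comp α (X ⊗ Q)) :
    crossSwap A V (X ⊗ Q) hXQ = (α_ _ _ _).inv ≫ (A.hb.β X hX).hom ▷ Q ≫ (α_ _ _ _).hom ≫
      X ◁ crossSwap A V Q hQ ≫ (α_ _ _ _).inv := by
  have e := swap_tensor A V.1 X Q hX (P.conj_unit hQ V.2.1) (P.conj_unit hXQ V.2.1)
    (P.isPivotalSub.tensor hX (P.conj_unit hQ V.2.1))
  simp only [crossSwap, e, Category.assoc, MonoidalCategory.whiskerLeft_comp, scal_whiskerLeft]
  rw [scal_nat]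

/-- Two factors d_V⁻¹ appear on the left and one on the right; the loop from `swap_slide` accounts
for the difference. -/
lemma crossSwap_crossHom (A : GradedCenter P) (V : InvDimObj P α) {Q X : C}
    (hQ : P.comp α Q) (hX : P.comp 1 X) (hQX : P.comp α (Q ⊗ X)) :
    crossSwap A V Q hQ ▷ X ≫ (α_ _ _ _).hom ≫ Q ◁ crossHom A V V X hX =
      (α_ _ _ _).hom ≫ crossSwap A V (Q ⊗ X) hQX ≫ (α_ _ _ _).hom := by
  have e := swap_slide P.isPivotalSub.tensor A V.1 V.1 Q X (P.conj_unit hQ V.2.1)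
    (P.conj V.2.1 V.2.1 hX) (P.conj_unit hQX V.2.1)
  simp only [crossSwap, crossHom, nslide, comp_whiskerRight, MonoidalCategory.whiskerLeft_comp,
    scal_whiskerLeft, scal_whiskerRight, Category.assoc]
  calc
    _ = scal (inv (dimL V.1)) _ ≫ (swap A V.1 Q (P.conj_unit hQ V.2.1) ▷ X ≫ (α_ _ _ _).hom ≫
          Q ◁ slide A V.1 V.1 X (P.conj V.2.1 V.2.1 hX)) ≫ scal (inv (dimL V.1)) _ := by
        simp only [scal_nat_assoc, Category.assoc]
    _ = scal (inv (dimL V.1)) _ ≫ scal (inv (dimL V.1) ≫ dimL V.1) _ ≫ (α_ _ _ _).hom ≫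
          swap A V.1 (Q ⊗ X) (P.conj_unit hQX V.2.1) ≫ (α_ _ _ _).hom := by
        rw [e, scal_nat, scal_comp, Category.assoc,
          scal_nat_assoc (dimL V.1) (swap A V.1 (Q ⊗ X) _), scal_nat_assoc (dimL V.1)]
    _ = _ := by
        rw [IsIso.inv_hom_id, scal_id, Category.id_comp,
          scal_nat_assoc (inv (dimL V.1)) (swap A V.1 (Q ⊗ X) _),
          scal_nat_assoc (inv (dimL V.1))]

/-- The case X = 𝟙 of `crossSwap_crossHom`: `crossSwap` already takes values in the image of the
idempotent, so projecting onto φ_V(A) loses nothing. -/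
lemma crossSwap_crossProj (A : GradedCenter P) (V : InvDimObj P α) (Q : C)
    (hQ : P.comp α Q) : crossSwap A V Q hQ ≫ Q ◁ crossProj A V V = crossSwap A V Q hQ := by
  have h1 : P.comp α (Q ⊗ 𝟙_ C) := P.eq_comp (P.tensor hQ P.unit) (mul_one α)
  have h := crossSwap_crossHom A V hQ P.unit h1
  have n := crossSwap_nat A V h1 hQ (ρ_ Q).hom
  calc
    _ = (ρ_ _).inv ≫ (crossSwap A V Q hQ ▷ 𝟙_ C ≫ (α_ _ _ _).hom ≫
          Q ◁ (crossHom A V V (𝟙_ C) P.unit)) ≫ Q ◁ (λ_ _).hom := by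
        rw [crossProj]; monoidal
    _ = (ρ_ _).inv ≫ (α_ _ _ _).hom ≫ (crossSwap A V (Q ⊗ 𝟙_ C) h1 ≫ (ρ_ Q).hom ▷ _) := by
        rw [h]; monoidal
    _ = _ := by rw [← n]; simp

/-- Taking Q = V and evaluating against V* gives the morphism that defines the idempotent, with the
same normalization. -/
lemma crossSwap_ev (A : GradedCenter P) (V : InvDimObj P α) :
    (𝟙 _ ⊗≫ dual V.1 ◁ crossSwap A V V.1 V.2.1 ⊗≫ ev V.1 ▷ (dual V.1 ⊗ (A.obj ⊗ V.1)) ⊗≫ 𝟙 _) =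
      crossProj A V V := by
  have e := slide_unit A V.1 V.1 (P.conj V.2.1 V.2.1 P.unit) (P.conj_unit V.2.1 V.2.1)
  calc
    _ = (𝟙 _ ⊗≫ dual V.1 ◁ swap A V.1 V.1 (P.conj_unit V.2.1 V.2.1)) ≫ scal (inv (dimL V.1)) _ ≫
          (𝟙 _ ⊗≫ ev V.1 ▷ (dual V.1 ⊗ (A.obj ⊗ V.1)) ⊗≫ 𝟙 _) := by
        rw [crossSwap, MonoidalCategory.whiskerLeft_comp, scal_whiskerLeft]; monoidal
    _ = (𝟙 _ ⊗≫ dual V.1 ◁ swap A V.1 V.1 (P.conj_unit V.2.1 V.2.1) ⊗≫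
          ev V.1 ▷ (dual V.1 ⊗ (A.obj ⊗ V.1)) ⊗≫ 𝟙 _) ≫ scal (inv (dimL V.1)) _ := by
        rw [← scal_nat]; monoidal
    _ = _ := by
        rw [← e, crossProj, crossHom, nslide]
        simp only [Category.assoc, scal_nat, scal_nat_assoc]

/-- For `Q` of degree `α`, the morphism `Z₁(X) ⊗ Q ⟶ Q ⊗ Z_α(X)` is recovered from `swap`. -/
lemma swap_ZmulAux [GCentralizable P] {V Q : C} (hV : P.comp α V) (hQ : P.comp α Q) (X : C) :
    swap (freeObj P 1 X) V Q (P.conj_unit hQ hV) ≫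
        Q ◁ (dual V ◁ ZmulAux P (one_mul α) X V hV ⊗≫ ev V ▷ Zobj P α X ⊗≫ 𝟙 _) =
      ZmulAux P (one_mul α) X Q hQ ≫ scal (dimL V) _ := by
  have hQV := P.conj_unit hQ hV
  have hQVV : P.comp α ((Q ⊗ dual V) ⊗ V) := P.eq_comp (P.tensor hQV hV) (one_mul α)
  have e := ZmulAux_tensor P (mul_one 1) (one_mul α) (one_mul α) X hQV hV hQVV
  have n := ZmulAux_nat P (one_mul α) X hQVV hQ (𝟙 _ ⊗≫ Q ◁ ev V ⊗≫ 𝟙 Q)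
  rw [e] at n
  change (𝟙 _ ⊗≫ (Zobj P 1 X ⊗ Q) ◁ coevt V ⊗≫
    (ZmulAux P (mul_one 1) X (Q ⊗ dual V) hQV) ▷ V ⊗≫ 𝟙 _) ≫ _ = _
  calc
    _ = 𝟙 _ ⊗≫ (Zobj P 1 X ⊗ Q) ◁ coevt V ⊗≫
          (((α_ _ _ _).inv ≫ ZmulAux P (mul_one 1) X (Q ⊗ dual V) hQV ▷ V ≫
            (α_ _ _ _).hom ≫ (Q ⊗ dual V) ◁ ZmulAux P (one_mul α) X V hV ≫ (α_ _ _ _).inv) ≫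
              (𝟙 _ ⊗≫ Q ◁ ev V ⊗≫ 𝟙 Q) ▷ Zobj P α X) := by monoidal
    _ = Zobj P 1 X ◁ ((ρ_ Q).inv ≫ Q ◁ dimL V ≫ (ρ_ Q).hom) ≫ ZmulAux P (one_mul α) X Q hQ := by
        rw [← n, dimL]; monoidal
    -- The loop of V now stands to the right of Q; purity moves it to the left, where scalars are
    -- natural.
    _ = _ := by
        rw [← IsPure.pure, ← scal, scal_whiskerLeft, scal_nat]

variable [GCentralizable P] [IsIdempotentComplete C]

/-- The canonical morphism `Z_α(A) ⟶ φ_V(A)`. -/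
def toCrossE (A : GradedCenter P) (V : InvDimObj P α) : Zobj P α A.obj ⟶ crossE A V :=
  Zdesc P α A.obj _ (fun Q hQ => crossSwap A V Q hQ ≫ Q ◁ crossP A V)
    (fun Q Q' hQ hQ' f => by
      rw [reassoc_of% crossSwap_nat A V hQ hQ' f, ← whisker_exchange, Category.assoc])

lemma Zd_toCrossE (A : GradedCenter P) (V : InvDimObj P α) (Q : C) (hQ : P.comp α Q) :
    Zd P α A.obj Q hQ ≫ Q ◁ toCrossE A V = crossSwap A V Q hQ ≫ Q ◁ crossP A V := by
  rw [toCrossE, Zd_Zdesc]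

/-- `toCrossE` as a morphism of the graded center. -/
def toCross (A : GradedCenter P) (V : InvDimObj P α) : freeObj P α A.obj ⟶ crossObj V A where
  f := (toCrossE A V : Zobj P α A.obj ⟶ crossE A V)
  comm X hX := by
    change toCrossE A V ▷ X ≫ crossGamma A V X hX =
      ZmulAux P (mul_one α) A.obj X hX ≫ X ◁ toCrossE A V
    -- Tested on ∂_{A,Q}, both sides become `crossSwap` at Q ⊗ X followed by the projection.
    apply ZmulAux_ext
    intro Q hQ
    have hQX : P.comp α (Q ⊗ X) := P.eq_comp (P.tensor hQ hX) (mul_one α)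
    have e := Zd_ZmulAux P (mul_one α) A.obj X Q hX hQ
    have t := Zd_toCrossE A V Q hQ
    have t' := Zd_toCrossE A V (Q ⊗ X) hQX
    calc
      _ = (Zd P α A.obj Q hQ ≫ Q ◁ toCrossE A V) ▷ X ≫ (α_ _ _ _).hom ≫
            Q ◁ crossGamma A V X hX := by monoidal
      _ = crossSwap A V Q hQ ▷ X ≫ (α_ _ _ _).hom ≫
            Q ◁ ((crossP A V ≫ crossI A V) ▷ X ≫ crossHom A V V X hX) ≫ Q ◁ X ◁ crossP A V := by
          rw [t, crossGamma]; monoidal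
      _ = (crossSwap A V Q hQ ▷ X ≫ (α_ _ _ _).hom ≫ Q ◁ crossHom A V V X hX) ≫
            Q ◁ X ◁ crossP A V := by
          rw [crossP_crossI, crossProj_crossHom]; simp
      _ = (α_ _ _ _).hom ≫ (crossSwap A V (Q ⊗ X) hQX ≫ (Q ⊗ X) ◁ crossP A V) ≫
            (α_ _ _ _).hom := by
          rw [crossSwap_crossHom A V hQ hX hQX]; monoidal
      _ = ((α_ _ _ _).hom ≫ Zd P α A.obj (Q ⊗ X) hQX ≫ (α_ _ _ _).hom) ≫
            Q ◁ X ◁ toCrossE A V := by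
          rw [← t']; monoidal
      _ = _ := by rw [← e]; monoidal

lemma crossP_map {A B : GradedCenter P} (g : A ⟶ B) (V : InvDimObj P α) :
    dual V.1 ◁ g.f ▷ V.1 ≫ crossP B V =
      crossP A V ≫ crossI A V ≫ dual V.1 ◁ g.f ▷ V.1 ≫ crossP B V := by
  rw [← Category.assoc (crossP A V), crossP_crossI, ← Category.assoc, ← crossProj_map,
    Category.assoc, ← crossP_crossI, Category.assoc, crossI_crossP, Category.comp_id]

lemma map_crossI {A B : GradedCenter P} (g : A ⟶ B) (V : InvDimObj P α) :
    crossI A V ≫ dual V.1 ◁ g.f ▷ V.1 =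
      (crossI A V ≫ dual V.1 ◁ g.f ▷ V.1 ≫ crossP B V) ≫ crossI B V := by
  simp only [Category.assoc]
  rw [crossP_crossI, crossProj_map, ← crossP_crossI, Category.assoc, reassoc_of% crossI_crossP A V]

lemma toCross_nat {A B : GradedCenter P} (g : A ⟶ B) (V : InvDimObj P α) :
    freeMap P α g.f ≫ toCross B V = toCross A V ≫ (crossV V).map g := RelCenter.hom_ext (by
  change Zmap P α g.f ≫ toCrossE B V =
    toCrossE A V ≫ crossI A V ≫ dual V.1 ◁ g.f ▷ V.1 ≫ crossP B V
  apply Zhom_ext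
  intro Q hQ
  rw [MonoidalCategory.whiskerLeft_comp, reassoc_of% Zd_Zmap P α g.f Q hQ, Zd_toCrossE,
    reassoc_of% crossSwap_map g V Q hQ, MonoidalCategory.whiskerLeft_comp,
    reassoc_of% Zd_toCrossE A V Q hQ]
  simp only [← MonoidalCategory.whiskerLeft_comp]
  rw [← crossP_map])

/-- Test on ∂ at X of degree 1 and Q of degree α. One side gives `crossSwap` at X ⊗ Q, the other the
half braiding of A with X followed by `crossSwap` at Q; `crossSwap_tensor` says that these agree. -/
lemma Zmul_toCrossE (A : GradedCenter P) (V : InvDimObj P α) :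
    Zmul P (one_mul α) A.obj ≫ toCrossE A V = Zmap P α (Zact P A) ≫ toCrossE A V := by
  apply Zhom_ext
  intro Q hQ
  rw [MonoidalCategory.whiskerLeft_comp, reassoc_of% Zd_Zmul_aux P (one_mul α) A.obj Q hQ,
    MonoidalCategory.whiskerLeft_comp, reassoc_of% Zd_Zmap P α (Zact P A) Q hQ]
  apply ZmulAux_ext
  intro X hX
  have hXQ : P.comp α (X ⊗ Q) := P.eq_comp (P.tensor hX hQ) (one_mul α)
  have e := Zd_ZmulAux P (one_mul α) A.obj Q X hQ hX
  have t := Zd_toCrossE A V Q hQ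
  have t' := Zd_toCrossE A V (X ⊗ Q) hXQ
  have a := Zd_Zact P A X hX
  have m := crossSwap_tensor A V hX hQ hXQ
  symm
  calc
    _ = (Zd P 1 A.obj X hX ≫ X ◁ Zact P A) ▷ Q ≫ (α_ _ _ _).hom ≫
          X ◁ (Zd P α A.obj Q hQ ≫ Q ◁ toCrossE A V) := by monoidal
    _ = (α_ _ _ _).hom ≫ ((α_ _ _ _).inv ≫ (A.hb.β X hX).hom ▷ Q ≫ (α_ _ _ _).hom ≫
          X ◁ crossSwap A V Q hQ ≫ (α_ _ _ _).inv) ≫ (X ⊗ Q) ◁ crossP A V ≫ (α_ _ _ _).hom := by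
        rw [t, a]; monoidal
    _ = (α_ _ _ _).hom ≫ (Zd P α A.obj (X ⊗ Q) hXQ ≫ (X ⊗ Q) ◁ toCrossE A V) ≫
          (α_ _ _ _).hom := by
        rw [← m, t']; simp
    _ = ((α_ _ _ _).hom ≫ Zd P α A.obj (X ⊗ Q) hXQ ≫ (α_ _ _ _).hom) ≫
          X ◁ Q ◁ toCrossE A V := by monoidal
    _ = _ := by rw [← e]; monoidal

/-- Bending Q = V back turns `crossSwap` into the idempotent (`crossSwap_ev`). In particular Z_α(A)
→ φ_V(A) is a split epimorphism, with section the inclusion of φ_V(A) followed by ρ at V. -/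
lemma Zrho_toCrossE (A : GradedCenter P) (V : InvDimObj P α) :
    Zrho P α A.obj V.1 V.2.1 ≫ toCrossE A V = crossP A V := by
  rw [Zrho_comp, Zd_toCrossE]
  calc
    _ = 𝟙 _ ⊗≫ dual V.1 ◁ crossSwap A V V.1 V.2.1 ⊗≫
          (ev V.1 ▷ (dual V.1 ⊗ (A.obj ⊗ V.1)) ≫ 𝟙_ C ◁ crossP A V) ⊗≫ 𝟙 _ := by
        rw [← whisker_exchange]; monoidal
    _ = (𝟙 _ ⊗≫ dual V.1 ◁ crossSwap A V V.1 V.2.1 ⊗≫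
          ev V.1 ▷ (dual V.1 ⊗ (A.obj ⊗ V.1)) ⊗≫ 𝟙 _) ≫ crossP A V := by monoidal
    _ = _ := by
        rw [crossSwap_ev, ← crossP_crossI, Category.assoc, crossI_crossP, Category.comp_id]

/-- The canonical morphism `φ_V(Z₁(X)) ⟶ Z_α(X)`. -/
def ofCrossFree (V : InvDimObj P α) (X : C) : crossE (freeObj P 1 X) V ⟶ Zobj P α X :=
  crossI (freeObj P 1 X) V ≫ Zrho P α (Zobj P 1 X) V.1 V.2.1 ≫ Zmul P (one_mul α) X

lemma ofCrossFree_nat (V : InvDimObj P α) {X X' : C} (f : X ⟶ X') :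
    ((crossV V).map (freeMap P 1 f)).f ≫ ofCrossFree V X' = ofCrossFree V X ≫ Zmap P α f := by
  change (crossI (freeObj P 1 X) V ≫ dual V.1 ◁ (freeMap P 1 f).f ▷ V.1 ≫
    crossP (freeObj P 1 X') V) ≫ crossI (freeObj P 1 X') V ≫ Zrho P α (Zobj P 1 X') V.1 V.2.1 ≫
      Zmul P (one_mul α) X' = (crossI (freeObj P 1 X) V ≫ Zrho P α (Zobj P 1 X) V.1 V.2.1 ≫
        Zmul P (one_mul α) X) ≫ Zmap P α f
  have h := Zrho_Zmap (P := P) (Zmap P 1 f) V.1 V.2.1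
  rw [← Category.assoc _ (crossI (freeObj P 1 X') V), ← map_crossI]
  simp only [Category.assoc]
  rw [← Zmap_Zmul P (one_mul α) f, reassoc_of% h]

/-- The coequalizing property replaces the multiplication by Z_α of the action. Naturality of ρ
moves the action inside V* ⊗ - ⊗ V, and the leg at V then becomes the projection. -/
lemma ofCrossFree_toCrossE (A : GradedCenter P) (V : InvDimObj P α) :
    ofCrossFree V A.obj ≫ toCrossE A V = ((crossV V).map (freeCounit P A)).f := by
  change _ = crossI (freeObj P 1 A.obj) V ≫ dual V.1 ◁ Zact P A ▷ V.1 ≫ crossP A V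
  have h := Zrho_Zmap (P := P) (Zact P A) V.1 V.2.1
  rw [ofCrossFree, Category.assoc, Category.assoc, Zmul_toCrossE, reassoc_of% h, Zrho_toCrossE]

/-- Going through φ_V inserts the idempotent, which `crossSwap` absorbs. `swap_ZmulAux` then gives
d_V times the multiplication, and the normalization removes d_V. -/
lemma toCrossE_ofCrossFree (V : InvDimObj P α) (X : C) :
    toCrossE (freeObj P 1 X) V ≫ ofCrossFree V X = Zmul P (one_mul α) X := by
  apply Zhom_ext
  intro Q hQ
  have e := swap_ZmulAux (P := P) V.2.1 hQ X
  have t := Zd_toCrossE (freeObj P 1 X) V Q hQ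
  have j : Zrho P α (Zobj P 1 X) V.1 V.2.1 ≫ Zmul P (one_mul α) X =
      dual V.1 ◁ ZmulAux P (one_mul α) X V.1 V.2.1 ⊗≫ ev V.1 ▷ Zobj P α X ⊗≫ 𝟙 _ := by
    rw [Zrho_comp, Zd_Zmul_aux]; monoidal
  rw [Zd_Zmul_aux, MonoidalCategory.whiskerLeft_comp]
  calc
    _ = (crossSwap (freeObj P 1 X) V Q hQ ≫ Q ◁ (crossP (freeObj P 1 X) V ≫
          crossI (freeObj P 1 X) V)) ≫
          Q ◁ (Zrho P α (Zobj P 1 X) V.1 V.2.1 ≫ Zmul P (one_mul α) X) := by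
        rw [← Category.assoc]
        refine (congrArg (· ≫ Q ◁ ofCrossFree V X) t).trans ?_
        rw [ofCrossFree]
        simp only [MonoidalCategory.whiskerLeft_comp, Category.assoc]
    _ = crossSwap (freeObj P 1 X) V Q hQ ≫
          Q ◁ (dual V.1 ◁ ZmulAux P (one_mul α) X V.1 V.2.1 ⊗≫ ev V.1 ▷ Zobj P α X ⊗≫ 𝟙 _) := by
        rw [crossP_crossI, crossSwap_crossProj, j]
    _ = scal (inv (dimL V.1)) _ ≫ (swap (freeObj P 1 X) V.1 Q (P.conj_unit hQ V.2.1) ≫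
          Q ◁ (dual V.1 ◁ ZmulAux P (one_mul α) X V.1 V.2.1 ⊗≫ ev V.1 ▷ Zobj P α X ⊗≫ 𝟙 _)) := by
        rw [crossSwap, Category.assoc, scal_nat_assoc]
    _ = scal (inv (dimL V.1) ≫ dimL V.1) _ ≫ ZmulAux P (one_mul α) X Q hQ := by
        rw [e, scal_nat, scal_comp, Category.assoc]
    _ = _ := by rw [IsIso.inv_hom_id, scal_id, Category.id_comp]

end CrossingAction

/-! ### An abstract description of the crossing functor through Z_α -/

section CrossingData

open PivotalCategory

variable {G : Type w} [Group G] {C : Type u} [Category.{v} C] [Preadditive C]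
  [HasFiniteBiproducts C] [MonoidalCategory C] [PivotalCategory C] [MonoidalPreadditive C]
  {P : GGrading G C} [GCentralizable P] {α : G}

/-- The relation between a functor `Φ` on the graded center and `Z_α`: natural morphisms
`Z_α(A) ⟶ Φ(A)` coequalizing the two morphisms `Z_α(Z₁(A)) ⟶ Z_α(A)`, which for `A = Z₁(X)`
factor the multiplication `Z_α(Z₁(X)) ⟶ Z_α(X)`. -/
structure CrossingData (P : GGrading G C) [GCentralizable P] (α : G)
    (Φ : GradedCenter P ⥤ GradedCenter P) where
  h (A : GradedCenter P) : freeObj P α A.obj ⟶ Φ.obj A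
  h_nat {A B : GradedCenter P} (g : A ⟶ B) : freeMap P α g.f ≫ h B = h A ≫ Φ.map g
  mul_h (A : GradedCenter P) :
    Zmul P (one_mul α) A.obj ≫ (h A).f = Zmap P α (Zact P A) ≫ (h A).f
  j (X : C) : (Φ.obj (freeObj P 1 X)).obj ⟶ Zobj P α X
  j_nat {X X' : C} (f : X ⟶ X') : (Φ.map (freeMap P 1 f)).f ≫ j X' = j X ≫ Zmap P α f
  j_h (A : GradedCenter P) : j A.obj ≫ (h A).f = (Φ.map (freeCounit P A)).f
  h_j (X : C) : (h (freeObj P 1 X)).f ≫ j X = Zmul P (one_mul α) X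

/-- The data for the functor `φ_V`. -/
def crossVData [IsPure C] [IsIdempotentComplete C] (V : InvDimObj P α) :
    CrossingData P α (crossV V) where
  h A := toCross A V
  h_nat g := toCross_nat g V
  mul_h A := Zmul_toCrossE A V
  j X := ofCrossFree V X
  j_nat f := ofCrossFree_nat V f
  j_h A := ofCrossFree_toCrossE A V
  h_j X := toCrossE_ofCrossFree V X

/-- Transport of the data along an isomorphism of functors. -/
def CrossingData.ofIso {Φ Ψ : GradedCenter P ⥤ GradedCenter P} (T : CrossingData P α Φ)
    (e : Φ ≅ Ψ) : CrossingData P α Ψ where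
  h A := T.h A ≫ e.hom.app A
  h_nat g := by rw [reassoc_of% T.h_nat g, e.hom.naturality, Category.assoc]
  mul_h A := by
    rw [RelCenter.comp_f, reassoc_of% T.mul_h A]
  j X := (e.inv.app (freeObj P 1 X)).f ≫ T.j X
  j_nat f := by
    rw [← Category.assoc, ← RelCenter.comp_f, e.inv.naturality, RelCenter.comp_f, Category.assoc,
      T.j_nat, Category.assoc]
  j_h A := by
    rw [RelCenter.comp_f, Category.assoc, reassoc_of% T.j_h A, ← RelCenter.comp_f,
      ← RelCenter.comp_f, e.hom.naturality, Iso.inv_hom_id_app_assoc]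
  h_j X := by
    rw [RelCenter.comp_f, Category.assoc, ← Category.assoc _ _ (T.j X), ← RelCenter.comp_f,
      Iso.hom_inv_id_app, RelCenter.id_f, Category.id_comp, T.h_j]

/-- The data for the crossing functor `φ_α`. -/
def crossingData [IsPure C] [IsIdempotentComplete C] (h : Nonempty (InvDimObj P α)) :
    CrossingData P α (crossing P α h) :=
  haveI := crossDiagram_hasLimit P α h
  -- Every object of a codiscrete category is initial, so the projection of the limit to any single
  -- φ_V is an isomorphism, along which the data are transported.
  haveI := isIso_π_of_isInitial (j := Codiscrete.mk h.some) (IsInitial.ofUnique _)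
    (crossDiagram P α)
  (crossVData h.some).ofIso (asIso (limit.π (crossDiagram P α) (Codiscrete.mk h.some))).symm

end CrossingData

/-! ### Tensoring with a dualizable object preserves coends -/

section Bending

variable {C : Type u} [Category.{v} C] [MonoidalCategory C] [PivotalCategory C]
  {J : Type*} [Category* J] {F : Jᵒᵖ ⥤ J ⥤ C} {W : Cowedge F}

/-- Since - ⊗ X is left adjoint to - ⊗ X*, a morphism out of W ⊗ X can be transposed to one out of
W, where the legs are jointly epimorphic. -/
lemma Cowedge.whisker_hom_ext (hW : IsColimit W) {X M : C} {f g : W.pt ⊗ X ⟶ M}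
    (h : ∀ j, W.π j ▷ X ≫ f = W.π j ▷ X ≫ g) : f = g := by
  let _ := leftPairing X
  apply (tensorRightHomEquiv W.pt X (dual X) M).injective
  apply Cowedge.IsColimit.hom_ext hW
  intro j
  apply (tensorRightHomEquiv _ X (dual X) M).symm.injective
  rw [tensorRightHomEquiv_symm_naturality, tensorRightHomEquiv_symm_naturality,
    Equiv.symm_apply_apply, Equiv.symm_apply_apply]
  exact h j

/-- The existence half of the same adjunction argument: transpose the family, descend it to W, and
transpose back. -/
lemma Cowedge.exists_whisker_desc (hW : IsColimit W) {X M : C}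
    (t : ∀ j : J, (F.obj (op j)).obj j ⊗ X ⟶ M)
    (ht : ∀ ⦃i j : J⦄ (f : i ⟶ j), (F.map f.op).app i ▷ X ≫ t i =
      (F.obj (op j)).map f ▷ X ≫ t j) :
    ∃ d : W.pt ⊗ X ⟶ M, ∀ j, W.π j ▷ X ≫ d = t j := by
  let _ := leftPairing X
  refine ⟨(tensorRightHomEquiv W.pt X (dual X) M).symm
    (Cowedge.IsColimit.desc hW (fun j => tensorRightHomEquiv _ X (dual X) M (t j)) ?_), ?_⟩
  · intro i j f
    apply (tensorRightHomEquiv _ X (dual X) M).symm.injective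
    rw [tensorRightHomEquiv_symm_naturality, tensorRightHomEquiv_symm_naturality,
      Equiv.symm_apply_apply, Equiv.symm_apply_apply]
    exact ht f
  · intro j
    refine (tensorRightHomEquiv_symm_naturality (W.π j) _).symm.trans ?_
    refine (congrArg _ (Cowedge.IsColimit.π_desc hW _ _ j)).trans ?_
    exact Equiv.symm_apply_apply _ _

end Bending

/-! ### The twisted legs that define the action of Z_1 on the coend -/

section Action

open PivotalCategory

variable {G : Type w} [Group G] {C : Type u} [Category.{v} C] [Preadditive C]
  [HasFiniteBiproducts C] [MonoidalCategory C] [PivotalCategory C] [MonoidalPreadditive C]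
  {P : GGrading G C} [GCentralizable P] {α β : G}

lemma Zd_Zantipode (X Y : C) (hY : P.comp 1 Y) :
    Zd P 1 (dual (Zobj P 1 X)) Y hY ≫ Y ◁ Zantipode P X =
      𝟙 _ ⊗≫ (dual (Zobj P 1 X) ⊗ Y) ◁ coev X ⊗≫
      (dual (Zobj P 1 X) ⊗ Y ⊗ X) ◁ coevt Y ▷ dual X ⊗≫
        (dual (Zobj P 1 X) ⊗ Y) ◁ Zd P 1 X (dual Y) (P.isPivotalSub.dual hY) ▷ (Y ⊗ dual X) ⊗≫
          dual (Zobj P 1 X) ◁ evt Y ▷ (Zobj P 1 X ⊗ Y ⊗ dual X) ⊗≫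
            ev (Zobj P 1 X) ▷ (Y ⊗ dual X) ⊗≫ 𝟙 _ := by
  rw [Zantipode, Zd_Zdesc]

/-- The half braiding of the dual of `Z_α(X)`, expressed through the antipode. -/
lemma dagger_freeObj (X Y : C) (hY : P.comp 1 Y) :
    dagger (freeObj P α X).hb Y hY = Zd P 1 (dual (Zobj P α X)) Y hY ≫
      Y ◁ (Zmap P 1 (dualMap (Zmul P (mul_one α) X)) ≫ Zantipode P (Zobj P α X)) := by
  have hY' := P.isPivotalSub.dual hY
  have a := Zd_Zantipode (P := P) (Zobj P α X) Y hY
  have n := Zd_Zmap P 1 (dualMap (Zmul P (mul_one α) X)) Y hY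
  have d := dualMap_ev (Zmul P (mul_one α) X)
  have z := Zd_Zmul_aux P (mul_one α) X (dual Y) hY'
  -- The inverse of the half braiding is by construction its value at Y* bent around Y. This is the
  -- shape in which the antipode is defined, hence the appearance of the antipode in the dual half
  -- braiding.
  have i : ((freeObj P α X).hb.β Y hY).inv =
      𝟙 _ ⊗≫ (Y ⊗ Zobj P α X) ◁ coevt Y ⊗≫
        Y ◁ ZmulAux P (mul_one α) X (dual Y) hY' ▷ Y ⊗≫
          evt Y ▷ (Zobj P α X ⊗ Y) ⊗≫ 𝟙 _ := rfl
  rw [MonoidalCategory.whiskerLeft_comp, reassoc_of% n, a, dagger, i]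
  set N := Zobj P α X
  set m := Zmul P (mul_one α) X
  symm
  calc
    _ = 𝟙 _ ⊗≫ (dualMap m ▷ (Y ⊗ 𝟙_ C) ≫ dual (Zobj P 1 N) ◁ (Y ◁ (coev N ⊗≫
          N ◁ coevt Y ▷ dual N ⊗≫ Zd P 1 N (dual Y) hY' ▷ (Y ⊗ dual N)) ⊗≫
            evt Y ▷ (Zobj P 1 N ⊗ Y ⊗ dual N))) ⊗≫
            ev (Zobj P 1 N) ▷ (Y ⊗ dual N) ⊗≫ 𝟙 _ := by monoidal
    _ = 𝟙 _ ⊗≫ dual N ◁ (Y ◁ (coev N ⊗≫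
          N ◁ coevt Y ▷ dual N ⊗≫ Zd P 1 N (dual Y) hY' ▷ (Y ⊗ dual N)) ⊗≫
            evt Y ▷ (Zobj P 1 N ⊗ Y ⊗ dual N)) ⊗≫
            (dualMap m ▷ Zobj P 1 N ≫ ev (Zobj P 1 N)) ▷ (Y ⊗ dual N) ⊗≫ 𝟙 _ := by
        rw [← whisker_exchange]; monoidal
    _ = 𝟙 _ ⊗≫ dual N ◁ (Y ◁ (coev N ⊗≫
          N ◁ coevt Y ▷ dual N ⊗≫ Zd P 1 N (dual Y) hY' ▷ (Y ⊗ dual N)) ⊗≫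
            (evt Y ▷ (Zobj P 1 N ⊗ Y ⊗ dual N) ≫ 𝟙_ C ◁ m ▷ (Y ⊗ dual N))) ⊗≫
            ev N ▷ (Y ⊗ dual N) ⊗≫ 𝟙 _ := by
        rw [d]; monoidal
    _ = 𝟙 _ ⊗≫ dual N ◁ (Y ◁ (coev N ⊗≫
          N ◁ coevt Y ▷ dual N ⊗≫ (Zd P 1 N (dual Y) hY' ≫ dual Y ◁ m) ▷ (Y ⊗ dual N)) ⊗≫
            (evt Y ▷ (N ⊗ Y ⊗ dual N))) ⊗≫
            ev N ▷ (Y ⊗ dual N) ⊗≫ 𝟙 _ := by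
        rw [← whisker_exchange]; monoidal
    _ = _ := by rw [z]; monoidal

/-- The leg `Z_α(Y)* ⊗ Y ⟶ W` of a cowedge over `cIntegrand`. -/
def cLeg (W : Cowedge (cIntegrand P α β)) (Y : C) (hY : P.comp β Y) :
    dual (Zobj P α Y) ⊗ Y ⟶ W.pt := W.π ⟨Y, hY⟩

lemma cLeg_dinat (W : Cowedge (cIntegrand P α β)) {Y Y' : C} (hY : P.comp β Y)
    (hY' : P.comp β Y') (f : Y ⟶ Y') :
    dualMap (Zmap P α f) ▷ Y ≫ cLeg W Y hY = dual (Zobj P α Y') ◁ f ≫ cLeg W Y' hY' :=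
  Cowedge.condition W
    (ObjectProperty.homMk f : (⟨Y, hY⟩ : (P.comp β).FullSubcategory) ⟶ ⟨Y', hY'⟩)

lemma Zobj_one_mem {X : C} (hX : P.comp β X) : P.comp β (Zobj P 1 X) :=
  Zobj_mem P (by group : (1 : G)⁻¹ * β * 1 = β) hX

/-- The morphism `Z_α(Y)* ⊗ Z₁(Y) ⟶ W` which induces the legs of `W` on the center. -/
def cFreeLeg (W : Cowedge (cIntegrand P α β)) (Y : C) (hY : P.comp β Y) :
    dual (Zobj P α Y) ⊗ Zobj P 1 Y ⟶ W.pt :=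
  dualMap (Zmul P (one_mul α) Y) ▷ Zobj P 1 Y ≫ cLeg W (Zobj P 1 Y) (Zobj_one_mem hY)

/-- Dinaturality of the leg at Z_1(Y) along Z_1(f), combined with naturality of the multiplication
Z_α(Z_1(Y)) → Z_α(Y). -/
lemma cFreeLeg_dinat (W : Cowedge (cIntegrand P α β)) {Y Y' : C} (hY : P.comp β Y)
    (hY' : P.comp β Y') (f : Y ⟶ Y') :
    dualMap (Zmap P α f) ▷ Zobj P 1 Y ≫ cFreeLeg W Y hY =
      dual (Zobj P α Y') ◁ Zmap P 1 f ≫ cFreeLeg W Y' hY' := by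
  have d := cLeg_dinat W (Zobj_one_mem hY) (Zobj_one_mem hY') (Zmap P 1 f)
  rw [cFreeLeg, cFreeLeg, ← comp_whiskerRight_assoc, ← dualMap_comp, ← Zmap_Zmul, dualMap_comp,
    comp_whiskerRight_assoc, d, whisker_exchange_assoc]

/-- The morphism inducing the half braiding of the coend with `X`. -/
def cTwist (W : Cowedge (cIntegrand P α β)) (X : C) (hX : P.comp 1 X) (Y : C)
    (hY : P.comp β Y) : (dual (Zobj P α Y) ⊗ Y) ⊗ X ⟶ X ⊗ W.pt :=
  (α_ _ _ _).hom ≫ dual (Zobj P α Y) ◁ Zd P 1 Y X hX ≫ (α_ _ _ _).inv ≫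
    dagger (freeObj P α Y).hb X hX ▷ Zobj P 1 Y ≫ (α_ _ _ _).hom ≫ X ◁ cFreeLeg W Y hY

/-- The map f passes through the three constituents in turn: the dual half braiding, since Z_α(f) is
a morphism of the center; the free leg, by its dinaturality; and ∂, by naturality. -/
lemma cTwist_dinat (W : Cowedge (cIntegrand P α β)) (X : C) (hX : P.comp 1 X) {Y Y' : C}
    (hY : P.comp β Y) (hY' : P.comp β Y') (f : Y ⟶ Y') :
    dualMap (Zmap P α f) ▷ Y ▷ X ≫ cTwist W X hX Y hY =
      (dual (Zobj P α Y') ◁ f) ▷ X ≫ cTwist W X hX Y' hY' := by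
  have d := cFreeLeg_dinat W hY hY' f
  have z := Zd_Zmap P 1 f X hX
  have c : dualMap (Zmap P α f) ▷ X ≫ dagger (freeObj P α Y).hb X hX =
    dagger (freeObj P α Y').hb X hX ≫ X ◁ dualMap (Zmap P α f) :=
    (RelCenter.dualHom P.isPivotalSub (freeMap P α f)).comm X hX
  rw [cTwist, cTwist]
  calc
    _ = (α_ _ _ _).hom ≫ (dualMap (Zmap P α f) ▷ (Y ⊗ X) ≫ dual (Zobj P α Y) ◁ Zd P 1 Y X hX) ≫
          (α_ _ _ _).inv ≫ dagger (freeObj P α Y).hb X hX ▷ Zobj P 1 Y ≫ (α_ _ _ _).hom ≫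
            X ◁ cFreeLeg W Y hY := by monoidal
    _ = (α_ _ _ _).hom ≫ dual (Zobj P α Y') ◁ Zd P 1 Y X hX ≫ (α_ _ _ _).inv ≫
          (dualMap (Zmap P α f) ▷ X ≫ dagger (freeObj P α Y).hb X hX) ▷ Zobj P 1 Y ≫
            (α_ _ _ _).hom ≫ X ◁ cFreeLeg W Y hY := by
        rw [← whisker_exchange]; monoidal
    _ = (α_ _ _ _).hom ≫ dual (Zobj P α Y') ◁ Zd P 1 Y X hX ≫ (α_ _ _ _).inv ≫
          dagger (freeObj P α Y').hb X hX ▷ Zobj P 1 Y ≫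
            (α_ _ _ _).hom ≫ X ◁ (dualMap (Zmap P α f) ▷ Zobj P 1 Y ≫ cFreeLeg W Y hY) := by
        rw [c]; monoidal
    _ = (α_ _ _ _).hom ≫ dual (Zobj P α Y') ◁ Zd P 1 Y X hX ≫ (α_ _ _ _).inv ≫
          (dagger (freeObj P α Y').hb X hX ▷ Zobj P 1 Y ≫
            (X ⊗ dual (Zobj P α Y')) ◁ Zmap P 1 f) ≫ (α_ _ _ _).hom ≫ X ◁ cFreeLeg W Y' hY' := by
        rw [d]; monoidal
    _ = (α_ _ _ _).hom ≫ dual (Zobj P α Y') ◁ (Zd P 1 Y X hX ≫ X ◁ Zmap P 1 f) ≫ (α_ _ _ _).inv ≫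
          dagger (freeObj P α Y').hb X hX ▷ Zobj P 1 Y' ≫ (α_ _ _ _).hom ≫
            X ◁ cFreeLeg W Y' hY' := by
        rw [← whisker_exchange]; monoidal
    _ = _ := by rw [z]; monoidal

lemma cTwist_nat (W : Cowedge (cIntegrand P α β)) {X X' : C} (hX : P.comp 1 X)
    (hX' : P.comp 1 X') (f : X ⟶ X') (Y : C) (hY : P.comp β Y) :
    (dual (Zobj P α Y) ⊗ Y) ◁ f ≫ cTwist W X' hX' Y hY = cTwist W X hX Y hY ≫ f ▷ W.pt := by
  have z := Zd_nat P 1 Y hX hX' f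
  have d := dagger_nat (freeObj P α Y).hb hX hX' f
  rw [cTwist, cTwist]
  calc
    _ = (α_ _ _ _).hom ≫ dual (Zobj P α Y) ◁ (Y ◁ f ≫ Zd P 1 Y X' hX') ≫ (α_ _ _ _).inv ≫
          dagger (freeObj P α Y).hb X' hX' ▷ Zobj P 1 Y ≫ (α_ _ _ _).hom ≫
            X' ◁ cFreeLeg W Y hY := by monoidal
    _ = (α_ _ _ _).hom ≫ dual (Zobj P α Y) ◁ Zd P 1 Y X hX ≫ (α_ _ _ _).inv ≫
          (dual (Zobj P α Y) ◁ f ≫ dagger (freeObj P α Y).hb X' hX') ▷ Zobj P 1 Y ≫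
            (α_ _ _ _).hom ≫ X' ◁ cFreeLeg W Y hY := by
        rw [z]; monoidal
    _ = (α_ _ _ _).hom ≫ dual (Zobj P α Y) ◁ Zd P 1 Y X hX ≫ (α_ _ _ _).inv ≫
          dagger (freeObj P α Y).hb X hX ▷ Zobj P 1 Y ≫
            (α_ _ _ _).hom ≫ (f ▷ (dual (Zobj P α Y) ⊗ Zobj P 1 Y) ≫ X' ◁ cFreeLeg W Y hY) := by
        rw [d]; monoidal
    _ = _ := by rw [← whisker_exchange]; simp only [Category.assoc]

/-- The comonoidal constraint of Z_1 is ∂ on one tensor factor after the other, and on the dual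
factor ∂ followed by the antipode term is the dual half braiding (`dagger_freeObj`). So the twisted
leg and the stated formula correspond under the universal property of Z_1. -/
lemma cTwist_eq_cAction (W : Cowedge (cIntegrand P α β)) (X : C) (hX : P.comp 1 X) (Y : C)
    (hY : P.comp β Y) : cTwist W X hX Y hY =
      Zd P 1 (dual (Zobj P α Y) ⊗ Y) X hX ≫ X ◁ cAction P α β W ⟨Y, hY⟩ := by
  have c : cAction P α β W ⟨Y, hY⟩ = Zcomul P 1 (dual (Zobj P α Y)) Y ≫
    (Zmap P 1 (dualMap (Zmul P (mul_one α) Y)) ≫ Zantipode P (Zobj P α Y)) ▷ Zobj P 1 Y ≫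
      cFreeLeg W Y hY := by
    change Zcomul P 1 (dual (Zobj P α Y)) Y ≫
      (Zmap P 1 (dualMap (Zmul P (mul_one α) Y)) ≫ Zantipode P (Zobj P α Y) ≫
        dualMap (Zmul P (one_mul α) Y)) ▷ Zobj P 1 Y ≫ cLeg W (Zobj P 1 Y) (Zobj_one_mem hY) = _
    rw [cFreeLeg]
    simp only [comp_whiskerRight, Category.assoc]
  have z := Zd_Zcomul P 1 (dual (Zobj P α Y)) Y X hX
  rw [cTwist, c, dagger_freeObj, MonoidalCategory.whiskerLeft_comp X (Zcomul P 1 _ _),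
    reassoc_of% z]
  monoidal

end Action

/-! ### Legs, half braiding and factorizations of the coend over the graded center -/

section CenterCoend

open PivotalCategory

variable {G : Type w} [Group G] {C : Type u} [Category.{v} C] [Preadditive C]
  [HasFiniteBiproducts C] [MonoidalCategory C] [PivotalCategory C] [MonoidalPreadditive C]
  {P : GGrading G C} [GCentralizable P] {α β : G} {W : Cowedge (cIntegrand P α β)}
  {Φ : GradedCenter P ⥤ GradedCenter P}

/-- For fixed X the twisted legs descend along the coend in Y; their naturality in X then lets the
resulting family descend along the coend Z_1(W). -/
lemma exists_cAction (hW : IsColimit W) : ∃ r : Zobj P 1 W.pt ⟶ W.pt,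
    ∀ (X : C) (hX : P.comp 1 X) (Y : C) (hY : P.comp β Y),
      cLeg W Y hY ▷ X ≫ Zd P 1 W.pt X hX ≫ X ◁ r = cTwist W X hX Y hY := by
  choose t ht using fun (X : C) (hX : P.comp 1 X) =>
    Cowedge.exists_whisker_desc hW (fun Y => cTwist W X hX Y.obj Y.property)
      (fun Y Y' f => cTwist_dinat W X hX Y.property Y'.property f.hom)
  refine ⟨Zdesc P 1 W.pt W.pt t ?_, ?_⟩
  · intro X X' hX hX' f
    apply Cowedge.whisker_hom_ext hW
    intro Y
    have e := ht X hX Y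
    have e' := ht X' hX' Y
    rw [← whisker_exchange_assoc, e', reassoc_of% e]
    exact cTwist_nat W hX hX' f Y.obj Y.property
  · intro X hX Y hY
    rw [Zd_Zdesc]
    exact ht X hX ⟨Y, hY⟩

/-- Both conditions are the same equation, before and after transposition along the universal
property of Z_1; the second form is convenient for testing on legs. -/
lemma cAction_iff (r : Zobj P 1 W.pt ⟶ W.pt) :
    (∀ Y : (P.comp β).FullSubcategory, Zmap P 1 (W.π Y) ≫ r = cAction P α β W Y) ↔
      ∀ (X : C) (hX : P.comp 1 X) (Y : C) (hY : P.comp β Y),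
        cLeg W Y hY ▷ X ≫ Zd P 1 W.pt X hX ≫ X ◁ r = cTwist W X hX Y hY := by
  have key : ∀ (X : C) (hX : P.comp 1 X) (Y : C) (hY : P.comp β Y),
      cLeg W Y hY ▷ X ≫ Zd P 1 W.pt X hX ≫ X ◁ r =
        Zd P 1 (dual (Zobj P α Y) ⊗ Y) X hX ≫ X ◁ (Zmap P 1 (cLeg W Y hY) ≫ r) := by
    intro X hX Y hY
    rw [MonoidalCategory.whiskerLeft_comp, reassoc_of% Zd_Zmap P 1 (cLeg W Y hY) X hX]
  constructor
  · intro h X hX Y hY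
    rw [key, cTwist_eq_cAction, ← h ⟨Y, hY⟩]
    rfl
  · intro h Y
    change Zmap P 1 (cLeg W Y.obj Y.property) ≫ r = _
    apply Zhom_ext
    intro X hX
    rw [← key, h, cTwist_eq_cAction]

lemma cAction_unique (hW : IsColimit W) {r r' : Zobj P 1 W.pt ⟶ W.pt}
    (h : ∀ (X : C) (hX : P.comp 1 X) (Y : C) (hY : P.comp β Y),
        cLeg W Y hY ▷ X ≫ Zd P 1 W.pt X hX ≫ X ◁ r = cTwist W X hX Y hY)
    (h' : ∀ (X : C) (hX : P.comp 1 X) (Y : C) (hY : P.comp β Y),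
        cLeg W Y hY ▷ X ≫ Zd P 1 W.pt X hX ≫ X ◁ r' = cTwist W X hX Y hY) : r = r' := by
  apply Zhom_ext
  intro X hX
  apply Cowedge.whisker_hom_ext hW
  intro Y
  exact (h X hX Y.obj Y.property).trans (h' X hX Y.obj Y.property).symm

/-- The leg `Φ(A)* ⊗ A ⟶ W` of the coend in the graded center. -/
def centerLeg (T : CrossingData P α Φ) (W : Cowedge (cIntegrand P α β)) (A : GradedCenter P)
    (hA : P.comp β A.obj) : dual (Φ.obj A).obj ⊗ A.obj ⟶ W.pt :=
  dualMap (T.h A).f ▷ A.obj ≫ cLeg W A.obj hA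

/-- The half braiding of `Φ(A)* ⊗ A`. -/
abbrev pairHB (Φ : GradedCenter P ⥤ GradedCenter P) (A : GradedCenter P) :
    RelHalfBraiding (P.comp 1) (dual (Φ.obj A).obj ⊗ A.obj) :=
  RelCenter.tensorHB (RelCenter.dualObj P.isPivotalSub (Φ.obj A)) A

/-- As h_A is a morphism of the center, its dual commutes with the dual half braidings. This leaves
∂ on the factor A followed by the free leg, and there the action Z_1(A) → A can be split off,
turning ∂ into the half braiding of A. -/
lemma centerLeg_comm (T : CrossingData P α Φ) {r : Zobj P 1 W.pt ⟶ W.pt}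
    (h : ∀ (X : C) (hX : P.comp 1 X) (Y : C) (hY : P.comp β Y),
      cLeg W Y hY ▷ X ≫ Zd P 1 W.pt X hX ≫ X ◁ r = cTwist W X hX Y hY)
    (A : GradedCenter P) (hA : P.comp β A.obj) (X : C) (hX : P.comp 1 X) :
    centerLeg T W A hA ▷ X ≫ Zd P 1 W.pt X hX ≫ X ◁ r =
      ((pairHB Φ A).β X hX).hom ≫ X ◁ centerLeg T W A hA := by
  have a := Zd_Zact P A X hX
  have c : dualMap (T.h A).f ▷ X ≫ dagger (freeObj P α A.obj).hb X hX =
    dagger (Φ.obj A).hb X hX ≫ X ◁ dualMap (T.h A).f :=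
    (RelCenter.dualHom P.isPivotalSub (T.h A)).comm X hX
  -- This is where the coequalizing property is used: after h_A*, the multiplication may be replaced
  -- by Z_α of the action, and dinaturality carries the action over to the other factor.
  have q : dualMap (T.h A).f ▷ Zobj P 1 A.obj ≫ cFreeLeg W A.obj hA =
      dual (Φ.obj A).obj ◁ Zact P A ≫ centerLeg T W A hA := by
    have d := cLeg_dinat W (Zobj_one_mem hA) hA (Zact P A)
    rw [cFreeLeg, ← comp_whiskerRight_assoc, ← dualMap_comp, T.mul_h, dualMap_comp,
      comp_whiskerRight_assoc, d, centerLeg, whisker_exchange_assoc]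
  have b : ((pairHB Φ A).β X hX).hom = (α_ _ _ _).hom ≫
      dual (Φ.obj A).obj ◁ (A.hb.β X hX).hom ≫ (α_ _ _ _).inv ≫
        dagger (Φ.obj A).hb X hX ▷ A.obj ≫ (α_ _ _ _).hom := rfl
  rw [centerLeg.eq_1 T W A hA, comp_whiskerRight, Category.assoc, h, ← centerLeg.eq_1, cTwist, b,
    ← a]
  calc
    _ = (α_ _ _ _).hom ≫ (dualMap (T.h A).f ▷ (A.obj ⊗ X) ≫
          dual (Zobj P α A.obj) ◁ Zd P 1 A.obj X hX) ≫
          (α_ _ _ _).inv ≫ dagger (freeObj P α A.obj).hb X hX ▷ Zobj P 1 A.obj ≫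
            (α_ _ _ _).hom ≫ X ◁ cFreeLeg W A.obj hA := by monoidal
    _ = (α_ _ _ _).hom ≫ dual (Φ.obj A).obj ◁ Zd P 1 A.obj X hX ≫ (α_ _ _ _).inv ≫
          (dualMap (T.h A).f ▷ X ≫ dagger (freeObj P α A.obj).hb X hX) ▷ Zobj P 1 A.obj ≫
            (α_ _ _ _).hom ≫ X ◁ cFreeLeg W A.obj hA := by
        rw [← whisker_exchange]; monoidal
    _ = (α_ _ _ _).hom ≫ dual (Φ.obj A).obj ◁ Zd P 1 A.obj X hX ≫ (α_ _ _ _).inv ≫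
          dagger (Φ.obj A).hb X hX ▷ Zobj P 1 A.obj ≫
            (α_ _ _ _).hom ≫ X ◁ (dualMap (T.h A).f ▷ Zobj P 1 A.obj ≫ cFreeLeg W A.obj hA) := by
        rw [c]; monoidal
    _ = (α_ _ _ _).hom ≫ dual (Φ.obj A).obj ◁ Zd P 1 A.obj X hX ≫ (α_ _ _ _).inv ≫
          (dagger (Φ.obj A).hb X hX ▷ Zobj P 1 A.obj ≫
            (X ⊗ dual (Φ.obj A).obj) ◁ Zact P A) ≫ (α_ _ _ _).hom ≫
              X ◁ centerLeg T W A hA := by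
        rw [q]; monoidal
    _ = _ := by rw [← whisker_exchange]; monoidal

lemma centerLeg_dinat (T : CrossingData P α Φ) (W : Cowedge (cIntegrand P α β))
    {A B : GradedCenter P} (hA : P.comp β A.obj) (hB : P.comp β B.obj) (g : A ⟶ B) :
    dualMap (Φ.map g).f ▷ A.obj ≫ centerLeg T W A hA =
      dual (Φ.obj B).obj ◁ g.f ≫ centerLeg T W B hB := by
  have d := cLeg_dinat W hA hB g.f
  have n : (T.h A).f ≫ (Φ.map g).f = Zmap P α g.f ≫ (T.h B).f :=
    congrArg RelCenter.Hom.f (T.h_nat g).symm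
  rw [centerLeg, centerLeg, ← comp_whiskerRight_assoc, ← dualMap_comp, n, dualMap_comp,
    comp_whiskerRight_assoc, d, whisker_exchange_assoc]

/-- The comparison `Z_α(Y)* ⊗ Y ⟶ Φ(Z₁(Y))* ⊗ Z₁(Y)`. -/
def toPair (T : CrossingData P α Φ) (Y : C) :
    dual (Zobj P α Y) ⊗ Y ⟶ dual (Φ.obj (freeObj P 1 Y)).obj ⊗ Zobj P 1 Y :=
  dualMap (T.j Y) ▷ Y ≫ dual (Φ.obj (freeObj P 1 Y)).obj ◁ Zunit P Y

/-- Composing j* with h* gives the dual of the multiplication. Dinaturality along the unit Y →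
Z_1(Y) brings in Z_α of the unit, and the unit law cancels the two. Every leg of W thus factors
through a center leg at a free object. -/
lemma toPair_centerLeg (T : CrossingData P α Φ) (W : Cowedge (cIntegrand P α β)) (Y : C)
    (hY : P.comp β Y) :
    toPair T Y ≫ centerLeg T W (freeObj P 1 Y) (Zobj_one_mem hY) = cLeg W Y hY := by
  have d := cLeg_dinat W hY (Zobj_one_mem hY) (Zunit P Y)
  have z := Zmap_Zunit_Zmul P (one_mul α) Y
  have e : dualMap (T.j Y) ≫ dualMap (T.h (freeObj P 1 Y)).f =
      dualMap (Zmul P (one_mul α) Y) := by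
    rw [← dualMap_comp, T.h_j]
  calc
    _ = (dualMap (T.j Y) ≫ dualMap (T.h (freeObj P 1 Y)).f) ▷ Y ≫
          dual (Zobj P α (Zobj P 1 Y)) ◁ Zunit P Y ≫ cLeg W (Zobj P 1 Y) (Zobj_one_mem hY) := by
        rw [toPair, centerLeg, Category.assoc, whisker_exchange_assoc, comp_whiskerRight_assoc]
    _ = (dualMap (Zmul P (one_mul α) Y) ≫ dualMap (Zmap P α (Zunit P Y))) ▷ Y ≫
          cLeg W Y hY := by
        rw [e, ← d, comp_whiskerRight_assoc]
    _ = _ := by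
        rw [← dualMap_comp, z, dualMap_id, id_whiskerRight, Category.id_comp]

lemma centerLeg_whisker_ext (T : CrossingData P α Φ) (hW : IsColimit W) {X M : C}
    {f g : W.pt ⊗ X ⟶ M} (h : ∀ (A : GradedCenter P) (hA : P.comp β A.obj),
      centerLeg T W A hA ▷ X ≫ f = centerLeg T W A hA ▷ X ≫ g) : f = g := by
  apply Cowedge.whisker_hom_ext hW
  rintro ⟨Y, hY⟩
  change cLeg W Y hY ▷ X ≫ f = cLeg W Y hY ▷ X ≫ g
  rw [← toPair_centerLeg T W Y hY, comp_whiskerRight, Category.assoc, Category.assoc, h]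

/-- The half braiding of the coend of `cIntegrand`. -/
def coendHB (T : CrossingData P α Φ) (hW : IsColimit W) (r : Zobj P 1 W.pt ⟶ W.pt)
    (h : ∀ (X : C) (hX : P.comp 1 X) (Y : C) (hY : P.comp β Y),
      cLeg W Y hY ▷ X ≫ Zd P 1 W.pt X hX ≫ X ◁ r = cTwist W X hX Y hY) :
    RelHalfBraiding (P.comp 1) W.pt :=
  RelHalfBraiding.ofLax P.isPivotalSub (fun X hX => Zd P 1 W.pt X hX ≫ X ◁ r)
    (fun hX hY f => by
      rw [reassoc_of% Zd_nat P 1 W.pt hX hY f, ← whisker_exchange, Category.assoc])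
    (fun {X Y} hX hY hXY => by
      -- Pulled back along the center legs, the axiom becomes the same axiom for the half braiding
      -- of Φ(A)* ⊗ A, which is known.
      apply centerLeg_whisker_ext T hW
      intro A hA
      have cX := centerLeg_comm T h A hA X hX
      have cY := centerLeg_comm T h A hA Y hY
      have cXY := centerLeg_comm T h A hA (X ⊗ Y) hXY
      have m := (pairHB Φ A).monoidal hX hY hXY
      set κ := centerLeg T W A hA
      set tX := Zd P 1 W.pt X hX ≫ X ◁ r
      set tY := Zd P 1 W.pt Y hY ≫ Y ◁ r
      rw [cXY, m]
      symm
      calc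
        _ = (α_ _ _ _).inv ≫ (κ ▷ X ≫ tX) ▷ Y ≫ (α_ _ _ _).hom ≫ X ◁ tY ≫ (α_ _ _ _).inv := by
            monoidal
        _ = (α_ _ _ _).inv ≫ ((pairHB Φ A).β X hX).hom ▷ Y ≫ (α_ _ _ _).hom ≫
              X ◁ (κ ▷ Y ≫ tY) ≫ (α_ _ _ _).inv := by
            rw [cX]; monoidal
        _ = _ := by rw [cY]; monoidal)
    (fun hX => by
      apply centerLeg_whisker_ext T hW
      intro A hA
      have c := centerLeg_comm T h A hA (𝟙_ C) hX
      rw [c, (pairHB Φ A).unit_eq hX (P.isPivotalSub.tensor hX hX)]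
      monoidal)

lemma coendHB_hom (T : CrossingData P α Φ) (hW : IsColimit W) (r : Zobj P 1 W.pt ⟶ W.pt)
    (h : ∀ (X : C) (hX : P.comp 1 X) (Y : C) (hY : P.comp β Y),
      cLeg W Y hY ▷ X ≫ Zd P 1 W.pt X hX ≫ X ◁ r = cTwist W X hX Y hY) (X : C)
    (hX : P.comp 1 X) : ((coendHB T hW r h).β X hX).hom = Zd P 1 W.pt X hX ≫ X ◁ r := rfl

/-- A family on the center is restricted to free objects and pulled back along `toPair`; this gives
a dinatural family on C, which descends to W. That the result has the right value at every A, free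
or not, follows from dinaturality along the counit Z_1(A) → A. -/
lemma exists_centerDesc (T : CrossingData P α Φ) (hW : IsColimit W) {M : C}
    (ξ : ∀ A : GradedCenter P, P.comp β A.obj → (dual (Φ.obj A).obj ⊗ A.obj ⟶ M))
    (hξ : ∀ {A B : GradedCenter P} (hA : P.comp β A.obj) (hB : P.comp β B.obj) (g : A ⟶ B),
      dualMap (Φ.map g).f ▷ A.obj ≫ ξ A hA = dual (Φ.obj B).obj ◁ g.f ≫ ξ B hB) :
    ∃ θ : W.pt ⟶ M, ∀ (A : GradedCenter P) (hA : P.comp β A.obj),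
      centerLeg T W A hA ≫ θ = ξ A hA := by
  -- The pulled back family is dinatural because j and the unit are natural and the given family is
  -- dinatural along Z_1(f).
  have dinat : ∀ {Y Y' : C} (hY : P.comp β Y) (hY' : P.comp β Y') (f : Y ⟶ Y'),
      dualMap (Zmap P α f) ▷ Y ≫ toPair T Y ≫ ξ (freeObj P 1 Y) (Zobj_one_mem hY) =
        dual (Zobj P α Y') ◁ f ≫ toPair T Y' ≫ ξ (freeObj P 1 Y') (Zobj_one_mem hY') := by
    intro Y Y' hY hY' f
    have d := hξ (Zobj_one_mem hY) (Zobj_one_mem hY') (freeMap P 1 f)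
    have j : dualMap (Zmap P α f) ≫ dualMap (T.j Y) =
        dualMap (T.j Y') ≫ dualMap (Φ.map (freeMap P 1 f)).f := by
      rw [← dualMap_comp, ← dualMap_comp, T.j_nat]
    calc
      _ = (dualMap (Zmap P α f) ≫ dualMap (T.j Y)) ▷ Y ≫
            dual (Φ.obj (freeObj P 1 Y)).obj ◁ Zunit P Y ≫
              ξ (freeObj P 1 Y) (Zobj_one_mem hY) := by
          rw [toPair, comp_whiskerRight, Category.assoc, Category.assoc]
      _ = dualMap (T.j Y') ▷ Y ≫ dual (Φ.obj (freeObj P 1 Y')).obj ◁ Zunit P Y ≫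
            dualMap (Φ.map (freeMap P 1 f)).f ▷ Zobj P 1 Y ≫
              ξ (freeObj P 1 Y) (Zobj_one_mem hY) := by
          rw [j, comp_whiskerRight, Category.assoc, ← whisker_exchange_assoc]
      _ = dualMap (T.j Y') ▷ Y ≫
            dual (Φ.obj (freeObj P 1 Y')).obj ◁ (Zunit P Y ≫ Zmap P 1 f) ≫
              ξ (freeObj P 1 Y') (Zobj_one_mem hY') := by
          rw [d, MonoidalCategory.whiskerLeft_comp, Category.assoc]
      _ = _ := by
          rw [← Zunit_nat, MonoidalCategory.whiskerLeft_comp, Category.assoc,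
            ← whisker_exchange_assoc, toPair, Category.assoc]
  obtain ⟨θ, fac⟩ : ∃ θ : W.pt ⟶ M, ∀ (Y : C) (hY : P.comp β Y), cLeg W Y hY ≫ θ =
      toPair T Y ≫ ξ (freeObj P 1 Y) (Zobj_one_mem hY) :=
    ⟨Cowedge.IsColimit.desc hW
      (fun Y => toPair T Y.obj ≫ ξ (freeObj P 1 Y.obj) (Zobj_one_mem Y.property))
      (fun Y Y' f => dinat Y.property Y'.property f.hom),
      fun Y hY => Cowedge.IsColimit.π_desc hW _ _ ⟨Y, hY⟩⟩
  refine ⟨θ, fun A hA => ?_⟩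
  · rw [centerLeg, Category.assoc, fac]
    have d := hξ (Zobj_one_mem hA) hA (freeCounit P A)
    -- The composite of j and h is Φ of the counit, so dinaturality applies and leaves the unit
    -- followed by the action on the factor A, which is the identity.
    have j : dualMap (T.h A).f ≫ dualMap (T.j A.obj) = dualMap (Φ.map (freeCounit P A)).f := by
      rw [← dualMap_comp, T.j_h]
    calc
      _ = (dualMap (T.h A).f ≫ dualMap (T.j A.obj)) ▷ A.obj ≫
            dual (Φ.obj (freeObj P 1 A.obj)).obj ◁ Zunit P A.obj ≫
              ξ (freeObj P 1 A.obj) (Zobj_one_mem hA) := by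
          rw [toPair, comp_whiskerRight, Category.assoc, Category.assoc]
      _ = dual (Φ.obj A).obj ◁ (Zunit P A.obj ≫ Zact P A) ≫ ξ A hA := by
          rw [j, ← whisker_exchange_assoc, d, MonoidalCategory.whiskerLeft_comp, Category.assoc]
      _ = _ := by rw [Zunit_Zact, MonoidalCategory.whiskerLeft_id, Category.id_comp]

lemma centerLeg_hom_ext (T : CrossingData P α Φ) (hW : IsColimit W) {M : C} {f g : W.pt ⟶ M}
    (h : ∀ (A : GradedCenter P) (hA : P.comp β A.obj),
      centerLeg T W A hA ≫ f = centerLeg T W A hA ≫ g) : f = g := by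
  apply Cowedge.IsColimit.hom_ext hW
  rintro ⟨Y, hY⟩
  change cLeg W Y hY ≫ f = cLeg W Y hY ≫ g
  rw [← toPair_centerLeg T W Y hY, Category.assoc, Category.assoc, h]

/-- All sources Z_α(Y)* ⊗ Y have degree (α⁻¹βα)⁻¹β, so a morphism from W to an object of any other
degree vanishes on every leg. -/
lemma coend_mem (hW : IsColimit W) : P.comp (α⁻¹ * β⁻¹ * α * β) W.pt := by
  refine P.mem_of_test _ _ fun δ hδ M hM f => ?_
  apply Cowedge.IsColimit.hom_ext hW
  rintro ⟨Y, hY⟩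
  have hZ : P.comp (α⁻¹ * β⁻¹ * α * β) (dual (Zobj P α Y) ⊗ Y) :=
    P.eq_comp (P.tensor (P.dual_mem (Zobj_mem P rfl hY)) hY) (by group)
  change cLeg W Y hY ≫ f = cLeg W Y hY ≫ 0
  rw [P.hom_zero hδ.symm hZ hM (cLeg W Y hY ≫ f), P.hom_zero hδ.symm hZ hM (cLeg W Y hY ≫ 0)]

end CenterCoend

/-! ### The universal property in the graded center -/

section CenterCoendUniversal

open PivotalCategory

variable {G : Type w} [Group G] {C : Type u} [Category.{v} C] [Preadditive C]
  [HasFiniteBiproducts C] [MonoidalCategory C] [PivotalCategory C] [MonoidalPreadditive C]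
  [IsPure C] [IsIdempotentComplete C]
  {P : GGrading G C} [GCentralizable P] {α β : G} {W : Cowedge (cIntegrand P α β)}

/-- Forgetting half braidings is faithful, so dinaturality over the center is an equation in C. -/
lemma centerIntegrand_dinat_iff (hα : Nonempty (InvDimObj P α))
    {A B : (centerComp P β).FullSubcategory} (f : A ⟶ B) {E : GradedCenter P}
    (a : ((centerIntegrand P α β hα).obj (op A)).obj A ⟶ E)
    (b : ((centerIntegrand P α β hα).obj (op B)).obj B ⟶ E)
    (a' : dual ((crossing P α hα).obj A.obj).obj ⊗ A.obj.obj ⟶ E.obj) (ha : a.f = a')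
    (b' : dual ((crossing P α hα).obj B.obj).obj ⊗ B.obj.obj ⟶ E.obj) (hb : b.f = b') :
    ((centerIntegrand P α β hα).map f.op).app A ≫ a =
        ((centerIntegrand P α β hα).obj (op B)).map f ≫ b ↔
      dualMap ((crossing P α hα).map f.hom).f ▷ A.obj.obj ≫ a' =
        dual ((crossing P α hα).obj B.obj).obj ◁ f.hom.f ≫ b' := by
  subst ha hb
  have e₁ : (((centerIntegrand P α β hα).map f.op).app A ≫ a).f =
      (dualMap ((crossing P α hα).map f.hom).f ▷ A.obj.obj ≫
        dual ((crossing P α hα).obj A.obj).obj ◁ 𝟙 A.obj.obj) ≫ a.f := rfl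
  have e₂ : (((centerIntegrand P α β hα).obj (op B)).map f ≫ b).f =
      (𝟙 (dual ((crossing P α hα).obj B.obj).obj) ▷ A.obj.obj ≫
        dual ((crossing P α hα).obj B.obj).obj ◁ f.hom.f) ≫ b.f := rfl
  rw [MonoidalCategory.whiskerLeft_id, Category.comp_id] at e₁
  rw [id_whiskerRight, Category.id_comp] at e₂
  constructor
  · intro h
    exact e₁.symm.trans ((congrArg RelCenter.Hom.f h).trans e₂)
  · intro h
    exact RelCenter.hom_ext (e₁.trans (h.trans e₂.symm))

lemma isCoendOf_center (hα : Nonempty (InvDimObj P α)) (T : CrossingData P α (crossing P α hα))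
    (hW : IsColimit W) (r : Zobj P 1 W.pt ⟶ W.pt)
    (h : ∀ (X : C) (hX : P.comp 1 X) (Y : C) (hY : P.comp β Y),
      cLeg W Y hY ▷ X ≫ Zd P 1 W.pt X hX ≫ X ◁ r = cTwist W X hX Y hY) :
    IsCoendOf (centerIntegrand P α β hα) ⟨W.pt, coendHB T hW r h⟩ := by
  refine ⟨fun A => ⟨centerLeg T W A.obj A.property, fun X hX =>
    centerLeg_comm T h A.obj A.property X hX⟩, fun A B f => ?_, ⟨?_⟩⟩
  · exact (centerIntegrand_dinat_iff hα f _ _ (centerLeg T W A.obj A.property) rfl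
      (centerLeg T W B.obj B.property) rfl).2 (centerLeg_dinat T W A.property B.property f.hom)
  · have key : ∀ c : Cowedge (centerIntegrand P α β hα),
        ∃ θ : (⟨W.pt, coendHB T hW r h⟩ : GradedCenter P) ⟶ c.pt,
          ∀ (A : GradedCenter P) (hA : P.comp β A.obj),
            centerLeg T W A hA ≫ θ.f = (c.π ⟨A, hA⟩).f := by
      intro c
      obtain ⟨θ, hθ⟩ := exists_centerDesc T hW (fun A hA => (c.π ⟨A, hA⟩).f)
        (fun {A B} hA hB g => (centerIntegrand_dinat_iff hα (ObjectProperty.homMk g :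
          (⟨A, hA⟩ : (centerComp P β).FullSubcategory) ⟶ ⟨B, hB⟩) _ _ _ rfl _ rfl).1
            (Cowedge.condition c _))
      refine ⟨⟨θ, fun X hX => ?_⟩, hθ⟩
      -- The factorization found in C respects half braidings: on center legs both sides reduce to
      -- the statement that the given leg is a morphism of the center.
      apply centerLeg_whisker_ext T hW
      intro A hA
      have e := (c.π ⟨A, hA⟩).comm X hX
      have k := centerLeg_comm T h A hA X hX
      rw [coendHB_hom, Category.assoc, reassoc_of% k, ← comp_whiskerRight_assoc,
        hθ, ← MonoidalCategory.whiskerLeft_comp, hθ]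
      exact e
    choose θ hθ using key
    refine Multicofork.IsColimit.mk _ θ (fun c A => RelCenter.hom_ext (hθ c A.obj A.property))
      (fun c m hm => RelCenter.hom_ext (centerLeg_hom_ext T hW fun A hA => ?_))
    rw [hθ]
    exact congrArg RelCenter.Hom.f (hm ⟨A, hA⟩)

end CenterCoendUniversal

/-! ### Recognizing coends and transporting them along isomorphisms -/

lemma Cowedge.nonempty_isColimit_mk {J : Type*} [Category* J] {E : Type*} [Category* E]
    {F : Jᵒᵖ ⥤ J ⥤ E} {X : E} (ρ : ∀ j : J, (F.obj (op j)).obj j ⟶ X)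
    (hρ : ∀ ⦃i j : J⦄ (f : i ⟶ j), (F.map f.op).app i ≫ ρ i = (F.obj (op j)).map f ≫ ρ j)
    (H : ∀ (M : E) (ξ : ∀ j : J, (F.obj (op j)).obj j ⟶ M), (∀ ⦃i j : J⦄ (f : i ⟶ j),
      (F.map f.op).app i ≫ ξ i = (F.obj (op j)).map f ≫ ξ j) → ∃ d : X ⟶ M, ∀ j, ρ j ≫ d = ξ j)
    (ext : ∀ (M : E) (f g : X ⟶ M), (∀ j, ρ j ≫ f = ρ j ≫ g) → f = g) :
    Nonempty (IsColimit (Cowedge.mk X ρ hρ)) := by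
  choose d hd using fun c : Cowedge F => H c.pt c.π (fun _ _ f => Cowedge.condition c f)
  exact ⟨Multicofork.IsColimit.mk _ d hd
    fun c g hg => ext c.pt g (d c) fun j => (hg j).trans (hd c j).symm⟩

lemma Cowedge.exists_isColimit_of_iso {J : Type*} [Category* J] {E : Type*} [Category* E]
    {F : Jᵒᵖ ⥤ J ⥤ E} {X X' : E} {ρ : ∀ j : J, (F.obj (op j)).obj j ⟶ X}
    {hρ : ∀ ⦃i j : J⦄ (f : i ⟶ j), (F.map f.op).app i ≫ ρ i = (F.obj (op j)).map f ≫ ρ j}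
    (hc : IsColimit (Cowedge.mk X ρ hρ)) (e : X ≅ X') :
    ∃ hρ', Nonempty (IsColimit (Cowedge.mk (F := F) X' (fun j => ρ j ≫ e.hom) hρ')) :=
  ⟨fun i j f => by rw [← Category.assoc, hρ f, Category.assoc],
    Cowedge.nonempty_isColimit_mk _ _
      (fun M ξ hξ => by
        obtain ⟨d, hd⟩ : ∃ d : X ⟶ M, ∀ j, ρ j ≫ d = ξ j :=
          ⟨Cowedge.IsColimit.desc hc ξ hξ, fun j => Cowedge.IsColimit.π_desc hc _ _ j⟩
        exact ⟨e.inv ≫ d, fun j => by rw [Category.assoc, Iso.hom_inv_id_assoc, hd]⟩)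
      (fun M f g h => by
        rw [← cancel_epi e.hom]
        refine Cowedge.IsColimit.hom_ext hc fun j => ?_
        change ρ j ≫ e.hom ≫ f = ρ j ≫ e.hom ≫ g
        simpa using h j)⟩

/-! ### Coends of biadditive functors on semisimple categories -/

section SemisimpleCoend

variable {J : Type*} [Category* J] [Preadditive J] {E : Type*} [Category* E] [Preadditive E]

/-- A decomposition of `Y` as a finite direct sum of members of the family `S`. -/
structure SumDecomposition {m : ℕ} (S : Fin m → J) (Y : J) where
  card : ℕ
  idx : Fin card → Fin m
  p (b : Fin card) : Y ⟶ S (idx b)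
  q (b : Fin card) : S (idx b) ⟶ Y
  total : ∑ b, p b ≫ q b = 𝟙 Y

/-- The decomposition of a member of the family `S`. -/
def SumDecomposition.self {m : ℕ} (S : Fin m → J) (a : Fin m) : SumDecomposition S (S a) where
  card := 1
  idx _ := a
  p _ := 𝟙 _
  q _ := 𝟙 _
  total := by simp

/-- Bifunctors which are additive in both variables. -/
structure IsBiadditive (F : Jᵒᵖ ⥤ J ⥤ E) : Prop where
  left {Y Y' : J} (Z : J) (f g : Y ⟶ Y') :
    (F.map (f + g).op).app Z = (F.map f.op).app Z + (F.map g.op).app Z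
  right (Z : J) {Y Y' : J} (f g : Y ⟶ Y') :
    (F.obj (op Z)).map (f + g) = (F.obj (op Z)).map f + (F.obj (op Z)).map g

namespace IsBiadditive

variable {F : Jᵒᵖ ⥤ J ⥤ E}

lemma left_sum (hF : IsBiadditive F)
    {ι : Type*} (s : Finset ι) {Y Y' : J} (Z : J) (f : ι → (Y ⟶ Y')) :
    (F.map (∑ i ∈ s, f i).op).app Z = ∑ i ∈ s, (F.map (f i).op).app Z :=
  map_sum (AddMonoidHom.mk' (fun f : Y ⟶ Y' => (F.map f.op).app Z) (hF.left Z)) f s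

lemma right_sum (hF : IsBiadditive F)
    {ι : Type*} (s : Finset ι) (Z : J) {Y Y' : J} (f : ι → (Y ⟶ Y')) :
    (F.obj (op Z)).map (∑ i ∈ s, f i) = ∑ i ∈ s, (F.obj (op Z)).map (f i) :=
  map_sum (AddMonoidHom.mk' (fun f : Y ⟶ Y' => (F.obj (op Z)).map f) (hF.right Z)) f s

lemma left_zero (hF : IsBiadditive F) (Y Y' Z : J) : (F.map (0 : Y ⟶ Y').op).app Z = 0 :=
  map_zero (AddMonoidHom.mk' (fun f : Y ⟶ Y' => (F.map f.op).app Z) (hF.left Z))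

lemma right_zero (hF : IsBiadditive F) (Z Y Y' : J) : (F.obj (op Z)).map (0 : Y ⟶ Y') = 0 :=
  map_zero (AddMonoidHom.mk' (fun f : Y ⟶ Y' => (F.obj (op Z)).map f) (hF.right Z))

end IsBiadditive

variable [HasFiniteBiproducts E] (F : Jᵒᵖ ⥤ J ⥤ E) {m : ℕ} (S : Fin m → J)

/-- For `p : Y ⟶ S a` and `q : S a ⟶ Y'`, the morphism `F(Y', Y) ⟶ ⊕ F(S a, S a)`. -/
def sumLeg {Y Y' : J} {a : Fin m} (p : Y ⟶ S a) (q : S a ⟶ Y') :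
    (F.obj (op Y')).obj Y ⟶ ⨁ fun a => (F.obj (op (S a))).obj (S a) :=
  (F.map q.op).app Y ≫ (F.obj (op (S a))).map p ≫
    biproduct.ι (fun a => (F.obj (op (S a))).obj (S a)) a

lemma map_app_sumLeg {Y Y' Y'' : J} {a : Fin m} (p : Y ⟶ S a) (q : S a ⟶ Y') (f : Y' ⟶ Y'') :
    (F.map f.op).app Y ≫ sumLeg F S p q = sumLeg F S p (q ≫ f) := by
  simp [sumLeg]

lemma map_sumLeg {Y Y' Y'' : J} {a : Fin m} (p : Y ⟶ S a) (q : S a ⟶ Y') (f : Y'' ⟶ Y) :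
    (F.obj (op Y')).map f ≫ sumLeg F S p q = sumLeg F S (f ≫ p) q := by
  simp [sumLeg]

variable {F S}

/-- For a ≠ b both sides contain a zero morphism. For a = b the endomorphism passes from one
variable of F to the other by the assumption on endomorphisms. -/
lemma sumLeg_slide (hF : IsBiadditive F) (hne : ∀ {a b : Fin m}, a ≠ b → ∀ f : S a ⟶ S b, f = 0)
    (heq : ∀ (a : Fin m) (f : S a ⟶ S a),
      (F.map f.op).app (S a) = (F.obj (op (S a))).map f)
    {Y Y' : J} {a b : Fin m} (p : Y ⟶ S a) (f : S a ⟶ S b) (q : S b ⟶ Y') :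
    sumLeg F S (p ≫ f) q = sumLeg F S p (f ≫ q) := by
  by_cases h : a = b
  · subst h
    rw [← map_sumLeg, ← map_app_sumLeg]
    have n := (F.map q.op).naturality f
    have e := heq a f
    calc
      _ = (F.obj (op Y')).map p ≫ ((F.obj (op Y')).map f ≫ (F.map q.op).app (S a)) ≫
            biproduct.ι (fun a => (F.obj (op (S a))).obj (S a)) a := by
          simp [sumLeg]
      _ = _ := by
          rw [n, ← e]; simp [sumLeg]
  · rw [hne h f, zero_comp, comp_zero, sumLeg, sumLeg, hF.left_zero, hF.right_zero]
    simp

lemma sumLeg_sum_right (hF : IsBiadditive F) {ι : Type*} (s : Finset ι) {Y Y' : J} {a : Fin m}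
    (p : Y ⟶ S a) (q : ι → (S a ⟶ Y')) :
    sumLeg F S p (∑ i ∈ s, q i) = ∑ i ∈ s, sumLeg F S p (q i) := by
  simp only [sumLeg, hF.left_sum, Preadditive.sum_comp]

lemma sumLeg_sum_left (hF : IsBiadditive F) {ι : Type*} (s : Finset ι) {Y Y' : J} {a : Fin m}
    (p : ι → (Y ⟶ S a)) (q : S a ⟶ Y') :
    sumLeg F S (∑ i ∈ s, p i) q = ∑ i ∈ s, sumLeg F S (p i) q := by
  simp only [sumLeg, hF.right_sum, Preadditive.sum_comp, Preadditive.comp_sum]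

/-- Expand f into its matrix entries D.q b ≫ f ≫ D'.p c between members of the family, slide each
entry from one variable to the other, and resum. General f gives dinaturality of the legs; f = 𝟙
gives their independence of the decomposition. -/
lemma sum_sumLeg (hF : IsBiadditive F) (hne : ∀ {a b : Fin m}, a ≠ b → ∀ f : S a ⟶ S b, f = 0)
    (heq : ∀ (a : Fin m) (f : S a ⟶ S a),
      (F.map f.op).app (S a) = (F.obj (op (S a))).map f)
    {Y Y' : J} (f : Y ⟶ Y') (D : SumDecomposition S Y) (D' : SumDecomposition S Y') :
    ∑ b, sumLeg F S (D.p b) (D.q b ≫ f) = ∑ b, sumLeg F S (f ≫ D'.p b) (D'.q b) := by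
  have h₁ : ∀ b, D.q b ≫ f = ∑ c, (D.q b ≫ f ≫ D'.p c) ≫ D'.q c := fun b => by
    calc
      _ = D.q b ≫ f ≫ 𝟙 _ := by simp
      _ = _ := by rw [← D'.total]; simp only [Preadditive.comp_sum, Category.assoc]
  have h₂ : ∀ c, f ≫ D'.p c = ∑ b, D.p b ≫ (D.q b ≫ f ≫ D'.p c) := fun c => by
    calc
      _ = 𝟙 _ ≫ f ≫ D'.p c := by simp
      _ = _ := by rw [← D.total]; simp only [Preadditive.sum_comp, Category.assoc]
  calc
    _ = ∑ b, ∑ c, sumLeg F S (D.p b) ((D.q b ≫ f ≫ D'.p c) ≫ D'.q c) := by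
        refine Finset.sum_congr rfl fun b _ => ?_
        rw [← sumLeg_sum_right hF, ← h₁]
    _ = ∑ c, ∑ b, sumLeg F S (D.p b ≫ (D.q b ≫ f ≫ D'.p c)) (D'.q c) := by
        rw [Finset.sum_comm]
        simp only [sumLeg_slide hF hne heq]
    _ = _ := by
        refine Finset.sum_congr rfl fun c _ => ?_
        rw [← sumLeg_sum_left hF, ← h₂]

/-- The coend of a biadditive functor on a category whose objects are direct sums of members of a
finite family of objects with only scalar morphisms between them. -/
theorem exists_coend_biproduct (hF : IsBiadditive F)
    (hne : ∀ {a b : Fin m}, a ≠ b → ∀ f : S a ⟶ S b, f = 0)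
    (heq : ∀ (a : Fin m) (f : S a ⟶ S a),
      (F.map f.op).app (S a) = (F.obj (op (S a))).map f)
    (hD : ∀ Y : J, Nonempty (SumDecomposition S Y)) :
    ∃ (ρ : ∀ Y : J, (F.obj (op Y)).obj Y ⟶ ⨁ fun a => (F.obj (op (S a))).obj (S a))
      (hρ : ∀ ⦃Y Y' : J⦄ (f : Y ⟶ Y'),
        (F.map f.op).app Y ≫ ρ Y = (F.obj (op Y')).map f ≫ ρ Y'),
      (∀ (Y : J) (D : SumDecomposition S Y), ρ Y = ∑ b, sumLeg F S (D.p b) (D.q b)) ∧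
      (∀ a, ρ (S a) = biproduct.ι (fun a => (F.obj (op (S a))).obj (S a)) a) ∧
      Nonempty (IsColimit (Cowedge.mk _ ρ hρ)) := by
  have indep : ∀ (Y : J) (D D' : SumDecomposition S Y),
      ∑ b, sumLeg F S (D.p b) (D.q b) = ∑ b, sumLeg F S (D'.p b) (D'.q b) := fun Y D D' => by
    simpa using sum_sumLeg hF hne heq (𝟙 Y) D D'
  have hself : ∀ a, ∑ b, sumLeg F S ((SumDecomposition.self S a).p b)
      ((SumDecomposition.self S a).q b) =
        biproduct.ι (fun a => (F.obj (op (S a))).obj (S a)) a := fun a => by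
    change ∑ b : Fin 1, sumLeg F S (𝟙 (S a)) (𝟙 (S a)) = _
    simp [sumLeg]
  refine ⟨fun Y => ∑ b, sumLeg F S ((hD Y).some.p b) ((hD Y).some.q b), fun Y Y' f => ?_,
    fun Y D => indep Y _ D, fun a => (indep _ _ (SumDecomposition.self S a)).trans (hself a),
    Cowedge.nonempty_isColimit_mk _ _ (fun M ξ hξ => ?_) (fun M f g h => ?_)⟩
  · simp only [Preadditive.comp_sum, map_app_sumLeg, map_sumLeg]
    exact sum_sumLeg hF hne heq f _ _
  · refine ⟨biproduct.desc fun a => ξ (S a), fun Y => ?_⟩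
    -- By dinaturality of ξ along q, each term contributes F applied to p ≫ q in the covariant
    -- variable, followed by ξ at Y; these maps p ≫ q sum to the identity of Y.
    have h : ∀ {a : Fin m} (p : Y ⟶ S a) (q : S a ⟶ Y), sumLeg F S p q ≫
        biproduct.desc (fun a => ξ (S a)) = (F.obj (op Y)).map (p ≫ q) ≫ ξ Y := fun p q => by
      have e := hξ q
      have n := (F.map q.op).naturality p
      rw [sumLeg, Category.assoc, Category.assoc, biproduct.ι_desc, ← reassoc_of% n, e,
        Functor.map_comp, Category.assoc]
    simp only [Preadditive.sum_comp, h]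
    rw [← Preadditive.sum_comp, ← hF.right_sum, (hD Y).some.total, CategoryTheory.Functor.map_id,
      Category.id_comp]
  · refine biproduct.hom_ext' _ _ fun a => ?_
    -- Each inclusion of a summand is itself a leg, namely the one at S a computed with the trivial
    -- decomposition, so agreement on legs suffices.
    rw [← hself a, indep _ _ (hD (S a)).some]
    exact h (S a)

/-- The coend of a biadditive functor on a category whose objects are direct sums of members of a
finite family of objects `S a` with only scalar morphisms between them is the direct sum of the
objects `F (S a, S a)`. -/
theorem exists_coend_decomposition [HasCoend F] (hF : IsBiadditive F)
    (hne : ∀ {a b : Fin m}, a ≠ b → ∀ f : S a ⟶ S b, f = 0)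
    (heq : ∀ (a : Fin m) (f : S a ⟶ S a),
      (F.map f.op).app (S a) = (F.obj (op (S a))).map f)
    (hD : ∀ Y : J, Nonempty (SumDecomposition S Y)) :
    ∃ e : ∀ a, coend F ⟶ (F.obj (op (S a))).obj (S a),
      (∀ a, coend.ι F (S a) ≫ e a = 𝟙 _) ∧ (∀ a b, a ≠ b → coend.ι F (S a) ≫ e b = 0) ∧
      ∑ a, e a ≫ coend.ι F (S a) = 𝟙 _ := by
  obtain ⟨ρ, hρ, -, hι, ⟨hc⟩⟩ := exists_coend_biproduct hF hne heq hD
  let d := coend.desc ρ hρ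
  have hd : ∀ Y, coend.ι F Y ≫ d = ρ Y := fun Y => coend.ι_desc _ _ Y
  -- The chosen coend and the direct sum are both universal; comparing them transfers the
  -- projections of the direct sum to the chosen coend.
  obtain ⟨d', hd'⟩ : ∃ d' : (⨁ fun a => (F.obj (op (S a))).obj (S a)) ⟶ coend F,
      ∀ Y, ρ Y ≫ d' = coend.ι F Y :=
    ⟨Cowedge.IsColimit.desc hc (coend.ι F) fun _ _ f => coend.condition _ f,
      fun Y => Cowedge.IsColimit.π_desc hc _ _ Y⟩
  have hdd : d ≫ d' = 𝟙 _ := coend.hom_ext fun Y => by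
    rw [← Category.assoc, hd, hd', Category.comp_id]
  refine ⟨fun a => d ≫ biproduct.π _ a, fun a => ?_, fun a b h => ?_, ?_⟩
  · rw [← Category.assoc, hd, hι, biproduct.ι_π_self]
  · rw [← Category.assoc, hd, hι, biproduct.ι_π_ne _ h]
  · simp only [← hd', hι, ← Category.assoc]
    rw [← Preadditive.sum_comp]
    simp only [Category.assoc]
    rw [← Preadditive.comp_sum, biproduct.total, Category.comp_id, hdd]

end SemisimpleCoend

/-! ### Canonical isomorphisms between duals -/

section DualTensor

open PivotalCategory

variable {C : Type u} [Category.{v} C] [MonoidalCategory C]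

/-- Uniqueness of duals: one zigzag identity for each of D and D' makes the comparison D' → D → D'
the identity. Applied twice with the roles exchanged, it gives an isomorphism. -/
lemma dual_comparison {Z D D' : C} (e : D ⊗ Z ⟶ 𝟙_ C) (k : 𝟙_ C ⟶ Z ⊗ D) (e' : D' ⊗ Z ⟶ 𝟙_ C)
    (k' : 𝟙_ C ⟶ Z ⊗ D')
    (h : k ▷ Z ≫ (α_ _ _ _).hom ≫ Z ◁ e = (λ_ Z).hom ≫ (ρ_ Z).inv)
    (h' : D' ◁ k' ≫ (α_ _ _ _).inv ≫ e' ▷ D' = (ρ_ D').hom ≫ (λ_ D').inv) :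
    ((ρ_ D').inv ≫ D' ◁ k ≫ (α_ _ _ _).inv ≫ e' ▷ D ≫ (λ_ D).hom) ≫
      (ρ_ D).inv ≫ D ◁ k' ≫ (α_ _ _ _).inv ≫ e ▷ D' ≫ (λ_ D').hom = 𝟙 D' := by
  calc
    _ = 𝟙 _ ⊗≫ D' ◁ k ⊗≫ (e' ▷ (D ⊗ 𝟙_ C) ≫ 𝟙_ C ◁ (D ◁ k')) ⊗≫ e ▷ D' ⊗≫ 𝟙 _ := by monoidal
    _ = 𝟙 _ ⊗≫ D' ◁ (k ▷ 𝟙_ C ≫ (Z ⊗ D) ◁ k') ⊗≫ (e' ▷ ((D ⊗ Z) ⊗ D') ≫ 𝟙_ C ◁ (e ▷ D')) ⊗≫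
          𝟙 _ := by
        rw [← whisker_exchange]; monoidal
    _ = 𝟙 _ ⊗≫ D' ◁ k' ⊗≫ D' ◁ (k ▷ Z ≫ (α_ _ _ _).hom ≫ Z ◁ e) ▷ D' ⊗≫ e' ▷ D' ⊗≫ 𝟙 _ := by
        rw [← whisker_exchange, ← whisker_exchange]; monoidal
    _ = 𝟙 _ ⊗≫ (D' ◁ k' ≫ (α_ _ _ _).inv ≫ e' ▷ D') ⊗≫ 𝟙 _ := by rw [h]; monoidal
    _ = _ := by rw [h']; monoidal

variable [PivotalCategory C]

/-- The evaluation of `Y* ⊗ X*` on `X ⊗ Y`. -/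
def evTensor (X Y : C) : (dual Y ⊗ dual X) ⊗ (X ⊗ Y) ⟶ 𝟙_ C :=
  𝟙 _ ⊗≫ dual Y ◁ ev X ▷ Y ⊗≫ ev Y

/-- The coevaluation of `Y* ⊗ X*` on `X ⊗ Y`. -/
def coevTensor (X Y : C) : 𝟙_ C ⟶ (X ⊗ Y) ⊗ (dual Y ⊗ dual X) :=
  coev X ⊗≫ X ◁ coev Y ▷ dual X ⊗≫ 𝟙 _

lemma coevTensor_evTensor (X Y : C) :
    (dual Y ⊗ dual X) ◁ coevTensor X Y ≫ (α_ _ _ _).inv ≫ evTensor X Y ▷ (dual Y ⊗ dual X) =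
      (ρ_ _).hom ≫ (λ_ _).inv := by
  dsimp only [evTensor, coevTensor]
  calc
    _ = 𝟙 _ ⊗≫ (dual Y ⊗ dual X) ◁ coev X ⊗≫
          dual Y ◁ ((dual X ⊗ X) ◁ (coev Y ▷ dual X) ≫ ev X ▷ ((Y ⊗ dual Y) ⊗ dual X)) ⊗≫
            ev Y ▷ (dual Y ⊗ dual X) ⊗≫ 𝟙 _ := by monoidal
    _ = 𝟙 _ ⊗≫ dual Y ◁ (dual X ◁ coev X ⊗≫ ev X ▷ dual X) ⊗≫
          (dual Y ◁ coev Y ⊗≫ ev Y ▷ dual Y) ▷ dual X ⊗≫ 𝟙 _ := by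
        rw [whisker_exchange]; monoidal
    _ = _ := by rw [zig_left, zig_left]; monoidal

lemma evTensor_coevTensor (X Y : C) :
    coevTensor X Y ▷ (X ⊗ Y) ≫ (α_ _ _ _).hom ≫ (X ⊗ Y) ◁ evTensor X Y =
      (λ_ _).hom ≫ (ρ_ _).inv := by
  dsimp only [evTensor, coevTensor]
  calc
    _ = 𝟙 _ ⊗≫ coev X ▷ (X ⊗ Y) ⊗≫
          X ◁ (coev Y ▷ ((dual X ⊗ X) ⊗ Y) ≫ (Y ⊗ dual Y) ◁ (ev X ▷ Y)) ⊗≫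
            (X ⊗ Y) ◁ ev Y ⊗≫ 𝟙 _ := by monoidal
    _ = 𝟙 _ ⊗≫ (coev X ▷ X ⊗≫ X ◁ ev X) ▷ Y ⊗≫
          X ◁ (coev Y ▷ Y ⊗≫ Y ◁ ev Y) ⊗≫ 𝟙 _ := by
        rw [← whisker_exchange]; monoidal
    _ = _ := by rw [zag_left, zag_left]; monoidal

lemma dualTensorInv_eq (X Y : C) : dualTensorInv X Y =
    (ρ_ _).inv ≫ dual (X ⊗ Y) ◁ coevTensor X Y ≫ (α_ _ _ _).inv ≫
      ev (X ⊗ Y) ▷ (dual Y ⊗ dual X) ≫ (λ_ _).hom := by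
  rw [dualTensorInv, coevTensor]; monoidal

lemma pivInv_eq (X : C) : pivInv X =
    (ρ_ _).inv ≫ dual (dual X) ◁ coevt X ≫ (α_ _ _ _).inv ≫ ev (dual X) ▷ X ≫ (λ_ _).hom := by
  rw [pivInv]; monoidal

/-- Both (X ⊗ Y)* and Y* ⊗ X* are left duals of X ⊗ Y. -/
instance (X Y : C) : IsIso (dualTensorInv X Y) := by
  rw [dualTensorInv_eq]
  exact ⟨_, dual_comparison _ _ _ _ (evTensor_coevTensor X Y) (coev_ev _),
    dual_comparison _ _ _ _ (ev_coev _) (coevTensor_evTensor X Y)⟩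

/-- Both X** and X are left duals of X*, the latter through the right duality of X. -/
instance (X : C) : IsIso (pivInv X) := by
  rw [pivInv_eq]
  exact ⟨_, dual_comparison _ _ _ _ (evt_coevt X) (coev_ev _),
    dual_comparison _ _ _ _ (ev_coev _) (coevt_evt X)⟩

lemma dualTensorInv_nat_left {X X' : C} (f : X ⟶ X') (Y : C) :
    dualMap (f ▷ Y) ≫ dualTensorInv X Y = dualTensorInv X' Y ≫ dual Y ◁ dualMap f := by
  have e := dualMap_ev (f ▷ Y)
  have c := coev_dualMap f
  dsimp only [dualTensorInv]
  calc
    _ = 𝟙 _ ⊗≫ (dualMap (f ▷ Y) ▷ 𝟙_ C ≫ dual (X ⊗ Y) ◁ (coev X ⊗≫ X ◁ coev Y ▷ dual X)) ⊗≫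
          ev (X ⊗ Y) ▷ (dual Y ⊗ dual X) ⊗≫ 𝟙 _ := by monoidal
    _ = 𝟙 _ ⊗≫ dual (X' ⊗ Y) ◁ (coev X ⊗≫ X ◁ coev Y ▷ dual X) ⊗≫
          (dualMap (f ▷ Y) ▷ (X ⊗ Y) ≫ ev (X ⊗ Y)) ▷ (dual Y ⊗ dual X) ⊗≫ 𝟙 _ := by
        rw [← whisker_exchange]; monoidal
    _ = 𝟙 _ ⊗≫ dual (X' ⊗ Y) ◁ (coev X ⊗≫ (X ◁ (coev Y ▷ dual X) ≫
          f ▷ ((Y ⊗ dual Y) ⊗ dual X))) ⊗≫ ev (X' ⊗ Y) ▷ (dual Y ⊗ dual X) ⊗≫ 𝟙 _ := by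
        rw [e]; monoidal
    _ = 𝟙 _ ⊗≫ dual (X' ⊗ Y) ◁ ((coev X ≫ f ▷ dual X) ⊗≫ X' ◁ coev Y ▷ dual X) ⊗≫
          ev (X' ⊗ Y) ▷ (dual Y ⊗ dual X) ⊗≫ 𝟙 _ := by
        rw [whisker_exchange]; monoidal
    _ = 𝟙 _ ⊗≫ dual (X' ⊗ Y) ◁ (coev X' ⊗≫ X' ◁ (𝟙_ C ◁ dualMap f ≫ coev Y ▷ dual X)) ⊗≫
          ev (X' ⊗ Y) ▷ (dual Y ⊗ dual X) ⊗≫ 𝟙 _ := by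
        rw [← c]; monoidal
    _ = 𝟙 _ ⊗≫ dual (X' ⊗ Y) ◁ (coev X' ⊗≫ X' ◁ coev Y ▷ dual X') ⊗≫
          ((dual (X' ⊗ Y) ⊗ X' ⊗ Y) ◁ (dual Y ◁ dualMap f) ≫
            ev (X' ⊗ Y) ▷ (dual Y ⊗ dual X)) ⊗≫ 𝟙 _ := by
        rw [whisker_exchange]; monoidal
    _ = _ := by rw [whisker_exchange]; monoidal

lemma dualTensorInv_nat_right (X : C) {Y Y' : C} (g : Y ⟶ Y') :
    dualMap (X ◁ g) ≫ dualTensorInv X Y = dualTensorInv X Y' ≫ dualMap g ▷ dual X := by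
  have e := dualMap_ev (X ◁ g)
  have c := coev_dualMap g
  dsimp only [dualTensorInv]
  calc
    _ = 𝟙 _ ⊗≫ (dualMap (X ◁ g) ▷ 𝟙_ C ≫ dual (X ⊗ Y) ◁ (coev X ⊗≫ X ◁ coev Y ▷ dual X)) ⊗≫
          ev (X ⊗ Y) ▷ (dual Y ⊗ dual X) ⊗≫ 𝟙 _ := by monoidal
    _ = 𝟙 _ ⊗≫ dual (X ⊗ Y') ◁ (coev X ⊗≫ X ◁ coev Y ▷ dual X) ⊗≫
          (dualMap (X ◁ g) ▷ (X ⊗ Y) ≫ ev (X ⊗ Y)) ▷ (dual Y ⊗ dual X) ⊗≫ 𝟙 _ := by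
        rw [← whisker_exchange]; monoidal
    _ = 𝟙 _ ⊗≫ dual (X ⊗ Y') ◁ (coev X ⊗≫ X ◁ (coev Y ≫ g ▷ dual Y) ▷ dual X) ⊗≫
          ev (X ⊗ Y') ▷ (dual Y ⊗ dual X) ⊗≫ 𝟙 _ := by
        rw [e]; monoidal
    _ = 𝟙 _ ⊗≫ dual (X ⊗ Y') ◁ (coev X ⊗≫ X ◁ coev Y' ▷ dual X) ⊗≫
          ((dual (X ⊗ Y') ⊗ X ⊗ Y') ◁ (dualMap g ▷ dual X) ≫
            ev (X ⊗ Y') ▷ (dual Y ⊗ dual X)) ⊗≫ 𝟙 _ := by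
        rw [← c]; monoidal
    _ = _ := by rw [whisker_exchange]; monoidal

end DualTensor

/-! ### Additivity and linearity of duals, of Z_α and of the integrands -/

section Additivity

open PivotalCategory

variable {G : Type w} [Group G] {C : Type u} [Category.{v} C] [Preadditive C]
  [HasFiniteBiproducts C] [MonoidalCategory C] [PivotalCategory C] [MonoidalPreadditive C]

lemma dualMap_add {X Y : C} (f g : X ⟶ Y) : dualMap (f + g) = dualMap f + dualMap g := by
  simp [dualMap]

lemma dualMap_sum {ι : Type*} (s : Finset ι) {X Y : C} (f : ι → (X ⟶ Y)) :
    dualMap (∑ i ∈ s, f i) = ∑ i ∈ s, dualMap (f i) :=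
  map_sum (AddMonoidHom.mk' (fun f : X ⟶ Y => dualMap f) dualMap_add) f s

lemma dualMap_zero (X Y : C) : dualMap (0 : X ⟶ Y) = 0 :=
  map_zero (AddMonoidHom.mk' (fun f : X ⟶ Y => dualMap f) dualMap_add)

lemma dualMap_smul {k : Type*} [CommRing k] [Linear k C] [MonoidalLinear k C] (c : k) {X Y : C}
    (f : X ⟶ Y) : dualMap (c • f) = c • dualMap f := by
  simp [dualMap]

lemma isBiadditive_zIntegrand (P : GGrading G C) (α : G)
    (X : C) : IsBiadditive (zIntegrand P α X) where
  left {Y Y'} Z f g := by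
    change dualMap (f.hom + g.hom) ▷ (X ⊗ Z.obj) = dualMap f.hom ▷ (X ⊗ Z.obj) +
      dualMap g.hom ▷ (X ⊗ Z.obj)
    rw [dualMap_add, MonoidalPreadditive.add_whiskerRight]
  right Z {Y Y'} f g := by
    change dual Z.obj ◁ X ◁ (f.hom + g.hom) = dual Z.obj ◁ X ◁ f.hom + dual Z.obj ◁ X ◁ g.hom
    simp

variable (P : GGrading G C) [GCentralizable P] (α : G)

lemma Zmap_add {X X' : C} (f g : X ⟶ X') : Zmap P α (f + g) = Zmap P α f + Zmap P α g := by
  apply Zhom_ext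
  intro Y hY
  rw [Zd_Zmap, MonoidalPreadditive.whiskerLeft_add, Preadditive.comp_add, Zd_Zmap, Zd_Zmap,
    MonoidalPreadditive.add_whiskerRight, Preadditive.add_comp]

lemma Zmap_smul {k : Type*} [CommRing k] [Linear k C] [MonoidalLinear k C] (c : k) {X X' : C}
    (f : X ⟶ X') : Zmap P α (c • f) = c • Zmap P α f := by
  apply Zhom_ext
  intro Y hY
  rw [Zd_Zmap, MonoidalLinear.whiskerLeft_smul, Linear.comp_smul, Zd_Zmap,
    MonoidalLinear.smul_whiskerRight, Linear.smul_comp]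

lemma isBiadditive_cIntegrand (β : G) : IsBiadditive (cIntegrand P α β) where
  left {Y Y'} Z f g := by
    change dualMap (Zmap P α (f.hom + g.hom)) ▷ Z.obj = dualMap (Zmap P α f.hom) ▷ Z.obj +
      dualMap (Zmap P α g.hom) ▷ Z.obj
    rw [Zmap_add, dualMap_add, MonoidalPreadditive.add_whiskerRight]
  right Z {Y Y'} f g := by
    change dual (Zobj P α Z.obj) ◁ (f.hom + g.hom) = dual (Zobj P α Z.obj) ◁ f.hom +
      dual (Zobj P α Z.obj) ◁ g.hom
    simp

end Additivity

/-! ### Decomposing objects of a fusion category within one degree -/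

section FusionDecomposition

open PivotalCategory

variable {k : Type*} [CommRing k] {G : Type w} [Group G] {C : Type u} [Category.{v} C]
  [Preadditive C] [Linear k C] [HasFiniteBiproducts C] [MonoidalCategory C]
  {P : GGrading G C} {n : G → ℕ} {S : ∀ γ : G, Fin (n γ) → C}

/-- Let g generate End(X), with 𝟙 = u g and g² = s g. Then g = u g² = us g = s 𝟙, so every
endomorphism is a multiple of the identity. -/
lemma IsSplitSimple.exists_smul {X : C} (h : IsSplitSimple k X) (f : X ⟶ X) :
    ∃ c : k, f = c • 𝟙 X := by
  obtain ⟨e⟩ := h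
  obtain ⟨u, hu⟩ := e.surjective (𝟙 X)
  obtain ⟨s, hs⟩ := e.surjective (e 1 ≫ e 1)
  obtain ⟨t, ht⟩ := e.surjective f
  have key : ∀ c : k, e c = c • e 1 := fun c => by rw [← map_smul, smul_eq_mul, mul_one]
  have hg : e 1 = s • 𝟙 X := by
    calc
      e 1 = e 1 ≫ 𝟙 X := by simp
      _ = u • (e 1 ≫ e 1) := by rw [← hu, key u, Linear.comp_smul]
      _ = s • 𝟙 X := by rw [← hs, key s, ← hu, key u, smul_smul, smul_smul, mul_comm]
  exact ⟨t * s, by rw [← ht, key t, hg, smul_smul]⟩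

/-- The members of degree `γ` of a representative family. -/
abbrev IsGRepresentative.simpleObj (hS : IsGRepresentative k P n S) (γ : G) (i : Fin (n γ)) :
    (P.comp γ).FullSubcategory := ⟨S γ i, hS.mem γ i⟩

lemma IsGRepresentative.hom_eq_zero (hk : IsGFusion k P) (hS : IsGRepresentative k P n S) {γ : G}
    {i j : Fin (n γ)} (hij : i ≠ j) (f : hS.simpleObj γ i ⟶ hS.simpleObj γ j) : f = 0 := by
  apply InducedCategory.hom_ext
  refine hk.hom_zero (hS.simple γ i) (hS.simple γ j) ⟨fun e => hij ?_⟩ f.hom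
  have h := (hS.unique _ (hS.simple γ i)).unique (y₁ := ⟨γ, i⟩) (y₂ := ⟨γ, j⟩) ⟨Iso.refl _⟩ ⟨e⟩
  simpa using h

lemma IsGRepresentative.nonempty_sumDecomposition (hk : IsGFusion k P)
    (hS : IsGRepresentative k P n S) {γ : G} (Y : (P.comp γ).FullSubcategory) :
    Nonempty (SumDecomposition (hS.simpleObj γ) Y) := by
  classical
  obtain ⟨m, T, hT, ⟨e⟩⟩ := hk.semisimple Y.obj
  choose s hs _ using fun a => hS.unique (T a) (hT a)
  let A := {a : Fin m // (s a).1 = γ}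
  have g : ∀ a : A, ∃ i : Fin (n γ), Nonempty (T a.1 ≅ S γ i) := by
    rintro ⟨a, rfl⟩
    exact ⟨_, hs a⟩
  choose i hi using g
  let φ (a : A) := (hi a).some
  let ε := Fintype.equivFin A
  refine ⟨⟨Fintype.card A, fun b => i (ε.symm b),
    fun b => ObjectProperty.homMk (e.hom ≫ biproduct.π T (ε.symm b).1 ≫ (φ (ε.symm b)).hom),
    fun b => ObjectProperty.homMk ((φ (ε.symm b)).inv ≫ biproduct.ι T (ε.symm b).1 ≫ e.inv), ?_⟩⟩
  -- A simple summand of another degree has no nonzero morphism to Y, so its term in the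
  -- decomposition of the identity vanishes and only the summands indexed by A are kept.
  have hz : ∀ a : Fin m, (s a).1 ≠ γ → biproduct.π T a ≫ biproduct.ι T a = 0 := by
    intro a ha
    have z : biproduct.ι T a ≫ e.inv = 0 := by
      have := P.hom_zero ha (hS.mem _ _) Y.property ((hs a).some.inv ≫ biproduct.ι T a ≫ e.inv)
      rwa [Iso.inv_comp_eq, comp_zero] at this
    rw [← cancel_mono e.inv, Category.assoc, z, comp_zero, zero_comp]
  have tot : ∑ a : A, e.hom ≫ (biproduct.π T a.1 ≫ biproduct.ι T a.1) ≫ e.inv = 𝟙 Y.obj := by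
    rw [← Preadditive.comp_sum, ← Preadditive.sum_comp,
      ← Finset.sum_subtype (Finset.univ.filter fun a => (s a).1 = γ) (by simp)
        (fun a => biproduct.π T a ≫ biproduct.ι T a),
      Finset.sum_filter_of_ne fun a _ h => not_not.1 fun ha => h (hz a ha), biproduct.total]
    simp
  let F : (Y ⟶ Y) →+ (Y.obj ⟶ Y.obj) := AddMonoidHom.mk' (fun f => f.hom) fun _ _ => rfl
  apply InducedCategory.hom_ext
  change F _ = _
  rw [map_sum]
  refine Eq.trans ?_ tot
  refine (Equiv.sum_comp ε.symm (fun a : A => e.hom ≫ (biproduct.π T a.1 ≫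
    biproduct.ι T a.1) ≫ e.inv)).symm ▸ Finset.sum_congr rfl fun b _ => ?_
  change (e.hom ≫ biproduct.π T (ε.symm b).1 ≫ (φ (ε.symm b)).hom) ≫
    (φ (ε.symm b)).inv ≫ biproduct.ι T (ε.symm b).1 ≫ e.inv = _
  simp

end FusionDecomposition

/-- If each A j is the direct sum of the B (i, j) over i, then so is the total sum over pairs. The
formula on inclusions is retained in order to follow the legs of the coend. -/
lemma exists_biproduct_iso {E : Type*} [Category* E] [Preadditive E] [HasFiniteBiproducts E]
    {m m' : ℕ} (A : Fin m' → E) (B : Fin m × Fin m' → E) (f : ∀ i j, A j ⟶ B (i, j))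
    (g : ∀ i j, B (i, j) ⟶ A j) (h_self : ∀ i j, g i j ≫ f i j = 𝟙 _)
    (h_ne : ∀ i i' j, i ≠ i' → g i j ≫ f i' j = 0) (h_total : ∀ j, ∑ i, f i j ≫ g i j = 𝟙 _) :
    ∃ e : ⨁ A ≅ ⨁ B, ∀ j, biproduct.ι A j ≫ e.hom = ∑ i, f i j ≫ biproduct.ι B (i, j) := by
  refine ⟨⟨biproduct.desc fun j => ∑ i, f i j ≫ biproduct.ι B (i, j),
    biproduct.desc fun s => g s.1 s.2 ≫ biproduct.ι A s.2, ?_, ?_⟩, fun j => by simp⟩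
  · refine biproduct.hom_ext' _ _ fun j => ?_
    simp only [biproduct.ι_desc_assoc, Preadditive.sum_comp, Category.assoc, biproduct.ι_desc,
      Category.comp_id]
    simp only [← Category.assoc]
    rw [← Preadditive.sum_comp, h_total, Category.id_comp]
  · refine biproduct.hom_ext' _ _ fun ⟨i, j⟩ => ?_
    simp only [biproduct.ι_desc_assoc, Category.assoc, biproduct.ι_desc, Preadditive.comp_sum,
      Category.comp_id]
    rw [Finset.sum_eq_single i]
    · rw [← Category.assoc, h_self, Category.id_comp]
    · intro i' _ h
      rw [← Category.assoc, h_ne _ _ _ h.symm, zero_comp]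
    · simp

/-! ### The coend in the fusion case -/

section FusionCoend

open PivotalCategory

variable {G : Type w} [Group G] {C : Type u} [Category.{v} C] [Preadditive C]
  [HasFiniteBiproducts C] [MonoidalCategory C]

lemma GGrading.hom_sum (P : GGrading G C) {γ : G} {ι : Type*} (s : Finset ι)
    {X Y : (P.comp γ).FullSubcategory} (f : ι → (X ⟶ Y)) :
    (∑ i ∈ s, f i).hom = ∑ i ∈ s, (f i).hom :=
  map_sum (AddMonoidHom.mk' (fun f : X ⟶ Y => f.hom) fun _ _ => rfl) f s

variable [PivotalCategory C]

/-- The canonical morphism `(i* ⊗ j ⊗ i)* ⊗ j ⟶ i* ⊗ j* ⊗ i ⊗ j`. -/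
def fusionTwist (i j : C) : dual (dual i ⊗ (j ⊗ i)) ⊗ j ⟶ dual i ⊗ (dual j ⊗ (i ⊗ j)) :=
  (dualTensorInv (dual i) (j ⊗ i) ≫ dualTensorInv j i ▷ dual (dual i)) ▷ j ⊗≫
    dual i ◁ dual j ◁ pivInv i ▷ j

instance (i j : C) : IsIso (fusionTwist i j) := by
  unfold fusionTwist monoidalComp
  infer_instance

variable [MonoidalPreadditive C] {P : GGrading G C} [GCentralizable P] {α : G}

/-- Naturality moves q and p to the front, so the explicit leg at Y factors through Z_α(j)* ⊗ j
exactly as the legs of the abstract coend do; what follows depends on i and j only. -/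
lemma fusionRho_eq {i j Y : C} (hi : P.comp α i) (p : Y ⟶ j) (q : j ⟶ Y) :
    fusionRho P α hi p q = dualMap (Zmap P α q) ▷ Y ≫ dual (Zobj P α j) ◁ p ≫
      dualMap (Zrho P α j i hi) ▷ j ≫ fusionTwist i j := by
  have e1 := dualTensorInv_nat_left q i
  have e2 := dualTensorInv_nat_right (dual i) (q ▷ i)
  have e3 : dualMap (Zrho P α Y i hi) ≫ dualMap (dual i ◁ q ▷ i) =
      dualMap (Zmap P α q) ≫ dualMap (Zrho P α j i hi) := by
    rw [← dualMap_comp, ← dualMap_comp, Zrho_Zmap]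
  have e4 : dualMap (Zrho P α Y i hi) ≫ dualTensorInv (dual i) (Y ⊗ i) ≫
      (dualTensorInv Y i ≫ dual i ◁ dualMap q) ▷ dual (dual i) =
        dualMap (Zmap P α q) ≫ dualMap (Zrho P α j i hi) ≫ dualTensorInv (dual i) (j ⊗ i) ≫
          dualTensorInv j i ▷ dual (dual i) := by
    rw [← e1, comp_whiskerRight, ← reassoc_of% e2, reassoc_of% e3]
  dsimp only [fusionRho, fusionTwist]
  calc
    _ = (dualMap (Zrho P α Y i hi) ≫ dualTensorInv (dual i) (Y ⊗ i) ≫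
          (dualTensorInv Y i ≫ dual i ◁ dualMap q) ▷ dual (dual i)) ▷ Y ⊗≫
            dual i ◁ dual j ◁ (pivInv i ▷ Y ≫ i ◁ p) := by monoidal
    _ = dualMap (Zmap P α q) ▷ Y ≫ ((dualMap (Zrho P α j i hi) ≫
          dualTensorInv (dual i) (j ⊗ i) ≫ dualTensorInv j i ▷ dual (dual i)) ▷ Y ≫
            ((dual i ⊗ dual j) ⊗ dual (dual i)) ◁ p) ⊗≫ dual i ◁ dual j ◁ pivInv i ▷ j := by
        rw [e4, ← whisker_exchange (pivInv i) p]; monoidal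
    _ = _ := by rw [← whisker_exchange]; monoidal

variable {k : Type*} [CommRing k] [Linear k C] [MonoidalLinear k C]
  {n : G → ℕ} {S : ∀ γ : G, Fin (n γ) → C}

/-- For a fusion category, `Z_α(X)` is the direct sum of the objects `i* ⊗ X ⊗ i`. -/
lemma IsGRepresentative.exists_Zobj_decomposition (hk : IsGFusion k P)
    (hS : IsGRepresentative k P n S) (α : G) (X : C) :
    ∃ e : ∀ i, Zobj P α X ⟶ dual (S α i) ⊗ (X ⊗ S α i),
      (∀ i, Zrho P α X (S α i) (hS.mem α i) ≫ e i = 𝟙 _) ∧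
      (∀ i j, i ≠ j → Zrho P α X (S α i) (hS.mem α i) ≫ e j = 0) ∧
      ∑ i, e i ≫ Zrho P α X (S α i) (hS.mem α i) = 𝟙 _ := by
  exact exists_coend_decomposition (S := hS.simpleObj α) (isBiadditive_zIntegrand P α X)
    (fun h f => hS.hom_eq_zero hk h f) (fun i f => by
      -- Endomorphisms of a simple object are scalars, and a scalar acts in the same way through
      -- either variable.
      obtain ⟨c, hc⟩ := (hS.simple α i).exists_smul f.hom
      change dualMap f.hom ▷ (X ⊗ S α i) = dual (S α i) ◁ X ◁ f.hom
      rw [hc, dualMap_smul, dualMap_id]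
      simp) (fun Y => hS.nonempty_sumDecomposition hk Y)

/-- The coend of `Z_α(Y)* ⊗ Y` in a fusion category. -/
theorem IsGRepresentative.exists_fusion_coend (hk : IsGFusion k P)
    (hS : IsGRepresentative k P n S) (α β : G) :
    ∃ (ρ : ∀ Y : (P.comp β).FullSubcategory,
        ((cIntegrand P α β).obj (op Y)).obj Y ⟶ fusionC n S α β)
      (hρ : ∀ ⦃Y Y' : (P.comp β).FullSubcategory⦄ (f : Y ⟶ Y'),
        ((cIntegrand P α β).map f.op).app Y ≫ ρ Y =
          ((cIntegrand P α β).obj (op Y')).map f ≫ ρ Y'),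
      (∀ (Y : (P.comp β).FullSubcategory) (D : SimplePartition (S β) Y.obj),
        ρ Y = ∑ i, ∑ b, fusionRho P α (hS.mem α i) (D.p b) (D.q b) ≫
          fusionIncl n S α β i (D.idx b)) ∧
      Nonempty (IsColimit (Cowedge.mk (fusionC n S α β) ρ hρ)) := by
  obtain ⟨ρ, hρ, hf, -, ⟨hc⟩⟩ := exists_coend_biproduct (S := hS.simpleObj β)
    (isBiadditive_cIntegrand P α β) (fun h f => hS.hom_eq_zero hk h f) (fun i f => by
      obtain ⟨c, hc⟩ := (hS.simple β i).exists_smul f.hom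
      change dualMap (Zmap P α f.hom) ▷ S β i = dual (Zobj P α (S β i)) ◁ f.hom
      rw [hc, Zmap_smul, Zmap_id, dualMap_smul, dualMap_id]
      simp) (fun Y => hS.nonempty_sumDecomposition hk Y)
  -- The coend is so far ⊕_j Z_α(j)* ⊗ j; each Z_α(j) is now decomposed over the simple objects of
  -- degree α.
  choose e he hne htot using fun j => hS.exists_Zobj_decomposition hk α (S β j)
  have hcomp : ∀ i i' j, (inv (fusionTwist (S α i) (S β j)) ≫ dualMap (e j i) ▷ S β j) ≫
      dualMap (Zrho P α (S β j) (S α i') (hS.mem α i')) ▷ S β j ≫ fusionTwist (S α i') (S β j) =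
        inv (fusionTwist (S α i) (S β j)) ≫
          dualMap (Zrho P α (S β j) (S α i') (hS.mem α i') ≫ e j i) ▷ S β j ≫
            fusionTwist (S α i') (S β j) := fun i i' j => by
    rw [dualMap_comp, comp_whiskerRight, Category.assoc, Category.assoc]
  obtain ⟨Ψ, hΨ⟩ := exists_biproduct_iso
    (fun j => dual (Zobj P α (S β j)) ⊗ S β j)
    (fun s : Fin (n α) × Fin (n β) => dual (S α s.1) ⊗ (dual (S β s.2) ⊗ (S α s.1 ⊗ S β s.2)))
    (fun i j => dualMap (Zrho P α (S β j) (S α i) (hS.mem α i)) ▷ S β j ≫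
      fusionTwist (S α i) (S β j))
    (fun i j => inv (fusionTwist (S α i) (S β j)) ≫ dualMap (e j i) ▷ S β j)
    (fun i j => by rw [hcomp, he, dualMap_id]; simp)
    -- Dualizing exchanges inclusions and projections of Z_α(j), hence the reversed inequality.
    (fun i i' j h => by rw [hcomp, hne _ _ _ h.symm, dualMap_zero]; simp)
    (fun j => by
      simp only [Category.assoc, IsIso.hom_inv_id_assoc]
      simp only [← comp_whiskerRight, ← dualMap_comp]
      rw [← sum_whiskerRight, ← dualMap_sum, htot, dualMap_id, id_whiskerRight])
  let Ψ' : (⨁ fun j => ((cIntegrand P α β).obj (op (hS.simpleObj β j))).obj (hS.simpleObj β j)) ≅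
    fusionC n S α β := Ψ
  have hleg : ∀ (Y : (P.comp β).FullSubcategory) (j : Fin (n β)) (p : Y ⟶ hS.simpleObj β j)
      (q : hS.simpleObj β j ⟶ Y), sumLeg (cIntegrand P α β) (hS.simpleObj β) p q ≫ Ψ'.hom =
        ∑ i, fusionRho P α (hS.mem α i) p.hom q.hom ≫ fusionIncl n S α β i j := by
    intro Y j p q
    change (dualMap (Zmap P α q.hom) ▷ Y.obj ≫ dual (Zobj P α (S β j)) ◁ p.hom ≫
      biproduct.ι (fun j => dual (Zobj P α (S β j)) ⊗ S β j) j) ≫ Ψ.hom = _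
    rw [Category.assoc, Category.assoc, hΨ, Preadditive.comp_sum, Preadditive.comp_sum]
    refine Finset.sum_congr rfl fun i _ => ?_
    rw [fusionRho_eq]
    simp only [Category.assoc]
    rfl
  obtain ⟨hρ', hc'⟩ := Cowedge.exists_isColimit_of_iso hc Ψ'
  refine ⟨_, hρ', fun Y D => ?_, hc'⟩
  -- Only the completeness relation of the partition is needed for the formula; orthogonality plays
  -- no role here.
  let D' : SumDecomposition (hS.simpleObj β) Y :=
    ⟨D.card, D.idx, fun b => ObjectProperty.homMk (D.p b), fun b => ObjectProperty.homMk (D.q b),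
      InducedCategory.hom_ext ((P.hom_sum _ _).trans D.total)⟩
  have h : ρ Y ≫ Ψ'.hom = ∑ b, sumLeg (cIntegrand P α β) (hS.simpleObj β) (D'.p b) (D'.q b) ≫
      Ψ'.hom := by
    rw [hf Y D', Preadditive.sum_comp]
  refine h.trans (Eq.trans ?_ Finset.sum_comm)
  exact Finset.sum_congr rfl fun b _ => hleg Y _ _ _

end FusionCoend

end GrCen

end

theorem theoremA1 {k : Type*} [CommRing k] {G : Type*} [Group G]
    {C : Type*} [Category* C] [Preadditive C] [Linear k C] [HasFiniteBiproducts C]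
    [MonoidalCategory C] [MonoidalPreadditive C] [MonoidalLinear k C] [PivotalCategory C]
    [IsPure C] [IsIdempotentComplete C]
    (P : GGrading G C) [GCentralizable P] (hdim : ∀ γ : G, Nonempty (InvDimObj P γ)) (α β : G) :
    (∀ W : Cowedge (cIntegrand P α β), IsColimit W →
      ∃ r : Zobj P 1 W.pt ⟶ W.pt,
        (∀ Y : (P.comp β).FullSubcategory, Zmap P 1 (W.π Y) ≫ r = cAction P α β W Y) ∧
        (∀ r' : Zobj P 1 W.pt ⟶ W.pt,
          (∀ Y : (P.comp β).FullSubcategory, Zmap P 1 (W.π Y) ≫ r' = cAction P α β W Y) → r' = r) ∧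
        ∃ σ : RelHalfBraiding (P.comp 1) W.pt,
          (∀ (X : C) (hX : P.comp 1 X), (σ.β X hX).hom = Zd P 1 W.pt X hX ≫ X ◁ r) ∧
          centerComp P (α⁻¹ * β⁻¹ * α * β) ⟨W.pt, σ⟩ ∧
          IsCoendOf (centerIntegrand P α β (hdim α)) ⟨W.pt, σ⟩) ∧
    (IsGFusion k P → ∀ (n : G → ℕ) (S : ∀ γ : G, Fin (n γ) → C)
      (hS : IsGRepresentative k P n S),
      ∃ (ρ : ∀ Y : (P.comp β).FullSubcategory,
          ((cIntegrand P α β).obj (op Y)).obj Y ⟶ fusionC n S α β)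
        (hρ : ∀ ⦃Y Y' : (P.comp β).FullSubcategory⦄ (f : Y ⟶ Y'),
          ((cIntegrand P α β).map f.op).app Y ≫ ρ Y =
            ((cIntegrand P α β).obj (op Y')).map f ≫ ρ Y'),
        (∀ (Y : (P.comp β).FullSubcategory) (D : SimplePartition (S β) Y.obj),
          ρ Y = ∑ i, ∑ b, fusionRho P α (hS.mem α i) (D.p b) (D.q b) ≫
            fusionIncl n S α β i (D.idx b)) ∧
        Nonempty (IsColimit (Cowedge.mk (fusionC n S α β) ρ hρ))) := by
  refine ⟨fun W hW => ?_, fun hk n S hS => hS.exists_fusion_coend hk α β⟩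
  obtain ⟨r, hr⟩ := exists_cAction hW
  exact ⟨r, (cAction_iff r).2 hr,
    fun r' h' => cAction_unique hW ((cAction_iff r').1 h') hr,
    coendHB (crossingData (hdim α)) hW r hr, fun X hX => rfl, coend_mem hW,
    isCoendOf_center (hdim α) _ hW r hr⟩
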